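/- For a finite-dimensional real Lie algebra $\mathfrak g$ put $\mathfrak g^0=\mathfrak g$, $\mathfrak g^{k+1}=[\mathfrak g,\mathfrak g^k]$. A nilpotent $\mathfrak g$ is called quasi-filiform if its nilindex (the least $m$ with $\mathfrak g^m=0$) equals $\dim\mathfrak g-2$. Let $\operatorname{gr}\mathfrak g=\bigoplus_{i\ge 1}\mathfrak g^{i-1}/\mathfrak g^{i}$ with the bracket $[x+\mathfrak g^{i},y+\mathfrak g^{j}]=[x,y]+\mathfrak g^{i+j}$ for $x\in\mathfrak g^{i-1}$, $y\in\mathfrak g^{j-1}$. Everywhere below, brackets of basis vectors that are neither listed nor obtained from listed ones by antisymmetry are zero. Consider the following real Lie algebras of dimension $2n$ with basis $X_0,\dots,X_{2n-1}$. * $L_{2n-1}\oplus\mathbb R$ ($n\ge2$): $[X_0,X_i]=X_{i+1}$ for $1\le i\le 2n-3$. * $L_{2n,r}$ ($n\ge3$, $r$ odd, $3\le r\le 2n-3$): $[X_0,X_i]=X_{i+1}$ for $1\le i\le 2n-3$; $[X_i,X_{r-i}]=(-1)^{i-1}X_{2n-1}$ for $1\le i\le\frac{r-1}2$. * $T_{2n,2n-3}$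 ($n\ge3$): $[X_0,X_i]=X_{i+1}$ for $1\le i\le 2n-4$; $[X_0,X_{2n-1}]=X_{2n-2}$; $[X_i,X_{2n-3-i}]=(-1)^{i-1}X_{2n-1}$ and $[X_i,X_{2n-2-i}]=(-1)^{i-1}(n-1-i)X_{2n-2}$ for $1\le i\le n-2$. * $N_{6,3}$ ($n=3$): $[X_0,X_i]=X_{i+1}$ for $i=1,2,3$; $[X_1,X_2]=X_5$; $[X_1,X_5]=X_4$. **Theorem.** Let $\mathfrak g$ be a real quasi-filiform Lie algebra of dimension $2n$. Then $\operatorname{gr}\mathfrak g$ is isomorphic to one of the algebras above of dimension $2n$, and there is a basis $X_0,\dots,X_{2n-1}$ of $\mathfrak g$ (an adapted basis) such that, for suitable real constants $C_{i,j}^k$: 1. if $\operatorname{gr}\mathfrak g\simeq L_{2n-1}\oplus\mathbb R$, the brackets are $[X_0,X_i]=X_{i+1}$ for $1\le i\le 2n-3$; $[X_i,X_j]=\sum_{k=i+j+1}^{2n-2}C_{i,j}^kX_k$ for $1\le i<j\le 2n-3-i$; $[X_i,X_{2n-1}]=\sum_{k=i+2}^{2n-2}C_{i,2n-1}^kX_k$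 for $1\le i\le 2n-4$. 2. if $\operatorname{gr}\mathfrak g\simeq L_{2n,r}$ ($n\ge 3$, $r$ odd, $3\le r\le 2n-3$), the brackets are $[X_0,X_i]=X_{i+1}$ for $1\le i\le 2n-3$; $[X_0,X_{2n-1}]=\sum_{k=r+2}^{2n-2}C_{0,2n-1}^kX_k$; $[X_i,X_j]=\sum_{k=i+j+1}^{2n-1}C_{i,j}^kX_k$ for $1\le i<j\le r-i-1$; $[X_i,X_j]=\sum_{k=i+j+1}^{2n-2}C_{i,j}^kX_k$ for $1\le i<j\le 2n-3-i$, $r<i+j$; $[X_i,X_{2n-1}]=\sum_{k=r+i+1}^{2n-2}C_{i,2n-1}^kX_k$ for $1\le i\le 2n-3-r$; $[X_1,X_{r-1}]=X_{2n-1}$; $[X_i,X_{r-i}]=(-1)^{i-1}X_{2n-1}+\sum_{k=r+1}^{2n-2}C_{i,r-i}^kX_k$ for $2\le i\le\frac{r-1}2$. 3. if $\operatorname{gr}\mathfrak g\simeq T_{2n,2n-3}$ ($n\ge3$), the brackets are $[X_0,X_i]=X_{i+1}$ for $1\le i\le 2n-4$; $[X_0,X_{2n-1}]=X_{2n-2}$;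 $[X_i,X_j]=\sum_{k=i+j+1}^{2n-1}C_{i,j}^kX_k$ for $1\le i<j\le 2n-4-i$; $[X_1,X_{2n-4}]=X_{2n-1}$; $[X_i,X_{2n-3-i}]=(-1)^{i-1}X_{2n-1}+C_{i,2n-3-i}^{2n-2}X_{2n-2}$ for $2\le i\le n-2$; $[X_i,X_{2n-2-i}]=(-1)^{i-1}(n-1-i)X_{2n-2}$ for $1\le i\le n-2$. 4. if $\operatorname{gr}\mathfrak g\simeq N_{6,3}$ (so $n=3$), then $\mathfrak g\simeq N_{6,3}$, and the brackets are $[X_0,X_i]=X_{i+1}$ for $i=1,2,3$; $[X_1,X_2]=X_5$; $[X_1,X_5]=X_4$. -/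

import Mathlib

open scoped DirectSum

noncomputable section

namespace QuasiFiliform

/-! ### Quasi-filiform Lie algebras -/

/-- A nilpotent Lie algebra is quasi-filiform if its nilindex (the least `m` with `𝔤^m = 0`,
where `𝔤^0 = 𝔤` and `𝔤^(k+1) = [𝔤, 𝔤^k]`) is equal to `dim 𝔤 - 2`. -/
def IsQuasiFiliform (𝔤 : Type*) [LieRing 𝔤] [LieAlgebra ℝ 𝔤] : Prop :=
  LieModule.IsNilpotent 𝔤 𝔤 ∧ LieModule.nilpotencyLength 𝔤 𝔤 + 2 = Module.finrank ℝ 𝔤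

theorem eq_zero_of_eq_neg {M : Type*} [AddCommGroup M] [Module ℝ M] {x : M} (h : x = -x) :
    x = 0 := by
  have h2 : (2 : ℝ) • x = 0 := by
    rw [two_smul]
    nth_rewrite 2 [h]
    exact add_neg_cancel x
  exact (smul_eq_zero.mp h2).resolve_left two_ne_zero

/-! ### The graded Lie algebra of a Lie algebra filtered by its lower central series -/

section Graded

variable (𝔤 : Type*) [LieRing 𝔤] [LieAlgebra ℝ 𝔤]

/-- The term `𝔤^i` of the lower central series, `𝔤^0 = 𝔤`. -/
def lcs (i : ℕ) : Submodule ℝ 𝔤 := (LieModule.lowerCentralSeries ℝ 𝔤 𝔤 i).toSubmodule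

variable {𝔤} in
theorem lcs_anti_succ (i : ℕ) : lcs 𝔤 (i + 1) ≤ lcs 𝔤 i :=
  LieModule.antitone_lowerCentralSeries ℝ 𝔤 𝔤 (Nat.le_succ i)

variable {𝔤} in
theorem lie_mem_lcs (i : ℕ) : ∀ (j : ℕ) {x y : 𝔤}, x ∈ lcs 𝔤 i → y ∈ lcs 𝔤 j →
    ⁅x, y⁆ ∈ lcs 𝔤 (i + j + 1) := by
  induction i with
  | zero =>
    intro j x y _ hy
    have : ⁅x, y⁆ ∈ LieModule.lowerCentralSeries ℝ 𝔤 𝔤 (j + 1) := by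
      rw [LieModule.lowerCentralSeries_succ]
      exact LieSubmodule.lie_mem_lie (LieSubmodule.mem_top x) hy
    simpa [lcs] using this
  | succ i ih =>
    intro j x y hx hy
    have hx' : x ∈ Submodule.span ℝ
        {m | ∃ u ∈ (⊤ : LieIdeal ℝ 𝔤), ∃ v ∈ LieModule.lowerCentralSeries ℝ 𝔤 𝔤 i,
          ⁅u, v⁆ = m} := by
      have h := hx
      rw [lcs, LieModule.lowerCentralSeries_succ,
        LieSubmodule.lieIdeal_oper_eq_linear_span'] at h
      exact h
    clear hx
    induction hx' using Submodule.span_induction with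
    | mem x h =>
      obtain ⟨u, -, v, hv, rfl⟩ := h
      rw [lie_lie]
      have top : ∀ (k : ℕ) (z : 𝔤), z ∈ lcs 𝔤 k → ⁅u, z⁆ ∈ lcs 𝔤 (k + 1) := by
        intro k z hz
        change ⁅u, z⁆ ∈ LieModule.lowerCentralSeries ℝ 𝔤 𝔤 (k + 1)
        rw [LieModule.lowerCentralSeries_succ]
        exact LieSubmodule.lie_mem_lie (LieSubmodule.mem_top u) hz
      refine Submodule.sub_mem _ ?_ ?_
      · have := top _ _ (ih j hv hy)
        rwa [show i + 1 + j + 1 = i + j + 1 + 1 by omega]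
      · have := ih (j + 1) hv (top _ _ hy)
        rwa [show i + 1 + j + 1 = i + (j + 1) + 1 by omega]
    | zero => simp
    | add x x' _ _ h h' => rw [add_lie]; exact Submodule.add_mem _ h h'
    | smul c x _ h => rw [smul_lie]; exact Submodule.smul_mem _ c h

/-- The homogeneous component `W_{i+1} = 𝔤^i / 𝔤^(i+1)`. -/
abbrev GrPiece (i : ℕ) : Type _ := ↥(lcs 𝔤 i) ⧸ (lcs 𝔤 (i + 1)).submoduleOf (lcs 𝔤 i)

/-- The vector space underlying `gr 𝔤`: the direct sum of all the `W_{i+1} = 𝔤^i / 𝔤^(i+1)`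
(those with `i` at least the nilindex are zero). -/
def Gr : Type _ := ⨁ i : ℕ, GrPiece 𝔤 i

instance : AddCommGroup (Gr 𝔤) := inferInstanceAs (AddCommGroup (⨁ i : ℕ, GrPiece 𝔤 i))

instance : Module ℝ (Gr 𝔤) := inferInstanceAs (Module ℝ (⨁ i : ℕ, GrPiece 𝔤 i))

/-- The inclusion of `W_{i+1}` in `gr 𝔤`. -/
def Gr.incl (i : ℕ) : GrPiece 𝔤 i →ₗ[ℝ] Gr 𝔤 := DirectSum.lof ℝ ℕ (GrPiece 𝔤) i

/-- The linear map `𝔤^i → gr 𝔤` that sends `x` to its class in `W_{i+1} = 𝔤^i / 𝔤^(i+1)`. -/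
def Gr.cls (i : ℕ) : ↥(lcs 𝔤 i) →ₗ[ℝ] Gr 𝔤 :=
  (Gr.incl 𝔤 i).comp ((lcs 𝔤 (i + 1)).submoduleOf (lcs 𝔤 i)).mkQ

variable {𝔤}

theorem Gr.cls_eq_zero {i : ℕ} (x : ↥(lcs 𝔤 i)) (hx : (x : 𝔤) ∈ lcs 𝔤 (i + 1)) :
    Gr.cls 𝔤 i x = 0 := by
  have : ((lcs 𝔤 (i + 1)).submoduleOf (lcs 𝔤 i)).mkQ x = 0 := by
    rw [Submodule.mkQ_apply, Submodule.Quotient.mk_eq_zero]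
    exact hx
  rw [Gr.cls, LinearMap.comp_apply, this, map_zero]

theorem Gr.cls_congr {i j : ℕ} (h : i = j) (x : ↥(lcs 𝔤 i)) (y : ↥(lcs 𝔤 j))
    (hxy : (x : 𝔤) = y) : Gr.cls 𝔤 i x = Gr.cls 𝔤 j y := by
  subst h
  rw [Subtype.ext hxy]

/-- The bilinear map `(x, y) ↦ [x, y] + 𝔤^(i+j+2)` on `𝔤^i × 𝔤^j`. -/
def Gr.preBracket (i j : ℕ) : ↥(lcs 𝔤 i) →ₗ[ℝ] ↥(lcs 𝔤 j) →ₗ[ℝ] Gr 𝔤 :=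
  LinearMap.mk₂ ℝ
    (fun x y => Gr.cls 𝔤 (i + j + 1) ⟨⁅(x : 𝔤), (y : 𝔤)⁆, lie_mem_lcs i j x.2 y.2⟩)
    (fun x x' y => by rw [← map_add]; congr 1; ext; simp)
    (fun c x y => by rw [← map_smul]; congr 1; ext; simp)
    (fun x y y' => by rw [← map_add]; congr 1; ext; simp)
    (fun c x y => by rw [← map_smul]; congr 1; ext; simp)

/-- The bilinear map `(x + 𝔤^(i+1), y + 𝔤^(j+1)) ↦ [x, y] + 𝔤^(i+j+2)` on
`W_{i+1} × W_{j+1}`, with values in `W_{i+j+2}`. -/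
def Gr.pieceBracket (i j : ℕ) : GrPiece 𝔤 i →ₗ[ℝ] GrPiece 𝔤 j →ₗ[ℝ] Gr 𝔤 :=
  Submodule.liftQ _
    (LinearMap.flip (Submodule.liftQ _ (LinearMap.flip (Gr.preBracket i j)) (by
      intro y hy
      rw [LinearMap.mem_ker]
      ext x
      exact Gr.cls_eq_zero _
        (lie_mem_lcs i (j + 1) x.2 hy)))) (by
    intro x hx
    rw [LinearMap.mem_ker]
    ext y
    refine Gr.cls_eq_zero _ ?_
    have := lie_mem_lcs (i + 1) j hx y.2
    rwa [show i + 1 + j + 1 = i + j + 1 + 1 by omega] at this)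

/-- The linear map on `gr 𝔤` with given restrictions to the components. -/
def Gr.lift {M : Type*} [AddCommGroup M] [Module ℝ M] (f : ∀ i, GrPiece 𝔤 i →ₗ[ℝ] M) :
    Gr 𝔤 →ₗ[ℝ] M :=
  DirectSum.toModule ℝ ℕ M f

theorem Gr.lift_cls {M : Type*} [AddCommGroup M] [Module ℝ M]
    (f : ∀ i, GrPiece 𝔤 i →ₗ[ℝ] M) (i : ℕ) (x : ↥(lcs 𝔤 i)) :
    Gr.lift f (Gr.cls 𝔤 i x) = f i (Submodule.Quotient.mk x) :=
  DirectSum.toModule_lof ℝ i _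

/-- The bracket of `gr 𝔤` as a bilinear map. -/
def Gr.bracket : Gr 𝔤 →ₗ[ℝ] Gr 𝔤 →ₗ[ℝ] Gr 𝔤 :=
  Gr.lift fun i => LinearMap.flip (Gr.lift fun j => LinearMap.flip (Gr.pieceBracket i j))

theorem Gr.bracket_cls {i j : ℕ} (x : ↥(lcs 𝔤 i)) (y : ↥(lcs 𝔤 j)) :
    Gr.bracket (Gr.cls 𝔤 i x) (Gr.cls 𝔤 j y) =
      Gr.cls 𝔤 (i + j + 1) ⟨⁅(x : 𝔤), (y : 𝔤)⁆, lie_mem_lcs i j x.2 y.2⟩ := by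
  rw [Gr.bracket, Gr.lift_cls, LinearMap.flip_apply, Gr.lift_cls]
  rfl

/-- `gr 𝔤` is additively generated by the classes of elements of the `𝔤^i`. -/
theorem Gr.induction {P : Gr 𝔤 → Prop} (h0 : P 0) (hc : ∀ i x, P (Gr.cls 𝔤 i x))
    (ha : ∀ a b, P a → P b → P (a + b)) (a : Gr 𝔤) : P a := by
  refine DirectSum.induction_on (motive := P) a h0 ?_ ha
  intro i x
  obtain ⟨x, rfl⟩ := Submodule.Quotient.mk_surjective _ x
  exact hc i x

theorem Gr.bracket_skew (a b : Gr 𝔤) : Gr.bracket a b = -Gr.bracket b a := by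
  induction a using Gr.induction with
  | h0 => simp
  | ha a a' h h' => simp only [map_add, LinearMap.add_apply, h, h', neg_add]
  | hc i x =>
    induction b using Gr.induction with
    | h0 => simp
    | ha b b' h h' => simp only [map_add, LinearMap.add_apply, h, h', neg_add]
    | hc j y =>
      rw [Gr.bracket_cls, Gr.bracket_cls, ← map_neg]
      exact Gr.cls_congr (by omega) _ _ (lie_skew (x : 𝔤) (y : 𝔤)).symm

theorem Gr.bracket_jacobi (a b c : Gr 𝔤) : Gr.bracket a (Gr.bracket b c) =
    Gr.bracket (Gr.bracket a b) c + Gr.bracket b (Gr.bracket a c) := by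
  induction a using Gr.induction with
  | h0 => simp
  | ha a a' h h' => simp only [map_add, LinearMap.add_apply, h, h']; abel
  | hc i x =>
    induction b using Gr.induction with
    | h0 => simp
    | ha b b' h h' => simp only [map_add, LinearMap.add_apply, h, h']; abel
    | hc j y =>
      induction c using Gr.induction with
      | h0 => simp
      | ha c c' h h' => simp only [map_add, h, h']; abel
      | hc k z =>
        simp only [Gr.bracket_cls]
        rw [Gr.cls_congr (show i + j + 1 + k + 1 = i + (j + k + 1) + 1 by omega)
            ⟨⁅⁅(x : 𝔤), (y : 𝔤)⁆, (z : 𝔤)⁆, _⟩ ⟨⁅⁅(x : 𝔤), (y : 𝔤)⁆, (z : 𝔤)⁆, by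
              have := lie_mem_lcs (i + j + 1) k (lie_mem_lcs i j x.2 y.2) z.2
              rwa [show i + j + 1 + k + 1 = i + (j + k + 1) + 1 by omega] at this⟩ rfl,
          Gr.cls_congr (show j + (i + k + 1) + 1 = i + (j + k + 1) + 1 by omega)
            ⟨⁅(y : 𝔤), ⁅(x : 𝔤), (z : 𝔤)⁆⁆, _⟩ ⟨⁅(y : 𝔤), ⁅(x : 𝔤), (z : 𝔤)⁆⁆, by
              have := lie_mem_lcs j (i + k + 1) y.2 (lie_mem_lcs i k x.2 z.2)
              rwa [show j + (i + k + 1) + 1 = i + (j + k + 1) + 1 by omega] at this⟩ rfl,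
          ← map_add]
        congr 1
        ext
        exact leibniz_lie (x : 𝔤) (y : 𝔤) (z : 𝔤)

/-- The bracket of `gr 𝔤`: `[x + 𝔤^(i+1), y + 𝔤^(j+1)] = [x, y] + 𝔤^(i+j+2)` for `x ∈ 𝔤^i` and
`y ∈ 𝔤^j`. -/
instance : LieRing (Gr 𝔤) where
  bracket a b := Gr.bracket a b
  add_lie a b c := LinearMap.map_add₂ _ a b c
  lie_add a b c := map_add (Gr.bracket a) b c
  lie_self a := eq_zero_of_eq_neg (Gr.bracket_skew a a)
  leibniz_lie a b c := Gr.bracket_jacobi a b c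

instance : LieAlgebra ℝ (Gr 𝔤) where
  lie_smul c a b := map_smul (Gr.bracket a) c b

end Graded

/-! ### Lie algebras given by a table of brackets -/

/-- The bracket on `ℝ^N` whose value on the standard basis vectors `e_i, e_j` is `t i j` for
`i < j`, and `- t j i` for `j < i`. -/
def tableBracket {N : ℕ} (t : Fin N → Fin N → (Fin N → ℝ)) (x y : Fin N → ℝ) : Fin N → ℝ :=
  ∑ i, ∑ j, (x i * y j) • (if i < j then t i j else if j < i then -t j i else 0)

/-- A table of brackets `[e_i, e_j] = t i j`, `i < j`, that satisfies the Jacobi identity. -/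
structure LieTable (N : ℕ) where
  t : Fin N → Fin N → (Fin N → ℝ)
  jacobi : ∀ i j k : Fin N, i < j → j < k →
    tableBracket t (Pi.single i 1) (t j k) =
      tableBracket t (t i j) (Pi.single k 1) + tableBracket t (Pi.single j 1) (t i k)

/-- The bracket of a table as a bilinear map. -/
def tableLin {N : ℕ} (t : Fin N → Fin N → (Fin N → ℝ)) :
    (Fin N → ℝ) →ₗ[ℝ] (Fin N → ℝ) →ₗ[ℝ] (Fin N → ℝ) :=
  LinearMap.mk₂ ℝ (tableBracket t)
    (fun x x' y => by simp only [tableBracket, Pi.add_apply, add_mul, add_smul, Finset.sum_add_distrib])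
    (fun c x y => by simp only [tableBracket, Finset.smul_sum, smul_smul, Pi.smul_apply,
      smul_eq_mul, mul_assoc])
    (fun x y y' => by simp only [tableBracket, Pi.add_apply, mul_add, add_smul, Finset.sum_add_distrib])
    (fun c x y => by simp only [tableBracket, Finset.smul_sum, smul_smul, Pi.smul_apply,
      smul_eq_mul, mul_left_comm])

theorem tableLin_apply {N : ℕ} (t : Fin N → Fin N → (Fin N → ℝ)) (x y : Fin N → ℝ) :
    tableLin t x y = tableBracket t x y := rfl

theorem tableBracket_single {N : ℕ} (t : Fin N → Fin N → (Fin N → ℝ)) (i j : Fin N) :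
    tableBracket t (Pi.single i 1) (Pi.single j 1) =
      if i < j then t i j else if j < i then -t j i else 0 := by
  rw [tableBracket, Finset.sum_eq_single i, Finset.sum_eq_single j]
  · simp
  · intro b _ hb; simp [hb]
  · simp
  · intro b _ hb; simp [hb]
  · simp

theorem tableBracket_skew {N : ℕ} (t : Fin N → Fin N → (Fin N → ℝ)) (x y : Fin N → ℝ) :
    tableBracket t x y = -tableBracket t y x := by
  rw [tableBracket, tableBracket, Finset.sum_comm, ← Finset.sum_neg_distrib]
  refine Finset.sum_congr rfl fun i _ => ?_
  rw [← Finset.sum_neg_distrib]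
  refine Finset.sum_congr rfl fun j _ => ?_
  rw [← smul_neg, mul_comm]
  congr 1
  rcases lt_trichotomy i j with h | h | h
  · simp [h, h.asymm]
  · simp [h]
  · simp [h, h.asymm]

/-- The Jacobi expression of a table. -/
def tableJac {N : ℕ} (t : Fin N → Fin N → (Fin N → ℝ)) (x y z : Fin N → ℝ) : Fin N → ℝ :=
  tableLin t x (tableLin t y z) - tableLin t (tableLin t x y) z - tableLin t y (tableLin t x z)

theorem tableLin_skew {N : ℕ} (t : Fin N → Fin N → (Fin N → ℝ)) (x y : Fin N → ℝ) :
    tableLin t x y = -tableLin t y x := tableBracket_skew t x y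

theorem tableJac_swap {N : ℕ} (t : Fin N → Fin N → (Fin N → ℝ)) (x y z : Fin N → ℝ) :
    tableJac t x y z = -tableJac t y x z := by
  have h : tableLin t (tableLin t y x) z = -tableLin t (tableLin t x y) z := by
    rw [tableLin_skew t y x, map_neg, LinearMap.neg_apply]
  simp only [tableJac, h]
  abel

theorem tableJac_swap' {N : ℕ} (t : Fin N → Fin N → (Fin N → ℝ)) (x y z : Fin N → ℝ) :
    tableJac t x y z = -tableJac t x z y := by
  have h1 : tableLin t (tableLin t x y) z = -tableLin t z (tableLin t x y) := tableLin_skew t _ _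
  have h2 : tableLin t (tableLin t x z) y = -tableLin t y (tableLin t x z) := tableLin_skew t _ _
  have h3 : tableLin t x (tableLin t z y) = -tableLin t x (tableLin t y z) := by
    rw [tableLin_skew t z y, map_neg]
  simp only [tableJac, h1, h2, h3]
  abel

theorem LieTable.jac_single {N : ℕ} (T : LieTable N) (i j k : Fin N) :
    tableJac T.t (Pi.single i 1) (Pi.single j 1) (Pi.single k 1) = 0 := by
  have hs : ∀ x y z : Fin N → ℝ, tableJac T.t x y z = 0 → tableJac T.t y x z = 0 := by
    intro x y z h; rw [tableJac_swap, h, neg_zero]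
  have hs' : ∀ x y z : Fin N → ℝ, tableJac T.t x y z = 0 → tableJac T.t x z y = 0 := by
    intro x y z h; rw [tableJac_swap', h, neg_zero]
  have h1 : ∀ x z : Fin N → ℝ, tableJac T.t x x z = 0 := by
    intro x z; exact eq_zero_of_eq_neg (tableJac_swap T.t x x z)
  have h2 : ∀ x z : Fin N → ℝ, tableJac T.t x z z = 0 := by
    intro x z; exact eq_zero_of_eq_neg (tableJac_swap' T.t x z z)
  have key : ∀ i j k : Fin N, i < j → j < k →
      tableJac T.t (Pi.single i 1) (Pi.single j 1) (Pi.single k 1) = 0 := by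
    intro i j k hij hjk
    simp only [tableJac, tableLin_apply, tableBracket_single, hij, hjk, hij.trans hjk, if_true]
    rw [T.jacobi i j k hij hjk]
    abel
  rcases lt_trichotomy i j with hij | rfl | hij
  · rcases lt_trichotomy j k with hjk | rfl | hjk
    · exact key _ _ _ hij hjk
    · exact h2 _ _
    · rcases lt_trichotomy i k with hik | rfl | hik
      · exact hs' _ _ _ (key _ _ _ hik hjk)
      · exact hs' _ _ _ (h1 _ _)
      · exact hs' _ _ _ (hs _ _ _ (key _ _ _ hik hij))
  · exact h1 _ _
  · rcases lt_trichotomy i k with hik | rfl | hik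
    · exact hs _ _ _ (key _ _ _ hij hik)
    · exact hs _ _ _ (h2 _ _)
    · rcases lt_trichotomy j k with hjk | rfl | hjk
      · exact hs _ _ _ (hs' _ _ _ (key _ _ _ hjk hik))
      · exact h2 _ _
      · exact hs _ _ _ (hs' _ _ _ (hs _ _ _ (key _ _ _ hjk hij)))

theorem LieTable.jac {N : ℕ} (T : LieTable N) (x y z : Fin N → ℝ) :
    tableJac T.t x y z = 0 := by
  have hx : x = ∑ i, x i • (Pi.single i 1 : Fin N → ℝ) := pi_eq_sum_univ' x
  have hy : y = ∑ i, y i • (Pi.single i 1 : Fin N → ℝ) := pi_eq_sum_univ' y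
  have hz : z = ∑ i, z i • (Pi.single i 1 : Fin N → ℝ) := pi_eq_sum_univ' z
  let B := tableLin T.t
  have step1 : ∀ (i j : Fin N) (z : Fin N → ℝ),
      tableJac T.t (Pi.single i 1) (Pi.single j 1) z = 0 := by
    intro i j z
    let F : (Fin N → ℝ) →ₗ[ℝ] (Fin N → ℝ) :=
      (B (Pi.single i 1)).comp (B (Pi.single j 1)) - B (B (Pi.single i 1) (Pi.single j 1))
        - (B (Pi.single j 1)).comp (B (Pi.single i 1))
    have : F = 0 := by
      refine (Pi.basisFun ℝ (Fin N)).ext fun k => ?_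
      rw [Pi.basisFun_apply]
      exact T.jac_single i j k
    exact LinearMap.congr_fun this z
  have step2 : ∀ (i : Fin N) (y z : Fin N → ℝ), tableJac T.t (Pi.single i 1) y z = 0 := by
    intro i y z
    let F : (Fin N → ℝ) →ₗ[ℝ] (Fin N → ℝ) :=
      (B (Pi.single i 1)).comp (B.flip z) - (B.flip z).comp (B (Pi.single i 1))
        - B.flip (B (Pi.single i 1) z)
    have : F = 0 := by
      refine (Pi.basisFun ℝ (Fin N)).ext fun k => ?_
      rw [Pi.basisFun_apply]
      exact step1 i k z
    exact LinearMap.congr_fun this y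
  let F : (Fin N → ℝ) →ₗ[ℝ] (Fin N → ℝ) :=
      B.flip (B y z) - (B.flip z).comp (B.flip y) - (B y).comp (B.flip z)
  have : F = 0 := by
    refine (Pi.basisFun ℝ (Fin N)).ext fun k => ?_
    rw [Pi.basisFun_apply]
    exact step2 k y z
  exact LinearMap.congr_fun this x

theorem LieTable.leibniz {N : ℕ} (T : LieTable N) (x y z : Fin N → ℝ) :
    tableBracket T.t x (tableBracket T.t y z) =
      tableBracket T.t (tableBracket T.t x y) z + tableBracket T.t y (tableBracket T.t x z) := by
  have := T.jac x y z
  rw [tableJac, sub_sub, sub_eq_zero] at this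
  exact this

/-- The Lie algebra `ℝ^N` with the brackets of its standard basis given by a table. -/
def LieTable.Alg {N : ℕ} (_T : LieTable N) : Type := Fin N → ℝ

instance {N : ℕ} (T : LieTable N) : AddCommGroup T.Alg :=
  inferInstanceAs (AddCommGroup (Fin N → ℝ))

instance {N : ℕ} (T : LieTable N) : Module ℝ T.Alg := inferInstanceAs (Module ℝ (Fin N → ℝ))

instance {N : ℕ} (T : LieTable N) : LieRing T.Alg where
  bracket x y := tableBracket T.t x y
  add_lie x y z := (tableLin T.t).map_add₂ x y z
  lie_add x y z := (tableLin T.t x).map_add y z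
  lie_self x := eq_zero_of_eq_neg (tableBracket_skew T.t x x)
  leibniz_lie x y z := T.leibniz x y z

instance {N : ℕ} (T : LieTable N) : LieAlgebra ℝ T.Alg where
  lie_smul c x y := (tableLin T.t x).map_smul c y

/-- The family `X_0, ..., X_{N-1}`, with indices in `ℕ` (`0` outside the range). -/
def natExt {N : ℕ} {V : Type*} [Zero V] (X : Fin N → V) (k : ℕ) : V :=
  if h : k < N then X ⟨k, h⟩ else 0

/-- The standard basis `e_0, ..., e_{N-1}` of `ℝ^N`, with indices in `ℕ`. -/
def stdVec (N : ℕ) : ℕ → (Fin N → ℝ) := natExt fun i => Pi.single i 1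

/-! #### The tables

Each of the following functions gives the bracket `[X_i, X_j]` for `i < j` in terms of the
family `X`; a bracket that is not listed is zero. -/

section Tables

variable {V : Type*} [AddCommGroup V] [Module ℝ V]

/-- `L_{2n-1} ⊕ ℝ`. -/
def brackets_LR (n : ℕ) (X : ℕ → V) (i j : ℕ) : V :=
  if i = 0 ∧ 1 ≤ j ∧ j ≤ 2 * n - 3 then X (j + 1)
  else 0

/-- `L_{2n,r}`. -/
def brackets_L (n r : ℕ) (X : ℕ → V) (i j : ℕ) : V :=
  if i = 0 ∧ 1 ≤ j ∧ j ≤ 2 * n - 3 then X (j + 1)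
  else if 1 ≤ i ∧ i ≤ (r - 1) / 2 ∧ i + j = r then (-1 : ℝ) ^ (i - 1) • X (2 * n - 1)
  else 0

/-- `T_{2n,2n-3}`. -/
def brackets_T (n : ℕ) (X : ℕ → V) (i j : ℕ) : V :=
  if i = 0 ∧ 1 ≤ j ∧ j ≤ 2 * n - 4 then X (j + 1)
  else if i = 0 ∧ j = 2 * n - 1 then X (2 * n - 2)
  else if 1 ≤ i ∧ i ≤ n - 2 ∧ i + j = 2 * n - 3 then (-1 : ℝ) ^ (i - 1) • X (2 * n - 1)
  else if 1 ≤ i ∧ i ≤ n - 2 ∧ i + j = 2 * n - 2 then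
    ((-1 : ℝ) ^ (i - 1) * ((n : ℝ) - 1 - i)) • X (2 * n - 2)
  else 0

/-- `N_{6,3}`. -/
def brackets_N (X : ℕ → V) (i j : ℕ) : V :=
  if i = 0 ∧ 1 ≤ j ∧ j ≤ 3 then X (j + 1)
  else if i = 1 ∧ j = 2 then X 5
  else if i = 1 ∧ j = 5 then X 4
  else 0

end Tables

theorem stdVec_val {N : ℕ} (i : Fin N) : stdVec N i = Pi.single i 1 := by
  simp [stdVec, natExt]

theorem tableBracket_stdVec {N : ℕ} (F : ℕ → ℕ → (Fin N → ℝ)) {i j : ℕ} (hi : i < N)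
    (hj : j < N) :
    tableLin (fun i j : Fin N => F i j) (stdVec N i) (stdVec N j) =
      if i < j then F i j else if j < i then -F j i else 0 := by
  have h1 : stdVec N i = Pi.single (⟨i, hi⟩ : Fin N) 1 := stdVec_val ⟨i, hi⟩
  have h2 : stdVec N j = Pi.single (⟨j, hj⟩ : Fin N) 1 := stdVec_val ⟨j, hj⟩
  rw [h1, h2, tableLin_apply, tableBracket_single]
  simp

/-- A table from brackets indexed by natural numbers. -/
def LieTable.ofNat (N : ℕ) (F : ℕ → ℕ → (Fin N → ℝ))
    (h : ∀ i j k : ℕ, i < j → j < k → k < N →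
      tableLin (fun i j : Fin N => F i j) (stdVec N i) (F j k) =
        tableLin (fun i j : Fin N => F i j) (F i j) (stdVec N k) +
          tableLin (fun i j : Fin N => F i j) (stdVec N j) (F i k)) : LieTable N where
  t i j := F i j
  jacobi i j k hij hjk := by
    have := h i j k hij hjk k.2
    rwa [stdVec_val, stdVec_val, stdVec_val] at this

/-- The Lie algebra `L_{2n-1} ⊕ ℝ`. -/
def tableLR (n : ℕ) : LieTable (2 * n) :=
  LieTable.ofNat (2 * n) (brackets_LR n (stdVec (2 * n))) <| by
    intro i j k hij hjk hk
    have key := fun a b ha hb => tableBracket_stdVec (brackets_LR n (stdVec (2 * n)))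
      (i := a) (j := b) ha hb
    generalize tableLin (fun i j : Fin (2 * n) => brackets_LR n (stdVec (2 * n)) i j) = B at *
    have hF : ∀ a b, 1 ≤ a → brackets_LR n (stdVec (2 * n)) a b = 0 := by
      intro a b ha
      rw [brackets_LR, if_neg (by omega)]
    have hB : ∀ a b, 1 ≤ a → 1 ≤ b → a < 2 * n → b < 2 * n →
        B (stdVec (2 * n) a) (stdVec (2 * n) b) = 0 := by
      intro a b ha hb ha' hb'
      rw [key a b ha' hb', hF a b ha, hF b a hb]
      simp
    rw [hF j k (by omega)]
    rcases Nat.eq_zero_or_pos i with rfl | hi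
    · simp only [brackets_LR]
      split_ifs <;> simp only [map_zero, LinearMap.zero_apply, add_zero, zero_add]
      · rw [hB _ _ (by omega) (by omega) (by omega) (by omega),
          hB _ _ (by omega) (by omega) (by omega) (by omega), add_zero]
      · rw [hB _ _ (by omega) (by omega) (by omega) (by omega)]
      · rw [hB _ _ (by omega) (by omega) (by omega) (by omega)]
    · rw [hF i j hi, hF i k hi]
      simp

/-- The Lie algebra `L_{2n,r}`, `r` odd, `r ≤ 2n - 3`. -/
def tableL (n r : ℕ) (hr : Odd r) (hrn : r + 3 ≤ 2 * n) : LieTable (2 * n) :=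
  LieTable.ofNat (2 * n) (brackets_L n r (stdVec (2 * n))) <| by
    intro i j k hij hjk hk
    obtain ⟨q, rfl⟩ := hr
    have key := fun a b ha hb => tableBracket_stdVec (brackets_L n (2 * q + 1) (stdVec (2 * n)))
      (i := a) (j := b) ha hb
    generalize tableLin (fun i j : Fin (2 * n) =>
      brackets_L n (2 * q + 1) (stdVec (2 * n)) i j) = B at *
    -- `F a b` without the ordering of the indices
    have hB : ∀ a b, 1 ≤ a → 1 ≤ b → a < 2 * n → b < 2 * n →
        B (stdVec (2 * n) a) (stdVec (2 * n) b) =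
          if a + b = 2 * q + 1 then (-1 : ℝ) ^ (a - 1) • stdVec (2 * n) (2 * n - 1) else 0 := by
      intro a b ha hb ha' hb'
      rw [key a b ha' hb']
      by_cases hab : a + b = 2 * q + 1
      · rw [if_pos hab]
        rcases lt_or_ge a b with h | h
        · rw [if_pos h, brackets_L, if_neg (by omega), if_pos (by omega)]
        · rw [if_neg (by omega), if_pos (by omega), brackets_L, if_neg (by omega),
            if_pos (by omega), ← neg_smul]
          congr 1
          have : a - 1 + (b - 1) + 1 = 2 * q := by omega
          rcases Nat.even_or_odd (a - 1) with h1 | h1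
          · have h2 : Odd (b - 1) := by
              obtain ⟨u, hu⟩ := h1; exact ⟨q - u - 1, by omega⟩
            rw [h1.neg_one_pow, h2.neg_one_pow, neg_neg]
          · have h2 : Even (b - 1) := by
              obtain ⟨u, hu⟩ := h1; exact ⟨q - u - 1, by omega⟩
            rw [h1.neg_one_pow, h2.neg_one_pow]
      · have hz : ∀ c d, 1 ≤ c → c + d ≠ 2 * q + 1 →
            brackets_L n (2 * q + 1) (stdVec (2 * n)) c d = 0 := by
          intro c d hc hcd
          rw [brackets_L, if_neg (by omega), if_neg (by omega)]
        rw [if_neg hab, hz a b ha hab, hz b a hb (by omega)]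
        simp
    have hF : ∀ a b, 1 ≤ a → a < b → b < 2 * n → brackets_L n (2 * q + 1) (stdVec (2 * n)) a b =
        if a + b = 2 * q + 1 then (-1 : ℝ) ^ (a - 1) • stdVec (2 * n) (2 * n - 1) else 0 := by
      intro a b ha hb hb'
      rw [← hB a b ha (by omega) (by omega) hb', key a b (by omega) hb', if_pos hb]
    have hZ : ∀ a, 1 ≤ a → a < 2 * n → B (stdVec (2 * n) a) (stdVec (2 * n) (2 * n - 1)) = 0 := by
      intro a ha ha'
      rw [hB a _ ha (by omega) ha' (by omega), if_neg (by omega)]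
    have hZ' : ∀ a, 1 ≤ a → a < 2 * n → B (stdVec (2 * n) (2 * n - 1)) (stdVec (2 * n) a) = 0 := by
      intro a ha ha'
      rw [hB _ _ (by omega) (by omega) (by omega) ha', if_neg (by omega)]
    rcases Nat.eq_zero_or_pos i with rfl | hi
    · have h0 : B (stdVec (2 * n) 0) (stdVec (2 * n) (2 * n - 1)) = 0 := by
        rw [key _ _ (by omega) (by omega), if_pos (by omega), brackets_L, if_neg (by omega),
          if_neg (by omega)]
      have hD : ∀ a, 1 ≤ a → a < 2 * n → brackets_L n (2 * q + 1) (stdVec (2 * n)) 0 a =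
          if a ≤ 2 * n - 3 then stdVec (2 * n) (a + 1) else 0 := by
        intro a ha ha'
        rw [brackets_L, if_neg (c := 1 ≤ 0 ∧ _) (by omega)]
        simp [ha]
      rw [hF j k (by omega) hjk hk, hD j (by omega) (by omega), hD k (by omega) hk]
      have hl : B (stdVec (2 * n) 0) (if j + k = 2 * q + 1 then
          (-1 : ℝ) ^ (j - 1) • stdVec (2 * n) (2 * n - 1) else 0) = 0 := by
        split_ifs
        · rw [map_smul, h0, smul_zero]
        · rw [map_zero]
      rw [hl]
      have h1 : B (if j ≤ 2 * n - 3 then stdVec (2 * n) (j + 1) else 0) (stdVec (2 * n) k) =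
          if j + 1 + k = 2 * q + 1 then (-1 : ℝ) ^ j • stdVec (2 * n) (2 * n - 1) else 0 := by
        split_ifs with h1 h2 h2
        · rw [hB _ _ (by omega) (by omega) (by omega) (by omega), if_pos h2]; simp
        · rw [hB _ _ (by omega) (by omega) (by omega) (by omega), if_neg h2]
        · omega
        · simp
      have h2 : B (stdVec (2 * n) j) (if k ≤ 2 * n - 3 then stdVec (2 * n) (k + 1) else 0) =
          if j + 1 + k = 2 * q + 1 then (-1 : ℝ) ^ (j - 1) • stdVec (2 * n) (2 * n - 1) else 0 := by
        split_ifs with h1 h2 h2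
        · rw [hB _ _ (by omega) (by omega) (by omega) (by omega), if_pos (by omega)]
        · rw [hB _ _ (by omega) (by omega) (by omega) (by omega), if_neg (by omega)]
        · omega
        · simp
      rw [h1, h2]
      split_ifs
      · rw [← add_smul]
        obtain ⟨m, rfl⟩ : ∃ m, j = m + 1 := ⟨j - 1, by omega⟩
        simp [pow_succ]
      · simp
    · rw [hF j k (by omega) hjk hk, hF i j hi hij (by omega), hF i k hi (by omega) hk]
      split_ifs <;> simp only [map_smul, map_zero, LinearMap.smul_apply, LinearMap.zero_apply,
        hZ i hi (by omega), hZ j (by omega) (by omega), hZ' k (by omega) hk, smul_zero, add_zero]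

/-- The Lie algebra `T_{2n,2n-3}`, `n ≥ 3`. -/
def tableT (n : ℕ) (hn : 3 ≤ n) : LieTable (2 * n) :=
  LieTable.ofNat (2 * n) (brackets_T n (stdVec (2 * n))) <| by
    intro i j k hij hjk hk
    have key := fun a b ha hb => tableBracket_stdVec (brackets_T n (stdVec (2 * n)))
      (i := a) (j := b) ha hb
    generalize tableLin (fun i j : Fin (2 * n) => brackets_T n (stdVec (2 * n)) i j) = B at *
    -- the brackets of `e_a`, `e_b` with `a, b ≥ 1`, in any order
    have hB : ∀ a b, 1 ≤ a → 1 ≤ b → a < 2 * n → b < 2 * n →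
        B (stdVec (2 * n) a) (stdVec (2 * n) b) =
          if a + b = 2 * n - 3 then (-1 : ℝ) ^ (a - 1) • stdVec (2 * n) (2 * n - 1)
          else if a + b = 2 * n - 2 then
            ((-1 : ℝ) ^ (a - 1) * ((n : ℝ) - 1 - a)) • stdVec (2 * n) (2 * n - 2)
          else 0 := by
      intro a b ha hb ha' hb'
      rw [key a b ha' hb']
      by_cases hab : a + b = 2 * n - 3
      · rw [if_pos hab]
        rcases lt_or_ge a b with h | h
        · rw [if_pos h, brackets_T, if_neg (by omega), if_neg (by omega), if_pos (by omega)]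
        · rw [if_neg (by omega), if_pos (by omega), brackets_T, if_neg (by omega),
            if_neg (by omega), if_pos (by omega), ← neg_smul]
          congr 1
          rcases Nat.even_or_odd (a - 1) with h1 | h1
          · have h2 : Odd (b - 1) := by
              obtain ⟨u, hu⟩ := h1; exact ⟨n - 3 - u, by omega⟩
            rw [h1.neg_one_pow, h2.neg_one_pow, neg_neg]
          · have h2 : Even (b - 1) := by
              obtain ⟨u, hu⟩ := h1; exact ⟨n - 3 - u, by omega⟩
            rw [h1.neg_one_pow, h2.neg_one_pow]
      · rw [if_neg hab]
        by_cases hab' : a + b = 2 * n - 2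
        · rw [if_pos hab']
          have hpow : (-1 : ℝ) ^ (b - 1) = (-1 : ℝ) ^ (a - 1) := by
            rcases Nat.even_or_odd (a - 1) with h1 | h1
            · have h2 : Even (b - 1) := by
                obtain ⟨u, hu⟩ := h1; exact ⟨n - 2 - u, by omega⟩
              rw [h1.neg_one_pow, h2.neg_one_pow]
            · have h2 : Odd (b - 1) := by
                obtain ⟨u, hu⟩ := h1; exact ⟨n - 3 - u, by omega⟩
              rw [h1.neg_one_pow, h2.neg_one_pow]
          have hsum : (a : ℝ) + b = 2 * n - 2 := by
            have : a + b + 2 = 2 * n := by omega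
            have h' : (a : ℝ) + b + 2 = 2 * n := by exact_mod_cast this
            linarith
          rcases lt_trichotomy a b with h | h | h
          · rw [if_pos h, brackets_T, if_neg (by omega), if_neg (by omega), if_neg (by omega),
              if_pos (by omega)]
          · subst h
            have : (n : ℝ) - 1 - a = 0 := by linarith
            simp [this]
          · rw [if_neg (by omega), if_pos (by omega), brackets_T, if_neg (by omega),
              if_neg (by omega), if_neg (by omega), if_pos (by omega), ← neg_smul, hpow]
            congr 1
            rw [← mul_neg]
            congr 1
            linarith
        · have hz : ∀ c d, 1 ≤ c → c + d ≠ 2 * n - 3 → c + d ≠ 2 * n - 2 →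
              brackets_T n (stdVec (2 * n)) c d = 0 := by
            intro c d hc hcd hcd'
            rw [brackets_T, if_neg (by omega), if_neg (by omega), if_neg (by omega),
              if_neg (by omega)]
          rw [if_neg hab', hz a b ha hab hab', hz b a hb (by omega) (by omega)]
          simp
    have hF : ∀ a b, 1 ≤ a → a < b → b < 2 * n → brackets_T n (stdVec (2 * n)) a b =
        if a + b = 2 * n - 3 then (-1 : ℝ) ^ (a - 1) • stdVec (2 * n) (2 * n - 1)
          else if a + b = 2 * n - 2 then
            ((-1 : ℝ) ^ (a - 1) * ((n : ℝ) - 1 - a)) • stdVec (2 * n) (2 * n - 2)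
          else 0 := by
      intro a b ha hb hb'
      rw [← hB a b ha (by omega) (by omega) hb', key a b (by omega) hb', if_pos hb]
    have hZ : ∀ a c, 1 ≤ a → a < 2 * n → 2 * n - 2 ≤ c → c < 2 * n →
        B (stdVec (2 * n) a) (stdVec (2 * n) c) = 0 := by
      intro a c ha ha' hc hc'
      rw [hB a _ ha (by omega) ha' (by omega), if_neg (by omega), if_neg (by omega)]
    have hZ' : ∀ a c, 1 ≤ a → a < 2 * n → 2 * n - 2 ≤ c → c < 2 * n →
        B (stdVec (2 * n) c) (stdVec (2 * n) a) = 0 := by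
      intro a c ha ha' hc hc'
      rw [hB _ _ (by omega) (by omega) (by omega) ha', if_neg (by omega), if_neg (by omega)]
    rcases Nat.eq_zero_or_pos i with rfl | hi
    · have hD : ∀ a, 1 ≤ a → a < 2 * n → brackets_T n (stdVec (2 * n)) 0 a =
          if a ≤ 2 * n - 4 then stdVec (2 * n) (a + 1)
          else if a = 2 * n - 1 then stdVec (2 * n) (2 * n - 2) else 0 := by
        intro a ha ha'
        rw [brackets_T, if_neg (c := 1 ≤ 0 ∧ _ ∧ _ = 2 * n - 3) (by omega),
          if_neg (c := 1 ≤ 0 ∧ _) (by omega)]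
        simp [ha]
      have h0 : B (stdVec (2 * n) 0) (stdVec (2 * n) (2 * n - 1)) = stdVec (2 * n) (2 * n - 2) := by
        rw [key _ _ (by omega) (by omega), if_pos (by omega), hD _ (by omega) (by omega),
          if_neg (by omega), if_pos rfl]
      have h0' : B (stdVec (2 * n) 0) (stdVec (2 * n) (2 * n - 2)) = 0 := by
        rw [key _ _ (by omega) (by omega), if_pos (by omega), hD _ (by omega) (by omega),
          if_neg (by omega), if_neg (by omega)]
      rw [hF j k (by omega) hjk hk, hD j (by omega) (by omega), hD k (by omega) hk]
      have hl : B (stdVec (2 * n) 0) (if j + k = 2 * n - 3 then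
            (-1 : ℝ) ^ (j - 1) • stdVec (2 * n) (2 * n - 1)
          else if j + k = 2 * n - 2 then
            ((-1 : ℝ) ^ (j - 1) * ((n : ℝ) - 1 - j)) • stdVec (2 * n) (2 * n - 2)
          else 0) = if j + k = 2 * n - 3 then
            (-1 : ℝ) ^ (j - 1) • stdVec (2 * n) (2 * n - 2) else 0 := by
        split_ifs
        · rw [map_smul, h0]
        · rw [map_smul, h0', smul_zero]
        · rw [map_zero]
      have h1 : B (if j ≤ 2 * n - 4 then stdVec (2 * n) (j + 1)
            else if j = 2 * n - 1 then stdVec (2 * n) (2 * n - 2) else 0) (stdVec (2 * n) k) =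
          if j + k = 2 * n - 3 then
            ((-1 : ℝ) ^ j * ((n : ℝ) - 1 - (j + 1))) • stdVec (2 * n) (2 * n - 2)
          else if j + k = 2 * n - 4 then (-1 : ℝ) ^ j • stdVec (2 * n) (2 * n - 1) else 0 := by
        rcases le_or_gt j (2 * n - 4) with h | h
        · rw [if_pos h, hB _ _ (by omega) (by omega) (by omega) (by omega)]
          by_cases e1 : j + k = 2 * n - 3
          · rw [if_pos e1, if_neg (by omega), if_pos (by omega)]; simp
          · rw [if_neg e1]
            by_cases e2 : j + k = 2 * n - 4
            · rw [if_pos e2, if_pos (by omega)]; simp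
            · rw [if_neg e2, if_neg (by omega), if_neg (by omega)]
        · rw [if_neg (by omega), if_neg (by omega), if_neg (by omega), if_neg (by omega)]
          simp
      have h2 : B (stdVec (2 * n) j) (if k ≤ 2 * n - 4 then stdVec (2 * n) (k + 1)
            else if k = 2 * n - 1 then stdVec (2 * n) (2 * n - 2) else 0) =
          if j + k = 2 * n - 3 then
            ((-1 : ℝ) ^ (j - 1) * ((n : ℝ) - 1 - j)) • stdVec (2 * n) (2 * n - 2)
          else if j + k = 2 * n - 4 then
            (-1 : ℝ) ^ (j - 1) • stdVec (2 * n) (2 * n - 1) else 0 := by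
        rcases le_or_gt k (2 * n - 4) with h | h
        · rw [if_pos h, hB _ _ (by omega) (by omega) (by omega) (by omega)]
          by_cases e1 : j + k = 2 * n - 3
          · rw [if_pos e1, if_neg (by omega), if_pos (by omega)]
          · rw [if_neg e1]
            by_cases e2 : j + k = 2 * n - 4
            · rw [if_pos e2, if_pos (by omega)]
            · rw [if_neg e2, if_neg (by omega), if_neg (by omega)]
        · rw [if_neg (c := k ≤ _) (by omega), if_neg (c := j + k = _) (by omega),
            if_neg (c := j + k = _) (by omega)]
          split_ifs
          · exact hZ j _ (by omega) (by omega) (by omega) (by omega)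
          · simp
      rw [hl, h1, h2]
      obtain ⟨m, rfl⟩ : ∃ m, j = m + 1 := ⟨j - 1, by omega⟩
      simp only [Nat.add_sub_cancel]
      split_ifs
      · rw [← add_smul]
        congr 1
        push_cast
        ring
      · rw [← add_smul]
        simp [pow_succ]
      · simp
    · have z1 := hZ i (2 * n - 1) hi (by omega) (by omega) (by omega)
      have z2 := hZ i (2 * n - 2) hi (by omega) (by omega) (by omega)
      have z3 := hZ j (2 * n - 1) (by omega) (by omega) (by omega) (by omega)
      have z4 := hZ j (2 * n - 2) (by omega) (by omega) (by omega) (by omega)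
      have z5 := hZ' k (2 * n - 1) (by omega) (by omega) (by omega) (by omega)
      have z6 := hZ' k (2 * n - 2) (by omega) (by omega) (by omega) (by omega)
      rw [hF j k (by omega) hjk hk, hF i j hi hij (by omega), hF i k hi (by omega) hk]
      split_ifs <;> simp only [map_smul, map_zero, LinearMap.smul_apply, LinearMap.zero_apply,
        z1, z2, z3, z4, z5, z6, smul_zero, add_zero]

/-- The Lie algebra `N_{6,3}`. -/
def tableN : LieTable 6 :=
  LieTable.ofNat 6 (brackets_N (stdVec 6)) <| by
    intro i j k hij hjk hk
    have key := fun a b ha hb => tableBracket_stdVec (brackets_N (stdVec 6))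
      (i := a) (j := b) ha hb
    generalize tableLin (fun i j : Fin 6 => brackets_N (stdVec 6) i j) = B at *
    have hk' : k < 6 := hk
    have hj' : j < 6 := by omega
    have hi' : i < 6 := by omega
    interval_cases k <;> interval_cases j <;> interval_cases i <;>
      simp [brackets_N, key]

/-! ### Adapted bases -/

/-- The brackets of the basis `X` are `[X_i, X_j] = F X i j` for `i < j` (the others follow by
antisymmetry). -/
def HasBrackets {𝔤 : Type*} [LieRing 𝔤] [LieAlgebra ℝ 𝔤] {N : ℕ}
    (X : Module.Basis (Fin N) ℝ 𝔤) (F : (ℕ → 𝔤) → ℕ → ℕ → 𝔤) : Prop :=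
  ∀ i j : Fin N, i < j → ⁅X i, X j⁆ = F (natExt X) i j

section Adapted

variable {V : Type*} [AddCommGroup V] [Module ℝ V]

/-- The brackets `[X_i, X_j]`, `i < j`, of an adapted basis, with constants `C i j k`, when
`gr 𝔤` is `L_{2n-1} ⊕ ℝ`. -/
def adapted_LR (n : ℕ) (C : ℕ → ℕ → ℕ → ℝ) (X : ℕ → V) (i j : ℕ) : V :=
  if i = 0 ∧ 1 ≤ j ∧ j ≤ 2 * n - 3 then X (j + 1)
  else if 1 ≤ i ∧ i + j ≤ 2 * n - 3 then
    ∑ k ∈ Finset.Icc (i + j + 1) (2 * n - 2), C i j k • X k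
  else if 1 ≤ i ∧ i ≤ 2 * n - 4 ∧ j = 2 * n - 1 then
    ∑ k ∈ Finset.Icc (i + 2) (2 * n - 2), C i j k • X k
  else 0

/-- The brackets `[X_i, X_j]`, `i < j`, of an adapted basis, with constants `C i j k`, when
`gr 𝔤` is `L_{2n,r}`. -/
def adapted_L (n r : ℕ) (C : ℕ → ℕ → ℕ → ℝ) (X : ℕ → V) (i j : ℕ) : V :=
  if i = 0 ∧ 1 ≤ j ∧ j ≤ 2 * n - 3 then X (j + 1)
  else if i = 0 ∧ j = 2 * n - 1 then
    ∑ k ∈ Finset.Icc (r + 2) (2 * n - 2), C i j k • X k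
  else if 1 ≤ i ∧ i + j ≤ r - 1 then
    ∑ k ∈ Finset.Icc (i + j + 1) (2 * n - 1), C i j k • X k
  else if 1 ≤ i ∧ r < i + j ∧ i + j ≤ 2 * n - 3 then
    ∑ k ∈ Finset.Icc (i + j + 1) (2 * n - 2), C i j k • X k
  else if 1 ≤ i ∧ i ≤ 2 * n - 3 - r ∧ j = 2 * n - 1 then
    ∑ k ∈ Finset.Icc (r + i + 1) (2 * n - 2), C i j k • X k
  else if i = 1 ∧ j = r - 1 then X (2 * n - 1)
  else if 2 ≤ i ∧ i ≤ (r - 1) / 2 ∧ i + j = r then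
    (-1 : ℝ) ^ (i - 1) • X (2 * n - 1) + ∑ k ∈ Finset.Icc (r + 1) (2 * n - 2), C i j k • X k
  else 0

/-- The brackets `[X_i, X_j]`, `i < j`, of an adapted basis, with constants `C i j k`, when
`gr 𝔤` is `T_{2n,2n-3}`. -/
def adapted_T (n : ℕ) (C : ℕ → ℕ → ℕ → ℝ) (X : ℕ → V) (i j : ℕ) : V :=
  if i = 0 ∧ 1 ≤ j ∧ j ≤ 2 * n - 4 then X (j + 1)
  else if i = 0 ∧ j = 2 * n - 1 then X (2 * n - 2)
  else if 1 ≤ i ∧ i + j ≤ 2 * n - 4 then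
    ∑ k ∈ Finset.Icc (i + j + 1) (2 * n - 1), C i j k • X k
  else if i = 1 ∧ j = 2 * n - 4 then X (2 * n - 1)
  else if 2 ≤ i ∧ i ≤ n - 2 ∧ i + j = 2 * n - 3 then
    (-1 : ℝ) ^ (i - 1) • X (2 * n - 1) + C i j (2 * n - 2) • X (2 * n - 2)
  else if 1 ≤ i ∧ i ≤ n - 2 ∧ i + j = 2 * n - 2 then
    ((-1 : ℝ) ^ (i - 1) * ((n : ℝ) - 1 - i)) • X (2 * n - 2)
  else 0

end Adapted

end QuasiFiliform

end

noncomputable section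

namespace QuasiFiliform

set_option linter.unusedSectionVars false

/-! ### Chains `y, [x, y], [x, [x, y]], ...` in a Lie algebra -/

section Chain

variable {L : Type*} [LieRing L] [LieAlgebra ℝ L]

/-! Let `V k` be the component `𝔤^k / 𝔤^(k+1)` of `gr 𝔤`, of degree `k + 1`. As `gr 𝔤` is generated
by `V 0`, a zero component would be followed by zeros only. So the nilindex `2n - 2` gives exactly
`2n - 2` nonzero components, of total dimension `2n`, and `dim V 0 ≥ 2`. The dimensions are
therefore `3, 1, ..., 1`, or `2, 1, ..., 1` with one further `2` at some index `ρ ≥ 1`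
(`exists_jump`).

Graded classification. For generators `x`, `y` put `c 0 = y` and `c (k+1) = [x, c k]`. Since `ad x`
is a derivation, the brackets `[c p, c q]` with `p + q = N + 1` are determined by those with `p + q
= N` and by the single unknown `[y, c (N+1)]` (`lie_chain_recursion`); when `N + 1` is even, `[c p,
c p] = 0` determines the unknown too. Consequently a new direction can only be `Y = [y, c (2q-1)]`,
at an even index `ρ = 2q`. If `Y` is central, the chain continues to the end and the type is
`L_{2n,2q+1}` (`typeL_of_central`). If `q ≥ 2` and `[x, Y] ≠ 0`, a shear of `x` by a multiple of `y`
gives `c (2q+1) = 0`, and the Jacobi identity makes the component two steps above `[x, Y]` vanish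
(`tail_relations`); as the last index `2n - 3` is odd, `[x, Y]` already spans the last component and
the type is `T_{2n,2n-3}`. If `q = 1`, the symmetric form `(u, v) ↦ [u, [v, [x, y]]]` on the plane
`V 0` takes values in a line, and the degenerate, indefinite and definite cases give `L_{2n,3}`,
`T_{6,3}` and `N_{6,3}` (`classify_of_eq_two`). If `dim V 0 = 3`, the kernel of the bracket `V 0 × V
0 → V 1` splits off the summand `ℝ`.

Lifting. Representatives of the generators in `𝔤`, combined by the same bracket expressions, form a
basis of `𝔤` adapted to the lower central series (`exists_basis_of_symbols`). A bracket agrees with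
its model up to a term lying one step deeper in the series, whose coordinates are the constants `C`.
Relations in the last component hold exactly.

One basis has to serve all four implications, so the models must also be told apart. This is done by
the number of generators, by the depth at which two independent central elements occur, and, for
`T_{6,3}` against `N_{6,3}`, by the sign of the quadratic form above. -/

/-- The sequence `y, [x, y], [x, [x, y]], ...`. -/
def chain (x y : L) : ℕ → L
  | 0 => y
  | k + 1 => ⁅x, chain x y k⁆

theorem chain_zero (x y : L) : chain x y 0 = y := rfl

theorem chain_succ (x y : L) (k : ℕ) : chain x y (k + 1) = ⁅x, chain x y k⁆ := rfl

theorem lie_chain_step (x y : L) (p q : ℕ) : ⁅x, ⁅chain x y p, chain x y q⁆⁆ =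
    ⁅chain x y (p + 1), chain x y q⁆ + ⁅chain x y p, chain x y (q + 1)⁆ := by
  rw [leibniz_lie, chain_succ, chain_succ]

/-- The Leibniz rule gives `[c (p+1), c q] = [x, [c p, c q]] - [c p, c (q+1)]`; the signs `(-1)^p`
turn this into a telescoping sum starting from `[c 0, c (N+1)]`. -/
theorem lie_chain_recursion (x y : L) {N : ℕ} (φ : ℕ → L)
    (h : ∀ p q, p + q = N → ⁅x, ⁅chain x y p, chain x y q⁆⁆ = (-1 : ℝ) ^ p • φ p) (p : ℕ) :
    ∀ q, p + q = N + 1 → ⁅chain x y p, chain x y q⁆ =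
      (-1 : ℝ) ^ p • (⁅y, chain x y (N + 1)⁆ - ∑ m ∈ Finset.range p, φ m) := by
  induction p with
  | zero =>
    intro q hq
    obtain rfl : q = N + 1 := by omega
    simp [chain_zero]
  | succ p ih =>
    intro q hq
    have h1 := h p q (by omega)
    rw [lie_chain_step, ih (q + 1) (by omega)] at h1
    rw [eq_sub_of_add_eq h1, Finset.sum_range_succ]
    module

/-- The recursion at `p = q = κ` computes `[c κ, c κ] = 0`, which pins down its initial value. -/
theorem lie_chain_middle (x y : L) {N κ : ℕ} (hN : N + 1 = 2 * κ) (φ : ℕ → L)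
    (h : ∀ p q, p + q = N → ⁅x, ⁅chain x y p, chain x y q⁆⁆ = (-1 : ℝ) ^ p • φ p) :
    ⁅y, chain x y (N + 1)⁆ = ∑ m ∈ Finset.range κ, φ m := by
  have h1 := lie_chain_recursion x y φ h κ κ (by omega)
  rw [lie_self, eq_comm, smul_eq_zero] at h1
  exact sub_eq_zero.mp (h1.resolve_left (pow_ne_zero _ (by norm_num)))

/-- The brackets of the members of the chain of total degree `k` vanish. -/
def ChainComm (x y : L) (k : ℕ) : Prop :=
  ∀ p q, p + q + 1 = k → ⁅chain x y p, chain x y q⁆ = 0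

theorem ChainComm.lie_eq_zero {x y : L} {k q : ℕ} (h : ChainComm x y k) (hq : q + 1 = k) :
    ⁅y, chain x y q⁆ = 0 :=
  h 0 q (by omega)

theorem chainComm_one (x y : L) : ChainComm x y 1 := by
  intro p q h
  obtain ⟨rfl, rfl⟩ : p = 0 ∧ q = 0 := by omega
  exact lie_self _

theorem ChainComm.lie_eq {x y : L} {k : ℕ} (hk : 1 ≤ k) (h : ChainComm x y k) {p q : ℕ}
    (hpq : p + q = k) : ⁅chain x y p, chain x y q⁆ = (-1 : ℝ) ^ p • ⁅y, chain x y k⁆ := by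
  obtain ⟨N, rfl⟩ : ∃ N, k = N + 1 := ⟨k - 1, by omega⟩
  have := lie_chain_recursion x y (N := N) (fun _ => 0)
    (fun p q hpq => by rw [h p q (by omega)]; simp) p q hpq
  simpa using this

/-- All brackets of the next degree are `± [y, c k]`, and one of them is the bracket of `c (k/2)`
with itself. This is why only odd `k` can produce something new. -/
theorem ChainComm.succ_of_even {x y : L} {k : ℕ} (hk : 1 ≤ k) (he : Even k)
    (h : ChainComm x y k) : ChainComm x y (k + 1) := by
  obtain ⟨κ, hκ⟩ := he
  have h0 : ⁅y, chain x y k⁆ = 0 := by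
    have h1 := h.lie_eq hk hκ.symm
    rw [lie_self, eq_comm, smul_eq_zero] at h1
    exact h1.resolve_left (pow_ne_zero _ (by norm_num))
  intro p q hpq
  rw [h.lie_eq hk (by omega : p + q = k), h0, smul_zero]

theorem ChainComm.succ_of_eq_zero {x y : L} {k : ℕ} (hk : 1 ≤ k) (h : ChainComm x y k)
    (h0 : ⁅y, chain x y k⁆ = 0) : ChainComm x y (k + 1) := by
  intro p q hpq
  rw [h.lie_eq hk (by omega : p + q = k), h0, smul_zero]

/-- The brackets of total degree one more than a degree where they are `± Y`. -/
theorem lie_chain_of_alternating {x y Y : L} {N κ : ℕ} (hN : N + 1 = 2 * κ)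
    (h : ∀ p q, p + q = N → ⁅chain x y p, chain x y q⁆ = (-1 : ℝ) ^ p • Y) {p q : ℕ}
    (hpq : p + q = N + 1) :
    ⁅chain x y p, chain x y q⁆ = ((-1 : ℝ) ^ p * ((κ : ℝ) - p)) • ⁅x, Y⁆ := by
  have h' : ∀ p q, p + q = N → ⁅x, ⁅chain x y p, chain x y q⁆⁆ =
      (-1 : ℝ) ^ p • (fun _ : ℕ => ⁅x, Y⁆) p := by
    intro p q hpq
    rw [h p q hpq, lie_smul]
  -- The middle bracket gives `[y, c (N+1)] = κ [x, Y]`; the recursion then subtracts `[x, Y]` once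
  -- for each step up to `p`.
  rw [lie_chain_recursion x y _ h' p q hpq, lie_chain_middle x y hN _ h']
  simp only [Finset.sum_const, Finset.card_range, ← Nat.cast_smul_eq_nsmul ℝ]
  module

theorem lie_chain_eq_zero {x y u : L} (hx : ⁅x, u⁆ = 0) (hy : ⁅y, u⁆ = 0) (k : ℕ) :
    ⁅u, chain x y k⁆ = 0 := by
  induction k with
  | zero => rw [chain_zero, ← lie_skew, hy, neg_zero]
  | succ k ih => rw [chain_succ, leibniz_lie, ih, ← lie_skew u x, hx]; simp

theorem chain_eq_zero_of_le {x y : L} {k l : ℕ} (hk : chain x y k = 0) (h : k ≤ l) :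
    chain x y l = 0 := by
  induction l, h using Nat.le_induction with
  | base => exact hk
  | succ l _ ih => rw [chain_succ, ih, lie_zero]

/-- Adding a multiple of `y` to `x` does not change the chain as long as `y` commutes with it. -/
theorem chain_add_smul {x y : L} (τ : ℝ) {k : ℕ} (h : ∀ p < k, ⁅y, chain x y p⁆ = 0) :
    ∀ p ≤ k, chain (x + τ • y) y p = chain x y p := by
  intro p
  induction p with
  | zero => intro _; rfl
  | succ p ih =>
    intro hp
    rw [chain_succ, ih (by omega), add_lie, smul_lie, h p (by omega), smul_zero, add_zero,
      chain_succ]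

/-! ### Naturally graded Lie algebras -/

/-- The subspaces `V k` (of degree `k + 1`) form a grading compatible with the bracket, and each
of them is generated by the first one. -/
structure NatGraded (V : ℕ → Submodule ℝ L) : Prop where
  lie_mem : ∀ {i j : ℕ} {x y : L}, x ∈ V i → y ∈ V j → ⁅x, y⁆ ∈ V (i + j + 1)
  gen : ∀ k, V (k + 1) ≤ Submodule.span ℝ {m | ∃ u ∈ V 0, ∃ v ∈ V k, ⁅u, v⁆ = m}

theorem lie_mem_of_mem_span {S T : Set L} {P : Submodule ℝ L}
    (h : ∀ s ∈ S, ∀ t ∈ T, ⁅s, t⁆ ∈ P) {u v : L} (hu : u ∈ Submodule.span ℝ S)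
    (hv : v ∈ Submodule.span ℝ T) : ⁅u, v⁆ ∈ P := by
  induction hu using Submodule.span_induction with
  | zero => simp
  | add x x' _ _ h h' => rw [add_lie]; exact P.add_mem h h'
  | smul c x _ h => rw [smul_lie]; exact P.smul_mem c h
  | mem s hs =>
    induction hv using Submodule.span_induction with
    | zero => simp
    | add x x' _ _ h h' => rw [lie_add]; exact P.add_mem h h'
    | smul c x _ h => rw [lie_smul]; exact P.smul_mem c h
    | mem t ht => exact h s hs t ht

namespace NatGraded

variable {V : ℕ → Submodule ℝ L}

/-- The standard way of bounding a component: it suffices to bracket spanning elements of `V 0` with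
spanning elements of the preceding component. -/
theorem succ_le (hV : NatGraded V) {k : ℕ} {S T : Set L} {P : Submodule ℝ L} (hS : V 0 ≤ Submodule.span ℝ S)
    (hT : V k ≤ Submodule.span ℝ T) (h : ∀ s ∈ S, ∀ t ∈ T, ⁅s, t⁆ ∈ P) : V (k + 1) ≤ P := by
  refine (hV.gen k).trans (Submodule.span_le.mpr ?_)
  rintro _ ⟨u, hu, v, hv, rfl⟩
  exact lie_mem_of_mem_span h (hS hu) (hT hv)

theorem chain_mem (hV : NatGraded V) {x y : L} (hx : x ∈ V 0) (hy : y ∈ V 0) (k : ℕ) : chain x y k ∈ V k := by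
  induction k with
  | zero => exact hy
  | succ k ih => simpa [chain_succ] using hV.lie_mem hx ih

/-- An element that commutes with the first component commutes with all of them. -/
theorem lie_eq_zero (hV : NatGraded V) {z : L} (h : ∀ u ∈ V 0, ⁅z, u⁆ = 0) :
    ∀ (k : ℕ), ∀ w ∈ V k, ⁅z, w⁆ = 0 := by
  intro k
  induction k with
  | zero => exact h
  | succ k ih =>
    intro w hw
    have : V (k + 1) ≤ LinearMap.ker (LieAlgebra.ad ℝ L z : L →ₗ[ℝ] L) := by
      refine (hV.gen k).trans (Submodule.span_le.mpr ?_)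
      rintro _ ⟨u, hu, v, hv, rfl⟩
      simp [leibniz_lie z u v, h u hu, ih v hv]
    simpa using this hw

theorem eq_bot_of_le (hV : NatGraded V) {k l : ℕ} (hk : V k = ⊥) (h : k ≤ l) : V l = ⊥ := by
  induction l, h using Nat.le_induction with
  | base => exact hk
  | succ l _ ih =>
    rw [eq_bot_iff]
    refine (hV.gen l).trans (Submodule.span_le.mpr ?_)
    rintro _ ⟨u, hu, v, hv, rfl⟩
    rw [ih, Submodule.mem_bot] at hv
    simp [hv]

end NatGraded

theorem exists_span_singleton_of_finrank_eq_one {W : Submodule ℝ L}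
    (h : Module.finrank ℝ W = 1) : ∃ w ∈ W, w ≠ 0 ∧ ∀ x ∈ W, ∃ c : ℝ, x = c • w := by
  obtain ⟨w, hw, hc⟩ := finrank_eq_one_iff'.mp h
  refine ⟨w, w.2, by simpa using hw, fun x hx => ?_⟩
  obtain ⟨c, hc⟩ := hc ⟨x, hx⟩
  exact ⟨c, by simpa using (congrArg Subtype.val hc).symm⟩

theorem ne_bot_of_finrank_eq_one {W : Submodule ℝ L} (h : Module.finrank ℝ W = 1) : W ≠ ⊥ := by
  rintro rfl
  simp at h

end Chain

/-! ### Propagation of the chain through one-dimensional components -/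

section Propagation

variable {L : Type*} [LieRing L] [LieAlgebra ℝ L] {V : ℕ → Submodule ℝ L}

open Submodule in
theorem NatGraded.succ_le_of_singleton (hV : NatGraded V) {x y z u : L} {k : ℕ}
    (h0 : V 0 ≤ span ℝ {x, y, z}) (hu : u ∈ V k) (hk : V k ≤ span ℝ {u})
    (hz : ∀ k, ∀ w ∈ V k, ⁅z, w⁆ = 0) {P : Submodule ℝ L} (hx : ⁅x, u⁆ ∈ P)
    (hy : ⁅y, u⁆ ∈ P) : V (k + 1) ≤ P := by
  refine hV.succ_le h0 hk ?_
  rintro s (rfl | rfl | rfl) t rfl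
  · exact hx
  · exact hy
  · rw [hz k _ hu]; exact P.zero_mem

/-- Up to sign `[y, c t]` is `[c 1, c (t-1)]`, and `ad y` sends both entries of this bracket to
elements that contribute nothing. -/
theorem lie_lie_chain_eq_zero {x y : L} {t : ℕ} (h3 : 3 ≤ t) (hS : ChainComm x y t)
    (hc : ∀ k, ⁅⁅y, chain x y 1⁆, chain x y k⁆ = 0) : ⁅y, ⁅y, chain x y t⁆⁆ = 0 := by
  have h1 := hS.lie_eq (by omega) (show 1 + (t - 1) = t by omega)
  have h2 : ⁅y, ⁅chain x y 1, chain x y (t - 1)⁆⁆ = 0 := by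
    rw [leibniz_lie, hc, hS.lie_eq_zero (q := t - 1) (by omega)]
    simp
  rw [h1] at h2
  simpa only [lie_smul, smul_eq_zero, pow_one, neg_eq_zero, one_ne_zero, false_or] using h2

open Submodule in
/-- Two steps of the chain, starting from an odd index. -/
theorem NatGraded.two_steps (hV : NatGraded V) {x y z : L} (hx : x ∈ V 0) (hy : y ∈ V 0)
    (hz : ∀ k, ∀ w ∈ V k, ⁅z, w⁆ = 0) (h0 : V 0 ≤ span ℝ {x, y, z})
    (hc : ∀ k, ⁅⁅y, chain x y 1⁆, chain x y k⁆ = 0) {t : ℕ} (ht : Odd t) (h3 : 3 ≤ t)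
    (hVt : V t ≤ span ℝ {chain x y t}) (hS : ChainComm x y t)
    (h1 : Module.finrank ℝ (V (t + 1)) = 1) (h2 : V (t + 2) ≠ ⊥) :
    (V (t + 1) ≤ span ℝ {chain x y (t + 1)} ∧ ChainComm x y (t + 1)) ∧
      V (t + 2) ≤ span ℝ {chain x y (t + 2)} ∧ ChainComm x y (t + 2) := by
  have hcm := hV.chain_mem hx hy
  obtain ⟨w, hw, hw0, hwc⟩ := exists_span_singleton_of_finrank_eq_one h1
  obtain ⟨a, ha⟩ := hwc _ (hcm (t + 1))
  have hYm : ⁅y, chain x y t⁆ ∈ V (t + 1) := by simpa using hV.lie_mem hy (hcm t)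
  obtain ⟨b, hb⟩ := hwc _ hYm
  have hyY := lie_lie_chain_eq_zero h3 hS hc
  obtain ⟨κ, hκ⟩ : ∃ κ, t + 1 = 2 * κ := by
    obtain ⟨m, rfl⟩ := ht
    exact ⟨m + 1, by ring⟩
  have hκ0 : (κ : ℝ) ≠ 0 := by
    have : 1 ≤ κ := by omega
    positivity
  have hd := lie_chain_of_alternating (Y := ⁅y, chain x y t⁆) hκ
    (fun p q hpq => hS.lie_eq (by omega) hpq) (show 0 + (t + 1) = t + 1 by omega)
  simp only [chain_zero, pow_zero, one_mul, Nat.cast_zero, sub_zero] at hd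
  -- If `Y = [y, c t]` were nonzero it would span `V (t+1)`, so `[y, Y] = 0` makes `y` commute with
  -- all of `V (t+1)`. Then `[y, c (t+1)] = κ [x, Y]` makes `x` commute with it as well, and `V
  -- (t+2)` would vanish.
  have hb0 : b = 0 := by
    by_contra hb0
    have hyw : ⁅y, w⁆ = 0 := by
      rw [hb, lie_smul, smul_eq_zero] at hyY
      exact hyY.resolve_left hb0
    have hxw : ⁅x, w⁆ = 0 := by
      rw [ha, lie_smul, hyw, smul_zero, hb, lie_smul, smul_smul, eq_comm, smul_eq_zero] at hd
      exact hd.resolve_left (mul_ne_zero hκ0 hb0)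
    apply h2
    rw [eq_bot_iff]
    refine hV.succ_le_of_singleton h0 hw (fun v hv => ?_) hz (by simp [hxw]) (by simp [hyw])
    obtain ⟨c, rfl⟩ := hwc v hv
    exact smul_mem _ _ (mem_span_singleton_self w)
  have hY0 : ⁅y, chain x y t⁆ = 0 := by rw [hb, hb0, zero_smul]
  have hV1 : V (t + 1) ≤ span ℝ {chain x y (t + 1)} :=
    hV.succ_le_of_singleton h0 (hcm t) hVt hz (mem_span_singleton_self _) (by simp [hY0])
  have hS1 := hS.succ_of_eq_zero (by omega) hY0
  have hS2 := hS1.succ_of_even (by omega) ht.add_one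
  refine ⟨⟨hV1, hS1⟩, ?_, hS2⟩
  exact hV.succ_le_of_singleton h0 (hcm (t + 1)) hV1 hz (mem_span_singleton_self _)
    (by rw [hS2.lie_eq_zero rfl]; exact zero_mem _)

-- The induction goes by two: that the chain survives at `t + 1` is only seen from `V (t+2) ≠ 0`,
-- and the step to `t + 2` is then free by parity.
open Submodule in
theorem NatGraded.propagate (hV : NatGraded V) {x y z : L} (hx : x ∈ V 0) (hy : y ∈ V 0)
    (hz : ∀ k, ∀ w ∈ V k, ⁅z, w⁆ = 0) (h0 : V 0 ≤ span ℝ {x, y, z})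
    (hc : ∀ k, ⁅⁅y, chain x y 1⁆, chain x y k⁆ = 0) {t : ℕ} (ht : Odd t) (h3 : 3 ≤ t)
    (hVt : V t ≤ span ℝ {chain x y t}) (hS : ChainComm x y t) (m : ℕ)
    (h1 : ∀ k, t < k → k < t + 2 * m → Module.finrank ℝ (V k) = 1) (h2 : V (t + 2 * m) ≠ ⊥) :
    ∀ k, t ≤ k → k ≤ t + 2 * m → V k ≤ span ℝ {chain x y k} ∧ ChainComm x y k := by
  induction m with
  | zero =>
    intro k hk hk'
    obtain rfl : k = t := by omega
    exact ⟨hVt, hS⟩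
  | succ m ih =>
    have hne : V (t + 2 * m) ≠ ⊥ := fun h => h2 (hV.eq_bot_of_le h (by omega))
    have ih := ih (fun k hk hk' => h1 k hk (by omega)) hne
    obtain ⟨hl, hl'⟩ := ih (t + 2 * m) (by omega) le_rfl
    have hs := hV.two_steps hx hy hz h0 hc (ht.add_even (even_two_mul m)) (by omega) hl hl'
      (h1 _ (by omega) (by omega)) h2
    intro k hk hk'
    rcases (show k ≤ t + 2 * m ∨ k = t + 2 * m + 1 ∨ k = t + 2 * m + 2 by omega) with h | rfl | rfl
    · exact ih k hk h
    · exact hs.1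
    · exact hs.2

open Submodule in
/-- If the third component is one-dimensional, the generators can be chosen such that
`[y, [x, y]] = 0`. -/
theorem NatGraded.exists_lie_eq_zero (hV : NatGraded V) {x y z : L} (hx : x ∈ V 0) (hy : y ∈ V 0)
    (h0 : V 0 ≤ span ℝ {x, y, z}) (h2 : Module.finrank ℝ (V 2) = 1) :
    ∃ x' ∈ V 0, ∃ y' ∈ V 0, V 0 ≤ span ℝ {x', y', z} ∧ ⁅y', ⁅x', y'⁆⁆ = 0 := by
  obtain ⟨w, hw, hw0, hwc⟩ := exists_span_singleton_of_finrank_eq_one h2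
  have hm : ∀ u ∈ V 0, ⁅u, ⁅x, y⁆⁆ ∈ V 2 := fun u hu => by
    simpa using hV.lie_mem hu (hV.lie_mem hx hy)
  obtain ⟨a, ha⟩ := hwc _ (hm x hx)
  obtain ⟨b, hb⟩ := hwc _ (hm y hy)
  by_cases hb0 : b = 0
  · exact ⟨x, hx, y, hy, h0, by rw [hb, hb0, zero_smul]⟩
  -- `x - (a/b) y` commutes with `[x, y]` by the choice of `a` and `b`, and its bracket with `y` is
  -- again `± [x, y]`.
  · refine ⟨y, hy, x - (a / b) • y, sub_mem hx (smul_mem _ _ hy), h0.trans ?_, ?_⟩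
    · rw [span_le]
      rintro s (rfl | rfl | rfl)
      · have : s = (s - (a / b) • y) + (a / b) • y := by abel
        rw [this]
        exact add_mem (subset_span (by simp)) (smul_mem _ _ (subset_span (by simp)))
      · exact subset_span (by simp)
      · exact subset_span (by simp)
    · have : ⁅y, x - (a / b) • y⁆ = -⁅x, y⁆ := by simp
      rw [this, lie_neg, sub_lie, smul_lie, ha, hb, smul_smul, div_mul_cancel₀ _ hb0, sub_self,
        neg_zero]

open Submodule in
/-- The filiform part of the algebra. -/
theorem NatGraded.exists_filiform (hV : NatGraded V) {x y z : L} (hx : x ∈ V 0) (hy : y ∈ V 0)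
    (hz : ∀ u ∈ V 0, ⁅z, u⁆ = 0) (h0 : V 0 ≤ span ℝ {x, y, z}) {t : ℕ} (ht : Odd t)
    (h1 : ∀ k, 1 ≤ k → k < t → Module.finrank ℝ (V k) = 1) (h2 : V t ≠ ⊥) :
    ∃ x' ∈ V 0, ∃ y' ∈ V 0, V 0 ≤ span ℝ {x', y', z} ∧
      (∀ k, 1 ≤ k → k ≤ t → V k ≤ span ℝ {chain x' y' k}) ∧
      ∀ k, k ≤ t → ChainComm x' y' k := by
  have hzV := hV.lie_eq_zero hz
  have hV1 : ∀ x ∈ V 0, ∀ y ∈ V 0, V 0 ≤ span ℝ {x, y, z} → V 1 ≤ span ℝ {chain x y 1} := by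
    intro x hx y hy h0
    have hz' : ∀ u ∈ V 0, ⁅u, z⁆ = 0 := fun u hu => by rw [← lie_skew, hz u hu, neg_zero]
    have hyx : ⁅y, x⁆ ∈ span ℝ {chain x y 1} := by
      rw [← lie_skew]
      exact neg_mem (mem_span_singleton_self ⁅x, y⁆)
    refine hV.succ_le h0 h0 ?_
    rintro s (rfl | rfl | rfl) t (rfl | rfl | rfl)
    all_goals try simp [hz, hz', hx, hy, hyx]
    exact mem_span_singleton_self _
  have hS0 : ∀ x y : L, ChainComm x y 0 := fun x y p q h => by omega
  -- For `t = 1` no normalisation is possible or needed: nothing is known about the dimension of `V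
  -- 2`. For `t ≥ 3`, `V 2` is a line and the propagation can start at index 3.
  rcases (show t = 1 ∨ 3 ≤ t by obtain ⟨m, rfl⟩ := ht; omega) with rfl | h3
  · refine ⟨x, hx, y, hy, h0, fun k hk hk' => ?_, fun k hk => ?_⟩
    · obtain rfl : k = 1 := by omega
      exact hV1 x hx y hy h0
    · rcases (show k = 0 ∨ k = 1 by omega) with rfl | rfl
      · exact hS0 x y
      · exact chainComm_one x y
  · obtain ⟨x', hx', y', hy', h0', hc⟩ := hV.exists_lie_eq_zero hx hy h0 (h1 2 (by omega) (by omega))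
    have hcm := hV.chain_mem hx' hy'
    have hS2 : ChainComm x' y' 2 := (chainComm_one x' y').succ_of_eq_zero le_rfl hc
    have hS3 : ChainComm x' y' 3 := hS2.succ_of_even (by omega) even_two
    have hV2 : V 2 ≤ span ℝ {chain x' y' 2} :=
      hV.succ_le_of_singleton h0' (hcm 1) (hV1 x' hx' y' hy' h0') hzV (mem_span_singleton_self _)
        (by rw [hS2.lie_eq_zero rfl]; exact zero_mem _)
    have hV3 : V 3 ≤ span ℝ {chain x' y' 3} :=
      hV.succ_le_of_singleton h0' (hcm 2) hV2 hzV (mem_span_singleton_self _)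
        (by rw [hS3.lie_eq_zero rfl]; exact zero_mem _)
    obtain ⟨m, hm⟩ : ∃ m, t = 3 + 2 * m := by
      obtain ⟨m, rfl⟩ := ht
      exact ⟨m - 1, by omega⟩
    have hp := hV.propagate hx' hy' hzV h0'
      (fun k => by rw [show ⁅y', chain x' y' 1⁆ = 0 from hc, zero_lie]) (by decide : Odd 3) le_rfl
      hV3 hS3 m (fun k hk hk' => h1 k (by omega) (by omega)) (hm ▸ h2)
    refine ⟨x', hx', y', hy', h0', fun k hk hk' => ?_, fun k hk => ?_⟩
    · rcases (show k = 1 ∨ k = 2 ∨ 3 ≤ k by omega) with rfl | rfl | h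
      · exact hV1 x' hx' y' hy' h0'
      · exact hV2
      · exact (hp k h (by omega)).1
    · rcases (show k = 0 ∨ k = 1 ∨ k = 2 ∨ 3 ≤ k by omega) with rfl | rfl | rfl | h
      · exact hS0 x' y'
      · exact chainComm_one x' y'
      · exact hS2
      · exact (hp k h (by omega)).2

end Propagation

/-! ### The graded types, and what follows the two-dimensional component -/

section Types

variable {L : Type*} [LieRing L] [LieAlgebra ℝ L] {V : ℕ → Submodule ℝ L}

open Submodule

/-- A naturally graded algebra of type `L_{2n-1} ⊕ ℝ`, with components `V 0, ..., V M`. -/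
structure TypeLR (V : ℕ → Submodule ℝ L) (M : ℕ) (x y z : L) : Prop where
  mem_x : x ∈ V 0
  mem_y : y ∈ V 0
  mem_z : z ∈ V 0
  span_zero : V 0 ≤ span ℝ {x, y, z}
  central : ∀ k, ∀ w ∈ V k, ⁅z, w⁆ = 0
  span_chain : ∀ k, 1 ≤ k → k ≤ M → V k ≤ span ℝ {chain x y k}
  comm : ∀ k, k ≤ M → ChainComm x y k

/-- A naturally graded algebra of type `L_{2n,r}`, `r = 2q+1`, with components `V 0, ..., V M`. -/
structure TypeL (V : ℕ → Submodule ℝ L) (M q : ℕ) (x y : L) : Prop where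
  one_le : 1 ≤ q
  lt : 2 * q < M
  mem_x : x ∈ V 0
  mem_y : y ∈ V 0
  span_zero : V 0 ≤ span ℝ {x, y}
  lie_x : ⁅x, ⁅y, chain x y (2 * q - 1)⁆⁆ = 0
  lie_y : ⁅y, ⁅y, chain x y (2 * q - 1)⁆⁆ = 0
  span_chain : ∀ k, 1 ≤ k → k ≤ M → k ≠ 2 * q → V k ≤ span ℝ {chain x y k}
  span_mid : V (2 * q) ≤ span ℝ {chain x y (2 * q), ⁅y, chain x y (2 * q - 1)⁆}
  comm : ∀ k, k ≤ M → k ≠ 2 * q → ChainComm x y k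

/-- A naturally graded algebra of type `T_{2n,2n-3}`, `2n = 2q + 4`, with components
`V 0, ..., V (2q+1)`. -/
structure TypeT (V : ℕ → Submodule ℝ L) (q : ℕ) (x y : L) : Prop where
  one_le : 1 ≤ q
  mem_x : x ∈ V 0
  mem_y : y ∈ V 0
  span_zero : V 0 ≤ span ℝ {x, y}
  chain_top : chain x y (2 * q + 1) = 0
  lie_y : ⁅y, ⁅y, chain x y (2 * q - 1)⁆⁆ = 0
  span_chain : ∀ k, 1 ≤ k → k < 2 * q → V k ≤ span ℝ {chain x y k}
  span_mid : V (2 * q) ≤ span ℝ {chain x y (2 * q), ⁅y, chain x y (2 * q - 1)⁆}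
  span_top : V (2 * q + 1) ≤ span ℝ {⁅x, ⁅y, chain x y (2 * q - 1)⁆⁆}
  comm : ∀ k, k < 2 * q → ChainComm x y k

/-- A naturally graded algebra of type `N_{6,3}`, with components `V 0, ..., V 3`. -/
structure TypeN (V : ℕ → Submodule ℝ L) (x y : L) : Prop where
  mem_x : x ∈ V 0
  mem_y : y ∈ V 0
  span_zero : V 0 ≤ span ℝ {x, y}
  span_one : V 1 ≤ span ℝ {chain x y 1}
  span_two : V 2 ≤ span ℝ {chain x y 2, ⁅y, chain x y 1⁆}
  span_three : V 3 ≤ span ℝ {chain x y 3}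
  lie_x : ⁅x, ⁅y, chain x y 1⁆⁆ = 0
  lie_y : ⁅y, ⁅y, chain x y 1⁆⁆ = chain x y 3
  lie_y_two : ⁅y, chain x y 2⁆ = 0

/-- With `[x, Y] = 0` the brackets of the chain at index `2q + 1` vanish, and `Y` contributes
nothing to `V (2q+1)`. So the chain alone spans from there on, and `propagate` applies with the odd
starting index `2q + 1`. -/
theorem NatGraded.typeL_of_central (hV : NatGraded V) {x y : L} {q M : ℕ} (hq : 1 ≤ q)
    (hM : Odd M) (hqM : 2 * q < M) (hx : x ∈ V 0) (hy : y ∈ V 0) (h0 : V 0 ≤ span ℝ {x, y})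
    (hsp : ∀ k, 1 ≤ k → k < 2 * q → V k ≤ span ℝ {chain x y k})
    (hcomm : ∀ k, k < 2 * q → ChainComm x y k)
    (hmid : V (2 * q) ≤ span ℝ {chain x y (2 * q), ⁅y, chain x y (2 * q - 1)⁆})
    (hxY : ⁅x, ⁅y, chain x y (2 * q - 1)⁆⁆ = 0) (hyY : ⁅y, ⁅y, chain x y (2 * q - 1)⁆⁆ = 0)
    (h1 : ∀ k, 2 * q < k → k ≤ M → Module.finrank ℝ (V k) = 1) : TypeL V M q x y := by
  have hcm := hV.chain_mem hx hy
  have h0' : V 0 ≤ span ℝ {x, y, 0} := h0.trans (span_mono (by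
    intro s; simp only [Set.mem_insert_iff, Set.mem_singleton_iff]; tauto))
  have hS : ChainComm x y (2 * q + 1) := by
    intro p s hps
    rw [lie_chain_of_alternating (N := 2 * q - 1) (κ := q) (Y := ⁅y, chain x y (2 * q - 1)⁆)
      (by omega) (fun p s hps => (hcomm _ (by omega)).lie_eq (by omega) hps) (by omega), hxY,
      smul_zero]
  have hVt : V (2 * q + 1) ≤ span ℝ {chain x y (2 * q + 1)} := by
    refine hV.succ_le h0 hmid ?_
    rintro s (rfl | rfl) t (rfl | rfl)
    · exact mem_span_singleton_self _
    · rw [hxY]; exact zero_mem _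
    · rw [hS.lie_eq_zero rfl]; exact zero_mem _
    · rw [hyY]; exact zero_mem _
  -- For `q = 1` the element `[y, c 1]` is `Y` itself, which commutes with the generators; for `q ≥
  -- 2` it is zero.
  have hc : ∀ k, ⁅⁅y, chain x y 1⁆, chain x y k⁆ = 0 := by
    rcases (show q = 1 ∨ 2 ≤ q by omega) with rfl | h
    · exact lie_chain_eq_zero hxY hyY
    · intro k
      rw [(hcomm 2 (by omega)).lie_eq_zero rfl, zero_lie]
  obtain ⟨m, hm⟩ : ∃ m, M = 2 * q + 1 + 2 * m := by
    obtain ⟨m, rfl⟩ := hM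
    exact ⟨m - q, by omega⟩
  have hp := hV.propagate hx hy (z := 0) (by simp) h0' hc (t := 2 * q + 1) ⟨q, rfl⟩ (by omega)
    hVt hS m (fun k hk hk' => h1 k (by omega) (by omega))
    (ne_bot_of_finrank_eq_one (h1 _ (by omega) (by omega)))
  refine ⟨hq, hqM, hx, hy, h0, hxY, hyY, fun k hk hk' hne => ?_, hmid, fun k hk hne => ?_⟩
  · rcases lt_or_gt_of_ne hne with h | h
    · exact hsp k hk h
    · exact (hp k (by omega) (by omega)).1
  · rcases lt_or_gt_of_ne hne with h | h
    · exact hcomm k h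
    · exact (hp k (by omega) (by omega)).2

/-- The brackets two and three degrees above the one in which `Y = [y, c (2q-1)]` lives. -/
theorem tail_relations {x y : L} {q : ℕ} (hq : 1 ≤ q)
    (hcomm : ∀ k, k < 2 * q → ChainComm x y k) (htop : chain x y (2 * q + 1) = 0) {U : L}
    (hU : ⁅x, ⁅y, chain x y (2 * q - 1)⁆⁆ = U)
    (hyY : ⁅y, ⁅y, chain x y (2 * q - 1)⁆⁆ = 0) :
    ⁅x, ⁅x, U⁆⁆ = 0 ∧ ⁅y, ⁅y, U⁆⁆ = 0 ∧ ⁅x, ⁅y, U⁆⁆ = (q : ℝ) • ⁅y, ⁅x, U⁆⁆ := by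
  obtain ⟨N, hN⟩ : ∃ N, 2 * q = N + 1 := ⟨2 * q - 1, by omega⟩
  have hN' : 2 * q - 1 = N := by omega
  rw [hN'] at hU hyY
  have e1 : ∀ p s, p + s = N → ⁅chain x y p, chain x y s⁆ = (-1 : ℝ) ^ p • ⁅y, chain x y N⁆ :=
    fun p s hps => (hcomm N (by omega)).lie_eq (by omega) hps
  have e2 : ∀ p s, p + s = N + 1 →
      ⁅chain x y p, chain x y s⁆ = ((-1 : ℝ) ^ p * ((q : ℝ) - p)) • U := by
    intro p s hps
    rw [← hU]
    exact lie_chain_of_alternating hN.symm e1 hps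
  have e3 : ∀ p s, p + s = N + 1 + 1 → ⁅chain x y p, chain x y s⁆ =
      -((-1 : ℝ) ^ p • (∑ m ∈ Finset.range p, ((q : ℝ) - m)) • ⁅x, U⁆) := by
    intro p s hps
    rw [lie_chain_recursion x y (N := N + 1) (fun m => ((q : ℝ) - m) • ⁅x, U⁆)
      (fun p s hps => by rw [e2 p s hps, lie_smul, mul_smul]) p s hps, Finset.sum_smul,
      ← hN, htop]
    simp
  -- The middle relation `[c (q+1), c (q+1)] = 0`, combined with `c (2q+2) = 0`, leaves a multiple
  -- of `[x, [x, U]]`. Its coefficient is, up to sign, a sum over `p ≤ q` of nonnegative terms, and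
  -- `p = 1` contributes `q > 0`.
  have hA : ⁅x, ⁅x, U⁆⁆ = 0 := by
    have h := lie_chain_middle x y (N := N + 1 + 1) (κ := q + 1) (by omega)
      (fun p => (-∑ m ∈ Finset.range p, ((q : ℝ) - m)) • ⁅x, ⁅x, U⁆⁆)
      (fun p s hps => by rw [e3 p s hps, lie_neg, lie_smul, lie_smul, neg_smul, smul_neg])
    rw [chain_eq_zero_of_le htop (by omega), lie_zero, ← Finset.sum_smul, eq_comm,
      smul_eq_zero] at h
    refine h.resolve_left ?_
    rw [Finset.sum_neg_distrib, neg_eq_zero]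
    refine ne_of_gt (Finset.sum_pos' (fun p hp => Finset.sum_nonneg fun m hm => ?_)
      ⟨1, by simp; omega, by simp; omega⟩)
    rw [Finset.mem_range] at hp hm
    have : (m : ℝ) ≤ q := by exact_mod_cast (by omega : m ≤ q)
    linarith
  set Y := ⁅y, chain x y N⁆ with hY
  have hc1 : ⁅x, y⁆ = chain x y 1 := rfl
  have hB : ⁅chain x y 1, Y⁆ = -⁅y, U⁆ := by
    have h := leibniz_lie x y Y
    rw [hyY, lie_zero, hU, hc1] at h
    exact eq_neg_of_add_eq_zero_left h.symm
  have hBC : ⁅chain x y 2, Y⁆ + ⁅chain x y 1, U⁆ = -⁅x, ⁅y, U⁆⁆ := by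
    have h := leibniz_lie x (chain x y 1) Y
    rw [hB, hU, lie_neg] at h
    exact h.symm
  have hCD : ⁅x, ⁅y, U⁆⁆ = ⁅chain x y 1, U⁆ + ⁅y, ⁅x, U⁆⁆ := leibniz_lie x y U
  have hDB : ⁅⁅y, chain x y 1⁆, Y⁆ = -⁅y, ⁅y, U⁆⁆ := by
    have h := leibniz_lie y (chain x y 1) Y
    rw [hyY, lie_zero, hB, lie_neg, add_zero] at h
    exact h.symm
  have h2Y : ⁅chain x y 2, Y⁆ = ⁅⁅chain x y 2, y⁆, chain x y N⁆ +
      ⁅y, ⁅chain x y 2, chain x y N⁆⁆ := leibniz_lie _ _ _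
  have h2N : ⁅y, ⁅chain x y 2, chain x y N⁆⁆ = -((2 * q - 1 : ℝ) • ⁅y, ⁅x, U⁆⁆) := by
    rw [e3 2 N (by omega), lie_neg]
    simp only [Finset.sum_range_succ, Finset.sum_range_zero, lie_smul]
    norm_num
    module
  -- For `q = 1` one has `[y, c 1] = Y` and `[c 2, y] = -U`; for `q ≥ 2` both brackets vanish. The
  -- elimination therefore has different coefficients, but the outcome is the same.
  rcases (show q = 1 ∨ 2 ≤ q by omega) with rfl | h2
  · obtain rfl : N = 1 := by omega
    rw [← hY, lie_self, eq_comm, neg_eq_zero] at hDB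
    have h20 : ⁅chain x y 2, y⁆ = -U := by
      have := e2 2 0 rfl
      rw [chain_zero] at this
      rw [this]
      norm_num
    have hU1 : ⁅U, chain x y 1⁆ = -⁅chain x y 1, U⁆ := (lie_skew _ _).symm
    rw [h20, neg_lie, hU1, h2N] at h2Y
    refine ⟨hA, hDB, ?_⟩
    rw [h2Y] at hBC
    push_cast at hBC ⊢
    linear_combination (norm := module) (1 / 3 : ℝ) • hBC + (2 / 3 : ℝ) • hCD
  · rw [(hcomm 2 (by omega)).lie_eq_zero rfl, zero_lie, eq_comm, neg_eq_zero] at hDB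
    have h20 : ⁅chain x y 2, y⁆ = 0 := hcomm 3 (by omega) 2 0 rfl
    rw [h20, zero_lie, zero_add, h2N] at h2Y
    refine ⟨hA, hDB, ?_⟩
    rw [h2Y] at hBC
    have e : ⁅chain x y 1, U⁆ = ⁅x, ⁅y, U⁆⁆ - ⁅y, ⁅x, U⁆⁆ := eq_sub_of_add_eq hCD.symm
    rw [e] at hBC
    linear_combination (norm := module) (1 / 2 : ℝ) • hBC

end Types

/-! ### Noncentral `Y`, and the two-dimensional component at index at least four -/

section Classification

variable {L : Type*} [LieRing L] [LieAlgebra ℝ L] {V : ℕ → Submodule ℝ L}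

open Submodule

/-- Since `M` is odd, `M ≠ 2q + 1` would mean `M ≥ 2q + 3`. But `tail_relations`, read on a
generator `w` of the line `V (2q+2)`, forces `[x, w] = [y, w] = 0`, hence `V (2q+3) = 0`. -/
theorem NatGraded.typeT_of_chain_eq_zero (hV : NatGraded V) {x y : L} {q M : ℕ} (hq : 1 ≤ q)
    (hM : Odd M) (hqM : 2 * q < M) (hx : x ∈ V 0) (hy : y ∈ V 0) (h0 : V 0 ≤ span ℝ {x, y})
    (hsp : ∀ k, 1 ≤ k → k < 2 * q → V k ≤ span ℝ {chain x y k})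
    (hcomm : ∀ k, k < 2 * q → ChainComm x y k)
    (hmid : V (2 * q) ≤ span ℝ {chain x y (2 * q), ⁅y, chain x y (2 * q - 1)⁆})
    (htop : chain x y (2 * q + 1) = 0) (hyY : ⁅y, ⁅y, chain x y (2 * q - 1)⁆⁆ = 0)
    (h1 : ∀ k, 2 * q < k → k ≤ M → Module.finrank ℝ (V k) = 1) :
    M = 2 * q + 1 ∧ TypeT V q x y := by
  have hcm := hV.chain_mem hx hy
  have hyc : ⁅y, chain x y (2 * q)⁆ = (q : ℝ) • ⁅x, ⁅y, chain x y (2 * q - 1)⁆⁆ := by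
    have := lie_chain_of_alternating (x := x) (N := 2 * q - 1) (κ := q)
      (Y := ⁅y, chain x y (2 * q - 1)⁆)
      (by omega) (fun p s hps => (hcomm _ (by omega)).lie_eq (by omega) hps)
      (p := 0) (q := 2 * q) (by omega)
    simpa [chain_zero] using this
  set U := ⁅x, ⁅y, chain x y (2 * q - 1)⁆⁆ with hU
  have htop' : V (2 * q + 1) ≤ span ℝ {U} := by
    refine hV.succ_le h0 hmid ?_
    rintro s (rfl | rfl) t (rfl | rfl)
    · rw [← chain_succ, htop]; exact zero_mem _
    · exact mem_span_singleton_self _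
    · rw [hyc]; exact smul_mem _ _ (mem_span_singleton_self _)
    · rw [hyY]; exact zero_mem _
  refine ⟨?_, hq, hx, hy, h0, htop, hyY, hsp, hmid, htop', hcomm⟩
  by_contra hne
  have hM3 : 2 * q + 3 ≤ M := by
    obtain ⟨m, rfl⟩ := hM
    omega
  obtain ⟨hA, hB, hC⟩ := tail_relations hq hcomm htop hU.symm hyY
  have hUm : U ∈ V (2 * q + 1) := by
    have h := hV.lie_mem hx (hV.lie_mem hy (hcm (2 * q - 1)))
    rwa [show 0 + (0 + (2 * q - 1) + 1) + 1 = 2 * q + 1 by omega] at h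
  obtain ⟨w, hw, hw0, hwc⟩ := exists_span_singleton_of_finrank_eq_one
    (h1 (2 * q + 2) (by omega) (by omega))
  obtain ⟨a, ha⟩ := hwc ⁅x, U⁆ (by simpa using hV.lie_mem hx hUm)
  obtain ⟨b, hb⟩ := hwc ⁅y, U⁆ (by simpa using hV.lie_mem hy hUm)
  have hab : ¬(a = 0 ∧ b = 0) := by
    rintro ⟨rfl, rfl⟩
    refine ne_bot_of_finrank_eq_one (h1 (2 * q + 2) (by omega) (by omega)) ?_
    rw [eq_bot_iff]
    refine hV.succ_le h0 htop' ?_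
    rintro s (rfl | rfl) t rfl
    · simp [ha]
    · simp [hb]
  rw [ha] at hA hC
  rw [hb] at hB hC
  simp only [lie_smul, smul_eq_zero] at hA hB hC
  have hxy : ⁅x, w⁆ = 0 ∧ ⁅y, w⁆ = 0 := by
    have hq0 : (q : ℝ) ≠ 0 := by positivity
    by_cases ha0 : a = 0
    · have hb0 : b ≠ 0 := fun h => hab ⟨ha0, h⟩
      rw [ha0, zero_smul, smul_zero, smul_eq_zero] at hC
      exact ⟨hC.resolve_left hb0, hB.resolve_left hb0⟩
    · have hx0 := hA.resolve_left ha0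
      rw [hx0, smul_zero, smul_smul, eq_comm, smul_eq_zero] at hC
      exact ⟨hx0, hC.resolve_left (mul_ne_zero hq0 ha0)⟩
  refine ne_bot_of_finrank_eq_one (h1 (2 * q + 2 + 1) (by omega) (by omega)) ?_
  rw [eq_bot_iff]
  refine hV.succ_le h0 (T := {w}) (fun v hv => ?_) ?_
  · obtain ⟨c, rfl⟩ := hwc v hv
    exact smul_mem _ _ (mem_span_singleton_self w)
  · rintro s (rfl | rfl) t rfl
    · simp [hxy.1]
    · simp [hxy.2]

/-- The case where the component of dimension two has degree at least five. -/
theorem NatGraded.classify_of_two_le (hV : NatGraded V) {x y : L} {q M : ℕ} (hq : 2 ≤ q)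
    (hM : Odd M) (hqM : 2 * q < M) (hx : x ∈ V 0) (hy : y ∈ V 0) (h0 : V 0 ≤ span ℝ {x, y})
    (hsp : ∀ k, 1 ≤ k → k < 2 * q → V k ≤ span ℝ {chain x y k})
    (hcomm : ∀ k, k < 2 * q → ChainComm x y k)
    (h1 : ∀ k, 2 * q < k → k ≤ M → Module.finrank ℝ (V k) = 1) :
    (∃ x y, TypeL V M q x y) ∨ (M = 2 * q + 1 ∧ ∃ x y, TypeT V q x y) := by
  have hcm := hV.chain_mem hx hy
  obtain ⟨N, hN⟩ : ∃ N, 2 * q = N + 1 := ⟨2 * q - 1, by omega⟩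
  have hN' : 2 * q - 1 = N := by omega
  have hyY : ⁅y, ⁅y, chain x y (2 * q - 1)⁆⁆ = 0 :=
    lie_lie_chain_eq_zero (by omega) (hcomm _ (by omega)) fun k => by
      rw [(hcomm 2 (by omega)).lie_eq_zero rfl, zero_lie]
  have hmid : V (2 * q) ≤ span ℝ {chain x y (2 * q), ⁅y, chain x y (2 * q - 1)⁆} := by
    rw [hN', hN]
    refine hV.succ_le h0 (hsp N (by omega) (by omega)) ?_
    rintro s (rfl | rfl) t rfl
    · exact subset_span (by simp [chain_succ])
    · exact subset_span (by simp)
  by_cases hU : ⁅x, ⁅y, chain x y (2 * q - 1)⁆⁆ = 0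
  · exact Or.inl ⟨x, y, hV.typeL_of_central (by omega) hM hqM hx hy h0 hsp hcomm hmid hU hyY h1⟩
  · right
    have hyc : ⁅y, chain x y (2 * q)⁆ = (q : ℝ) • ⁅x, ⁅y, chain x y (2 * q - 1)⁆⁆ := by
      have := lie_chain_of_alternating (x := x) (N := 2 * q - 1) (κ := q)
        (Y := ⁅y, chain x y (2 * q - 1)⁆)
        (by omega) (fun p s hps => (hcomm _ (by omega)).lie_eq (by omega) hps)
        (p := 0) (q := 2 * q) (by omega)
      simpa [chain_zero] using this
    obtain ⟨w, hw, hw0, hwc⟩ := exists_span_singleton_of_finrank_eq_one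
      (h1 (2 * q + 1) (by omega) (by omega))
    have hYm : ⁅y, chain x y (2 * q - 1)⁆ ∈ V (2 * q) := by
      have h := hV.lie_mem hy (hcm (2 * q - 1))
      rwa [show 0 + (2 * q - 1) + 1 = 2 * q by omega] at h
    obtain ⟨a, ha⟩ := hwc (chain x y (2 * q + 1)) (hcm _)
    obtain ⟨b, hb⟩ := hwc ⁅x, ⁅y, chain x y (2 * q - 1)⁆⁆ (by simpa using hV.lie_mem hx hYm)
    have hb0 : b ≠ 0 := by
      rintro rfl
      exact hU (by rw [hb, zero_smul])
    -- Replacing `x` by `x + τ y` keeps the chain up to index `2q - 1` and adds `τ Y` to `c (2q)`.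
    -- By `[y, c (2q)] = q [x, Y]` and `[y, Y] = 0` the element `c (2q+1)` becomes `(a + τ b + τ q
    -- b) w`, and `τ` is the root of this coefficient.
    set τ : ℝ := -(a / b) / (q + 1) with hτ
    have hch := chain_add_smul (x := x) (y := y) τ (k := 2 * q - 1)
      (fun p hp => (hcomm (p + 1) (by omega)).lie_eq_zero rfl)
    have hY' : chain (x + τ • y) y (2 * q - 1) = chain x y (2 * q - 1) := hch _ le_rfl
    have hq1 : chain (x + τ • y) y (2 * q) =
        chain x y (2 * q) + τ • ⁅y, chain x y (2 * q - 1)⁆ := by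
      rw [hN', hN] at *
      rw [chain_succ, hY', add_lie, smul_lie, chain_succ]
    have hq2 : chain (x + τ • y) y (2 * q + 1) = 0 := by
      rw [chain_succ, hq1, add_lie, lie_add, lie_add, smul_lie, smul_lie, lie_smul, lie_smul, hyY,
        hyc, ← chain_succ, ha, hb]
      have : (q : ℝ) + 1 ≠ 0 := by positivity
      simp only [smul_smul, smul_zero, add_zero, ← add_smul]
      rw [show a + τ * b + τ * (q * b) = 0 by rw [hτ]; field_simp; ring, zero_smul]
    have hxt : x + τ • y ∈ V 0 := add_mem hx (smul_mem _ _ hy)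
    have h0' : V 0 ≤ span ℝ {x + τ • y, y} := by
      refine h0.trans (span_le.mpr ?_)
      rintro s (rfl | rfl)
      · have : s = (s + τ • y) - τ • y := by abel
        rw [this]
        exact sub_mem (subset_span (by simp)) (smul_mem _ _ (subset_span (by simp)))
      · exact subset_span (by simp)
    have hmid' : V (2 * q) ≤ span ℝ {chain (x + τ • y) y (2 * q),
        ⁅y, chain (x + τ • y) y (2 * q - 1)⁆} := by
      rw [hY', hq1]
      refine hmid.trans (span_le.mpr ?_)
      rintro s (rfl | rfl)
      · have : chain x y (2 * q) = (chain x y (2 * q) + τ • ⁅y, chain x y (2 * q - 1)⁆) -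
          τ • ⁅y, chain x y (2 * q - 1)⁆ := by abel
        rw [this]
        exact sub_mem (subset_span (by simp)) (smul_mem _ _ (subset_span (by simp)))
      · exact subset_span (by simp)
    have := hV.typeT_of_chain_eq_zero (by omega) hM hqM hxt hy h0'
      (fun k hk hk' => by rw [hch k (by omega)]; exact hsp k hk hk')
      (fun k hk p s hps => by
        rw [hch p (by omega), hch s (by omega)]; exact hcomm k hk p s hps)
      hmid' hq2 (by rw [hY']; exact hyY) h1
    exact ⟨this.1, _, _, this.2⟩

end Classification

/-! ### The two-dimensional component at index two: binary quadratic forms -/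

section SmallDegree

variable {L : Type*} [LieRing L] [LieAlgebra ℝ L] {V : ℕ → Submodule ℝ L}

open Submodule

/-- Normal forms, up to a scalar, of a real binary quadratic form. -/
theorem exists_normal_form (α β γ : ℝ) : ∃ a b c d : ℝ, a * d - b * c ≠ 0 ∧
    ((a * c * α + (a * d + b * c) * β + b * d * γ = 0 ∧
        c * c * α + 2 * (c * d) * β + d * d * γ = 0) ∨
      (a * a * α + 2 * (a * b) * β + b * b * γ = 0 ∧
        c * c * α + 2 * (c * d) * β + d * d * γ = 0) ∨
      (a * c * α + (a * d + b * c) * β + b * d * γ = 0 ∧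
        a * a * α + 2 * (a * b) * β + b * b * γ =
          c * c * α + 2 * (c * d) * β + d * d * γ)) := by
  by_cases h : α = 0 ∧ γ = 0
  · obtain ⟨rfl, rfl⟩ := h
    exact ⟨1, 0, 0, 1, by norm_num, Or.inr (Or.inl (by norm_num))⟩
  -- Exchanging the two coordinates exchanges `α` and `γ`.
  wlog hα : α ≠ 0 generalizing α γ
  · obtain ⟨a, b, c, d, hd, h'⟩ := this γ α (by tauto) (by tauto)
    refine ⟨b, a, d, c, fun h0 => hd (by linear_combination -h0), ?_⟩
    rcases h' with ⟨h1, h2⟩ | ⟨h1, h2⟩ | ⟨h1, h2⟩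
    · exact Or.inl ⟨by linear_combination h1, by linear_combination h2⟩
    · exact Or.inr (Or.inl ⟨by linear_combination h1, by linear_combination h2⟩)
    · exact Or.inr (Or.inr ⟨by linear_combination h1, by linear_combination h2⟩)
  -- Negative: a definite form, with an orthogonal basis on which it takes equal values. Zero: the
  -- second basis vector spans the radical. Positive: two independent isotropic vectors.
  rcases lt_trichotomy (β ^ 2 - α * γ) 0 with hD | hD | hD
  · have hs := Real.sq_sqrt (show 0 ≤ -(β ^ 2 - α * γ) by linarith)
    have hs0 : √(-(β ^ 2 - α * γ)) ≠ 0 := (Real.sqrt_pos.mpr (by linarith)).ne'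
    set s := √(-(β ^ 2 - α * γ))
    refine ⟨s / α, 0, -(β / α), 1, by simp [hα, hs0], Or.inr (Or.inr ⟨?_, ?_⟩)⟩
    · field_simp; ring
    · field_simp; linear_combination hs
  · refine ⟨1, 0, -(β / α), 1, by simp, Or.inl ⟨?_, ?_⟩⟩
    · field_simp; ring
    · field_simp; linear_combination -hD
  · have hs := Real.sq_sqrt hD.le
    have hs0 : √(β ^ 2 - α * γ) ≠ 0 := (Real.sqrt_pos.mpr hD).ne'
    set s := √(β ^ 2 - α * γ)
    refine ⟨-(β / α) + s / α, 1, -(β / α) - s / α, 1, ?_, Or.inr (Or.inl ⟨?_, ?_⟩)⟩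
    · intro h0
      have : 2 * (s / α) = 0 := by linear_combination h0
      simp [hα, hs0] at this
    · field_simp; linear_combination hs
    · field_simp; linear_combination hs

/-- With `U = c 3`, the Jacobi identity gives `[x, [x, U]] = [y, [y, U]]` and `[x, [y, U]] = [y, [x,
U]] = 0`. As `[x, U]` and `[y, U]` span the line `V 4`, its generator commutes with `x` and `y`; so
`V 5 = 0`, which excludes every odd `M > 3`. -/
theorem NatGraded.typeN_tail (hV : NatGraded V) {x y : L} {M : ℕ} (h3 : 3 ≤ M)
    (hM : Odd M) (h : TypeN V x y) (h1 : ∀ k, 2 < k → k ≤ M → Module.finrank ℝ (V k) = 1) :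
    M = 3 := by
  have hcm := hV.chain_mem h.mem_x h.mem_y
  by_contra hne
  have hM5 : 5 ≤ M := by
    obtain ⟨m, rfl⟩ := hM
    omega
  obtain ⟨w, hw, hw0, hwc⟩ := exists_span_singleton_of_finrank_eq_one
    (h1 4 (by omega) (by omega))
  obtain ⟨a, ha⟩ := hwc ⁅x, chain x y 3⁆ (by simpa using hV.lie_mem h.mem_x (hcm 3))
  obtain ⟨b, hb⟩ := hwc ⁅y, chain x y 3⁆ (by simpa using hV.lie_mem h.mem_y (hcm 3))
  have hab : ¬(a = 0 ∧ b = 0) := by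
    rintro ⟨rfl, rfl⟩
    refine ne_bot_of_finrank_eq_one (h1 4 (by omega) (by omega)) ?_
    rw [eq_bot_iff]
    refine hV.succ_le h.span_zero h.span_three ?_
    rintro s (rfl | rfl) t rfl
    · simp [ha]
    · simp [hb]
  have hxY := h.lie_x
  have hyY := h.lie_y
  have hy2 := h.lie_y_two
  have hx2 : ⁅x, chain x y 2⁆ = chain x y 3 := rfl
  have hx1 : ⁅x, chain x y 1⁆ = chain x y 2 := rfl
  have hx0 : ⁅x, y⁆ = chain x y 1 := rfl
  generalize chain x y 3 = U at *
  generalize chain x y 2 = X3 at *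
  generalize chain x y 1 = X2 at *
  set Y := ⁅y, X2⁆ with hY
  have e1 : ⁅X2, X3⁆ = -⁅y, U⁆ := by
    have h := leibniz_lie x y X3
    rw [hy2, lie_zero, hx0, hx2] at h
    exact eq_neg_of_add_eq_zero_left h.symm
  have e2 : ⁅X2, Y⁆ = ⁅x, U⁆ := by
    have h := leibniz_lie x y Y
    rw [hyY, hxY, lie_zero, hx0, add_zero] at h
    exact h.symm
  have e3 : ⁅x, ⁅y, U⁆⁆ = ⁅X2, U⁆ + ⁅y, ⁅x, U⁆⁆ := by rw [leibniz_lie, hx0]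
  have e4 : ⁅X2, U⁆ = -⁅x, ⁅y, U⁆⁆ := by
    have h := leibniz_lie x X2 X3
    rw [e1, lie_neg, hx1, lie_self, hx2, zero_add] at h
    exact h.symm
  have e5 : ⁅X2, U⁆ = ⁅y, ⁅x, U⁆⁆ := by
    have h := leibniz_lie y X2 Y
    rw [e2, ← hY, lie_self, hyY, zero_add] at h
    exact h.symm
  have hxX : ⁅x, ⁅X2, Y⁆⁆ = ⁅X3, Y⁆ := by rw [leibniz_lie, hx1, hxY, lie_zero, add_zero]
  have hyX : ⁅y, ⁅X2, X3⁆⁆ = -⁅X3, Y⁆ := by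
    rw [leibniz_lie, ← hY, hy2, lie_zero, add_zero, lie_skew]
  have e6 : ⁅x, ⁅x, U⁆⁆ = ⁅y, ⁅y, U⁆⁆ := by
    rw [e2] at hxX
    rw [e1, lie_neg, neg_inj] at hyX
    rw [hxX, hyX]
  -- The relations `e3`, `e4`, `e5` between `[c 1, U]`, `[x, [y, U]]` and `[y, [x, U]]` combine to
  -- `3 [x, [y, U]] = 0`.
  have e7 : ⁅x, ⁅y, U⁆⁆ = 0 := by
    rw [e5] at e3 e4
    have : (3 : ℝ) • ⁅x, ⁅y, U⁆⁆ = 0 := by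
      linear_combination (norm := module) e3 + (2 : ℝ) • e4
    exact (smul_eq_zero.mp this).resolve_left (by norm_num)
  have e8 : ⁅y, ⁅x, U⁆⁆ = 0 := by rw [← e5, e4, e7, neg_zero]
  rw [ha] at e6 e8
  rw [hb] at e6 e7
  simp only [lie_smul, smul_eq_zero] at e6 e7 e8
  have hxy : ⁅x, w⁆ = 0 ∧ ⁅y, w⁆ = 0 := by
    by_cases ha0 : a = 0
    · have hb0 : b ≠ 0 := fun h => hab ⟨ha0, h⟩
      rw [ha0, zero_smul, eq_comm, smul_eq_zero] at e6
      exact ⟨e7.resolve_left hb0, e6.resolve_left hb0⟩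
    · have hy0 := e8.resolve_left ha0
      rw [hy0, smul_zero, smul_eq_zero] at e6
      exact ⟨e6.resolve_left ha0, hy0⟩
  refine ne_bot_of_finrank_eq_one (h1 5 (by omega) (by omega)) ?_
  rw [eq_bot_iff]
  refine hV.succ_le (k := 4) h.span_zero (T := {w}) (fun v hv => ?_) ?_
  · obtain ⟨c, rfl⟩ := hwc v hv
    exact smul_mem _ _ (mem_span_singleton_self w)
  · rintro s (rfl | rfl) t rfl
    · simp [hxy.1]
    · simp [hxy.2]

theorem NatGraded.one_le_span (hV : NatGraded V) {x y : L} (h0 : V 0 ≤ span ℝ {x, y}) :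
    V 1 ≤ span ℝ {chain x y 1} := by
  refine hV.succ_le h0 h0 ?_
  rintro s (rfl | rfl) t (rfl | rfl)
  · simp
  · exact mem_span_singleton_self _
  · rw [← lie_skew]
    exact neg_mem (mem_span_singleton_self _)
  · simp

/-- The case where the component of dimension two has degree three. -/
theorem NatGraded.classify_of_eq_two (hV : NatGraded V) {x y : L} {M : ℕ}
    (hM : Odd M) (h3 : 2 < M) (hx : x ∈ V 0) (hy : y ∈ V 0) (h0 : V 0 ≤ span ℝ {x, y})
    (h1 : ∀ k, 2 < k → k ≤ M → Module.finrank ℝ (V k) = 1) :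
    (∃ x y, TypeL V M 1 x y) ∨ (M = 2 * 1 + 1 ∧ ∃ x y, TypeT V 1 x y) ∨
      (M = 3 ∧ ∃ x y, TypeN V x y) := by
  obtain ⟨w, hw, hw0, hwc⟩ := exists_span_singleton_of_finrank_eq_one
    (h1 3 (by omega) (by omega))
  have hm : ∀ u ∈ V 0, ∀ v ∈ V 0, ⁅u, ⁅v, ⁅x, y⁆⁆⁆ ∈ V 3 := fun u hu v hv => by
    simpa using hV.lie_mem hu (hV.lie_mem hv (hV.lie_mem hx hy))
  obtain ⟨α, hα⟩ := hwc _ (hm x hx x hx)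
  obtain ⟨β, hβ⟩ := hwc _ (hm x hx y hy)
  obtain ⟨γ, hγ⟩ := hwc _ (hm y hy y hy)
  -- Symmetry of the form `(u, v) ↦ [u, [v, [x, y]]]`, because `[[x, y], [x, y]] = 0`.
  have hβ' : ⁅y, ⁅x, ⁅x, y⁆⁆⁆ = β • w := by
    have h := leibniz_lie x y ⁅x, y⁆
    rw [lie_self, zero_add, hβ] at h
    exact h.symm
  -- New generators multiply `[x, y]` by the determinant, so the form is transformed as usual and
  -- rescaled. The conditions of the normal form are insensitive to the scalar.
  obtain ⟨a, b, c, d, hδ, hn⟩ := exists_normal_form α β γ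
  set x' := a • x + b • y with hx'
  set y' := c • x + d • y with hy'
  have hxm : x' ∈ V 0 := add_mem (smul_mem _ _ hx) (smul_mem _ _ hy)
  have hym : y' ∈ V 0 := add_mem (smul_mem _ _ hx) (smul_mem _ _ hy)
  have h0' : V 0 ≤ span ℝ {x', y'} := by
    refine h0.trans (span_le.mpr ?_)
    have key : ∀ s, (a * d - b * c) • s ∈ span ℝ {x', y'} → s ∈ span ℝ {x', y'} := by
      intro s hs
      have := smul_mem (span ℝ {x', y'}) (a * d - b * c)⁻¹ hs
      rwa [smul_smul, inv_mul_cancel₀ hδ, one_smul] at this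
    rintro s (rfl | rfl) <;> refine key _ (mem_span_pair.mpr ?_)
    · exact ⟨d, -b, by rw [hx', hy']; module⟩
    · exact ⟨-c, a, by rw [hx', hy']; module⟩
  have h1c : chain x' y' 1 = (a * d - b * c) • ⁅x, y⁆ := by
    have hyx : ⁅y, x⁆ = -⁅x, y⁆ := (lie_skew _ _).symm
    change ⁅x', y'⁆ = _
    simp only [hx', hy', add_lie, lie_add, smul_lie, lie_smul, lie_self, hyx]
    module
  have hxx : ⁅x', ⁅x', chain x' y' 1⁆⁆ =
      ((a * d - b * c) * (a * a * α + 2 * (a * b) * β + b * b * γ)) • w := by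
    rw [h1c]
    simp only [hx', add_lie, lie_add, smul_lie, lie_smul, hα, hβ, hβ', hγ]
    module
  have hxy : ⁅x', ⁅y', chain x' y' 1⁆⁆ =
      ((a * d - b * c) * (a * c * α + (a * d + b * c) * β + b * d * γ)) • w := by
    rw [h1c]
    simp only [hx', hy', add_lie, lie_add, smul_lie, lie_smul, hα, hβ, hβ', hγ]
    module
  have hyy : ⁅y', ⁅y', chain x' y' 1⁆⁆ =
      ((a * d - b * c) * (c * c * α + 2 * (c * d) * β + d * d * γ)) • w := by
    rw [h1c]
    simp only [hy', add_lie, lie_add, smul_lie, lie_smul, hα, hβ, hβ', hγ]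
    module
  have hyx : ⁅y', chain x' y' 2⁆ = ⁅x', ⁅y', chain x' y' 1⁆⁆ := by
    have h : ⁅x', ⁅y', chain x' y' 1⁆⁆ = ⁅chain x' y' 1, chain x' y' 1⁆ + ⁅y', chain x' y' 2⁆ :=
      leibniz_lie x' y' (chain x' y' 1)
    rw [lie_self, zero_add] at h
    exact h.symm
  clear_value x' y'
  have hV1 := hV.one_le_span h0'
  have hV2 : V 2 ≤ span ℝ {chain x' y' 2, ⁅y', chain x' y' 1⁆} := by
    refine hV.succ_le h0' hV1 ?_
    rintro s (rfl | rfl) t rfl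
    · exact subset_span (by simp [chain_succ])
    · exact subset_span (by simp)
  have hsp : ∀ k, 1 ≤ k → k < 2 * 1 → V k ≤ span ℝ {chain x' y' k} := by
    intro k hk hk'
    obtain rfl : k = 1 := by omega
    exact hV1
  have hcomm : ∀ k, k < 2 * 1 → ChainComm x' y' k := by
    intro k hk
    rcases (show k = 0 ∨ k = 1 by omega) with rfl | rfl
    · intro p q h; omega
    · exact chainComm_one _ _
  -- A radical vector `y'` makes `Y` central (type L). Isotropic `x'`, `y'` give `c 3 = 0` and `[y',
  -- Y] = 0` (type T). In the remaining case `[y', Y] = c 3` and `[x', Y] = 0` (type N).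
  rcases hn with ⟨n1, n2⟩ | ⟨n1, n2⟩ | ⟨n1, n2⟩
  · rw [n1, mul_zero, zero_smul] at hxy
    rw [n2, mul_zero, zero_smul] at hyy
    exact Or.inl ⟨x', y', hV.typeL_of_central le_rfl hM (by omega) hxm hym h0' hsp hcomm hV2 hxy
      hyy h1⟩
  · rw [n1, mul_zero, zero_smul] at hxx
    rw [n2, mul_zero, zero_smul] at hyy
    have := hV.typeT_of_chain_eq_zero le_rfl hM (by omega) hxm hym h0' hsp hcomm hV2 hxx hyy h1
    exact Or.inr (Or.inl ⟨this.1, x', y', this.2⟩)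
  · rw [n1, mul_zero, zero_smul] at hxy
    rw [hxy] at hyx
    rw [← n2, ← hxx] at hyy
    have hV3 : V 3 ≤ span ℝ {chain x' y' 3} := by
      refine hV.succ_le h0' hV2 ?_
      rintro s (rfl | rfl) t (rfl | rfl)
      · exact mem_span_singleton_self _
      · rw [hxy]; exact zero_mem _
      · rw [hyx]; exact zero_mem _
      · rw [hyy]; exact mem_span_singleton_self _
    have hN : TypeN V x' y' := ⟨hxm, hym, h0', hV1, hV2, hV3, hxy, hyy, hyx⟩
    exact Or.inr (Or.inr ⟨hV.typeN_tail (by omega) hM hN h1, x', y', hN⟩)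

end SmallDegree

/-! ### Choice of generators and the graded classification -/

section Generators

variable {L : Type*} [LieRing L] [LieAlgebra ℝ L] {V : ℕ → Submodule ℝ L}

open Submodule

theorem finrank_span_pair_of_lie_ne_zero {x y : L} (h : ⁅x, y⁆ ≠ 0) :
    Module.finrank ℝ (span ℝ {x, y}) = 2 := by
  have hli : LinearIndependent ℝ ![x, y] := by
    rw [LinearIndependent.pair_iff]
    intro s t hst
    constructor
    · have : s • ⁅x, y⁆ = 0 := by
        have := congrArg (⁅·, y⁆) hst
        simpa using this
      exact (smul_eq_zero.mp this).resolve_right h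
    · have : t • ⁅x, y⁆ = 0 := by
        have := congrArg (⁅x, ·⁆) hst
        simpa using this
      exact (smul_eq_zero.mp this).resolve_right h
  have := finrank_span_eq_card hli
  rwa [Matrix.range_cons_cons_empty, Fintype.card_fin] at this

theorem NatGraded.exists_lie_ne_zero (hV : NatGraded V) (h : V 1 ≠ ⊥) :
    ∃ x ∈ V 0, ∃ y ∈ V 0, ⁅x, y⁆ ≠ 0 := by
  by_contra! hne
  apply h
  rw [eq_bot_iff]
  refine (hV.gen 0).trans (span_le.mpr ?_)
  rintro _ ⟨u, hu, v, hv, rfl⟩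
  simp [hne u hu v hv]

theorem NatGraded.two_le_finrank (hV : NatGraded V) [Module.Finite ℝ (V 0)] (h : V 1 ≠ ⊥) :
    2 ≤ Module.finrank ℝ (V 0) := by
  obtain ⟨x, hx, y, hy, hxy⟩ := hV.exists_lie_ne_zero h
  rw [← finrank_span_pair_of_lie_ne_zero hxy]
  exact Submodule.finrank_mono (span_le.mpr (by rintro s (rfl | rfl) <;> assumption))

theorem NatGraded.exists_generators (hV : NatGraded V) (h : V 1 ≠ ⊥)
    (h2 : Module.finrank ℝ (V 0) = 2) :
    ∃ x ∈ V 0, ∃ y ∈ V 0, V 0 ≤ span ℝ {x, y} := by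
  have : Module.Finite ℝ (V 0) := Module.finite_of_finrank_pos (by omega)
  obtain ⟨x, hx, y, hy, hxy⟩ := hV.exists_lie_ne_zero h
  refine ⟨x, hx, y, hy, (Submodule.eq_of_le_of_finrank_le
    (span_le.mpr (by rintro s (rfl | rfl) <;> assumption)) ?_).ge⟩
  rw [finrank_span_pair_of_lie_ne_zero hxy, h2]

theorem NatGraded.finrank_one_le (hV : NatGraded V) (h2 : Module.finrank ℝ (V 0) = 2) :
    Module.finrank ℝ (V 1) ≤ 1 := by
  by_cases h : V 1 = ⊥
  · rw [h, finrank_bot]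
    omega
  · obtain ⟨x, hx, y, hy, h0⟩ := hV.exists_generators h h2
    refine (Submodule.finrank_mono (hV.one_le_span h0)).trans ?_
    exact (finrank_span_le_card _).trans (by simp)

/-- The bracket on the three-dimensional `V 0` is an alternating form with values in the line `V 1`,
so it has a kernel. A kernel vector commutes with `V 0`, hence with everything, and the other two
generators span a filiform part. -/
theorem NatGraded.exists_typeLR (hV : NatGraded V) {M : ℕ} (hM : Odd M)
    (h3 : Module.finrank ℝ (V 0) = 3)
    (h1 : ∀ k, 1 ≤ k → k ≤ M → Module.finrank ℝ (V k) = 1) : ∃ x y z, TypeLR V M x y z := by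
  have hM1 : 1 ≤ M := hM.pos
  have : Module.Finite ℝ (V 0) := Module.finite_of_finrank_pos (by omega)
  obtain ⟨x, hx, y, hy, hxy⟩ := hV.exists_lie_ne_zero
    (ne_bot_of_finrank_eq_one (h1 1 le_rfl hM1))
  have hle : span ℝ {x, y} ≤ V 0 := span_le.mpr (by rintro s (rfl | rfl) <;> assumption)
  obtain ⟨z, hz, hzn⟩ : ∃ z ∈ V 0, z ∉ span ℝ {x, y} := by
    by_contra! hall
    have hf : Module.Finite ℝ (span ℝ {x, y}) := Module.Finite.span_of_finite ℝ (by simp)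
    have := Submodule.finrank_mono (show V 0 ≤ span ℝ {x, y} from hall)
    rw [finrank_span_pair_of_lie_ne_zero hxy] at this
    omega
  have hle3 : span ℝ {x, y, z} ≤ V 0 :=
    span_le.mpr (by rintro s (rfl | rfl | rfl) <;> assumption)
  have hfin : Module.Finite ℝ (span ℝ {x, y, z}) := Module.Finite.span_of_finite ℝ (by simp)
  have hlt : span ℝ {x, y} < span ℝ {x, y, z} := by
    refine lt_of_le_of_ne (span_mono ?_) fun h => hzn (h ▸ subset_span (by simp))
    intro s; simp only [Set.mem_insert_iff, Set.mem_singleton_iff]; tauto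
  have h0 : V 0 ≤ span ℝ {x, y, z} := by
    refine (Submodule.eq_of_le_of_finrank_le hle3 ?_).ge
    have := Submodule.finrank_lt_finrank_of_lt hlt
    rw [finrank_span_pair_of_lie_ne_zero hxy] at this
    omega
  obtain ⟨w, hw, hw0, hwc⟩ := exists_span_singleton_of_finrank_eq_one (h1 1 le_rfl hM1)
  obtain ⟨c, hc⟩ := hwc ⁅x, y⁆ (by simpa using hV.lie_mem hx hy)
  obtain ⟨a, ha⟩ := hwc ⁅x, z⁆ (by simpa using hV.lie_mem hx hz)
  obtain ⟨b, hb⟩ := hwc ⁅y, z⁆ (by simpa using hV.lie_mem hy hz)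
  have hc0 : c ≠ 0 := by rintro rfl; simp [hc] at hxy
  have hyx : ⁅y, x⁆ = -(c • w) := by rw [← lie_skew, hc]
  -- The combination that cancels `[x, z] = a w` and `[y, z] = b w` against `[x, y] = c w`.
  set z' := z - (a / c) • y + (b / c) • x with hz'
  have hz'm : z' ∈ V 0 := add_mem (sub_mem hz (smul_mem _ _ hy)) (smul_mem _ _ hx)
  have hxz : ⁅x, z'⁆ = 0 := by
    simp only [hz', lie_add, lie_sub, lie_smul, ha, hc, lie_self, smul_smul, smul_zero, add_zero]
    rw [div_mul_cancel₀ _ hc0, sub_self]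
  have hyz : ⁅y, z'⁆ = 0 := by
    simp only [hz', lie_add, lie_sub, lie_smul, hb, hyx, lie_self, smul_neg, smul_smul, smul_zero,
      sub_zero]
    rw [div_mul_cancel₀ _ hc0, add_neg_cancel]
  have h0' : V 0 ≤ span ℝ {x, y, z'} := by
    refine h0.trans (span_le.mpr ?_)
    rintro s (rfl | rfl | rfl)
    · exact subset_span (by simp)
    · exact subset_span (by simp)
    · have : s = z' + (a / c) • y - (b / c) • x := by rw [hz']; abel
      rw [this]
      exact sub_mem (add_mem (subset_span (by simp)) (smul_mem _ _ (subset_span (by simp))))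
        (smul_mem _ _ (subset_span (by simp)))
  have hzc : ∀ u ∈ V 0, ⁅z', u⁆ = 0 := by
    intro u hu
    obtain ⟨p, q, r, rfl⟩ := mem_span_triple.mp (h0' hu)
    have hzx : ⁅z', x⁆ = 0 := by rw [← lie_skew, hxz, neg_zero]
    have hzy : ⁅z', y⁆ = 0 := by rw [← lie_skew, hyz, neg_zero]
    simp [hzx, hzy]
  obtain ⟨x', hx', y', hy', h0'', hsp, hcomm⟩ := hV.exists_filiform hx hy hzc h0' hM
    (fun k hk hk' => h1 k hk hk'.le) (ne_bot_of_finrank_eq_one (h1 M hM1 le_rfl))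
  exact ⟨x', y', z', hx', hy', hz'm, h0'', hV.lie_eq_zero hzc, hsp, hcomm⟩

/-- An odd `ρ` is impossible: the filiform analysis up to the odd index `ρ` shows that `V ρ` is
spanned by one chain element. For `ρ = 2q` the analysis is stopped at `2q - 1`. The case `q = 1` is
separate because `V 2` is then not a line, and `[y, [x, y]] = 0` cannot be arranged. -/
theorem NatGraded.classify (hV : NatGraded V) {M ρ : ℕ} (hM : Odd M)
    (h2 : Module.finrank ℝ (V 0) = 2) (hρ : 1 ≤ ρ) (hρM : ρ ≤ M)
    (hρ2 : Module.finrank ℝ (V ρ) = 2)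
    (h1 : ∀ k, 1 ≤ k → k ≤ M → k ≠ ρ → Module.finrank ℝ (V k) = 1) :
    (∃ q x y, TypeL V M q x y) ∨ (∃ q, M = 2 * q + 1 ∧ ∃ x y, TypeT V q x y) ∨
      (M = 3 ∧ ∃ x y, TypeN V x y) := by
  have hρ1 : ρ ≠ 1 := by
    rintro rfl
    have := hV.finrank_one_le h2
    omega
  have hne : V ρ ≠ ⊥ := by
    intro h
    rw [h] at hρ2
    simp at hρ2
  obtain ⟨x, hx, y, hy, h0⟩ := hV.exists_generators
    (fun h => hne (hV.eq_bot_of_le h hρ)) h2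
  have h0' : V 0 ≤ span ℝ {x, y, 0} := h0.trans (span_mono (by
    intro s; simp only [Set.mem_insert_iff, Set.mem_singleton_iff]; tauto))
  rcases Nat.even_or_odd' ρ with ⟨q, rfl | rfl⟩
  · have hlt : 2 * q < M := by
      obtain ⟨m, rfl⟩ := hM
      omega
    have h1' : ∀ k, 2 * q < k → k ≤ M → Module.finrank ℝ (V k) = 1 :=
      fun k hk hk' => h1 k (by omega) hk' (by omega)
    rcases (show q = 1 ∨ 2 ≤ q by omega) with rfl | hq
    · rcases hV.classify_of_eq_two hM hlt hx hy h0 h1' with h | ⟨h, h'⟩ | h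
      · exact Or.inl ⟨1, h⟩
      · exact Or.inr (Or.inl ⟨1, h, h'⟩)
      · exact Or.inr (Or.inr h)
    · obtain ⟨x', hx', y', hy', h0'', hsp, hcomm⟩ := hV.exists_filiform hx hy (z := 0) (by simp)
        h0' (t := 2 * q - 1) ⟨q - 1, by omega⟩
        (fun k hk hk' => h1 k hk (by omega) (by omega))
        (ne_bot_of_finrank_eq_one (h1 _ (by omega) (by omega) (by omega)))
      have h0'' : V 0 ≤ span ℝ {x', y'} := h0''.trans (span_le.mpr (by
        rintro s (rfl | rfl | rfl)
        · exact subset_span (by simp)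
        · exact subset_span (by simp)
        · exact zero_mem _))
      rcases hV.classify_of_two_le hq hM hlt hx' hy' h0''
        (fun k hk hk' => hsp k hk (by omega)) (fun k hk => hcomm k (by omega)) h1' with h | ⟨h, h'⟩
      · exact Or.inl ⟨q, h⟩
      · exact Or.inr (Or.inl ⟨q, h, h'⟩)
  · exfalso
    obtain ⟨x', hx', y', hy', h0'', hsp, hcomm⟩ := hV.exists_filiform hx hy (z := 0) (by simp)
      h0' (t := 2 * q + 1) ⟨q, rfl⟩ (fun k hk hk' => h1 k hk (by omega) (by omega)) hne
    have := (Submodule.finrank_mono (hsp (2 * q + 1) hρ le_rfl)).trans (finrank_span_le_card _)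
    simp at this
    omega

end Generators

/-! ### Passing between `𝔤` and `gr 𝔤` -/

section Symbols

variable {𝔤 : Type*} [LieRing 𝔤] [LieAlgebra ℝ 𝔤]

open Submodule

/-- The element `x` belongs to `𝔤^k` and its class in `𝔤^k / 𝔤^(k+1)` is `e`. -/
def HasSymbol (k : ℕ) (x : 𝔤) (e : Gr 𝔤) : Prop :=
  ∃ h : x ∈ lcs 𝔤 k, Gr.cls 𝔤 k ⟨x, h⟩ = e

theorem lcs_antitone : Antitone (lcs 𝔤) := antitone_nat_of_succ_le lcs_anti_succ

theorem Gr.mem_of_cls_eq_zero {k : ℕ} {x : ↥(lcs 𝔤 k)} (h : Gr.cls 𝔤 k x = 0) :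
    (x : 𝔤) ∈ lcs 𝔤 (k + 1) := by
  have h1 : Gr.incl 𝔤 k (((lcs 𝔤 (k + 1)).submoduleOf (lcs 𝔤 k)).mkQ x) = Gr.incl 𝔤 k 0 := by
    rw [map_zero]; exact h
  have h2 := DirectSum.of_injective (β := GrPiece 𝔤) k h1
  rw [Submodule.mkQ_apply, Submodule.Quotient.mk_eq_zero] at h2
  exact h2

namespace HasSymbol

theorem mem {k : ℕ} {x : 𝔤} {e : Gr 𝔤} (h : HasSymbol k x e) : x ∈ lcs 𝔤 k := h.1

theorem zero (k : ℕ) : HasSymbol k (0 : 𝔤) 0 := ⟨zero_mem _, map_zero (Gr.cls 𝔤 k)⟩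

theorem mem_succ {k : ℕ} {x : 𝔤} (h : HasSymbol k x 0) : x ∈ lcs 𝔤 (k + 1) := by
  obtain ⟨h, h'⟩ := h
  exact Gr.mem_of_cls_eq_zero h'

theorem of_mem_succ {k : ℕ} {x : 𝔤} (h : x ∈ lcs 𝔤 (k + 1)) : HasSymbol k x 0 :=
  ⟨lcs_anti_succ k h, Gr.cls_eq_zero _ h⟩

theorem add {k : ℕ} {x y : 𝔤} {e f : Gr 𝔤} (hx : HasSymbol k x e) (hy : HasSymbol k y f) :
    HasSymbol k (x + y) (e + f) := by
  obtain ⟨h, rfl⟩ := hx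
  obtain ⟨h', rfl⟩ := hy
  exact ⟨add_mem h h', map_add (Gr.cls 𝔤 k) ⟨x, h⟩ ⟨y, h'⟩⟩

theorem smul {k : ℕ} {x : 𝔤} {e : Gr 𝔤} (c : ℝ) (hx : HasSymbol k x e) :
    HasSymbol k (c • x) (c • e) := by
  obtain ⟨h, rfl⟩ := hx
  exact ⟨smul_mem _ c h, map_smul (Gr.cls 𝔤 k) c ⟨x, h⟩⟩

theorem sub {k : ℕ} {x y : 𝔤} {e f : Gr 𝔤} (hx : HasSymbol k x e) (hy : HasSymbol k y f) :
    HasSymbol k (x - y) (e - f) := by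
  rw [sub_eq_add_neg, sub_eq_add_neg, ← neg_one_smul ℝ y, ← neg_one_smul ℝ f]
  exact hx.add (hy.smul _)

theorem sum {ι : Type*} (s : Finset ι) {k : ℕ} {x : ι → 𝔤} {e : ι → Gr 𝔤}
    (h : ∀ i ∈ s, HasSymbol k (x i) (e i)) : HasSymbol k (∑ i ∈ s, x i) (∑ i ∈ s, e i) := by
  classical
  induction s using Finset.induction_on with
  | empty => simpa using zero k
  | insert a s ha ih =>
    rw [Finset.sum_insert ha, Finset.sum_insert ha]
    exact (h a (by simp)).add (ih fun i hi => h i (by simp [hi]))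

theorem lie {i j : ℕ} {x y : 𝔤} {e f : Gr 𝔤} (hx : HasSymbol i x e) (hy : HasSymbol j y f) :
    HasSymbol (i + j + 1) ⁅x, y⁆ ⁅e, f⁆ := by
  obtain ⟨h, rfl⟩ := hx
  obtain ⟨h', rfl⟩ := hy
  exact ⟨lie_mem_lcs i j h h', (Gr.bracket_cls ⟨x, h⟩ ⟨y, h'⟩).symm⟩

theorem chain {x y : 𝔤} {e f : Gr 𝔤} (hx : HasSymbol 0 x e) (hy : HasSymbol 0 y f) (k : ℕ) :
    HasSymbol k (chain x y k) (chain e f k) := by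
  induction k with
  | zero => exact hy
  | succ k ih => simpa [chain_succ] using hx.lie ih

theorem sub_mem {k : ℕ} {x y : 𝔤} {e : Gr 𝔤} (hx : HasSymbol k x e) (hy : HasSymbol k y e) :
    x - y ∈ lcs 𝔤 (k + 1) := by
  have := hx.sub hy
  rw [sub_self] at this
  exact this.mem_succ

end HasSymbol

variable (𝔤) in
/-- The homogeneous component `𝔤^k / 𝔤^(k+1)` of `gr 𝔤`, as a subspace. -/
def Gr.comp (k : ℕ) : Submodule ℝ (Gr 𝔤) := LinearMap.range (Gr.cls 𝔤 k)

theorem Gr.mem_comp {k : ℕ} {e : Gr 𝔤} : e ∈ Gr.comp 𝔤 k ↔ ∃ x, HasSymbol k x e := by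
  constructor
  · rintro ⟨⟨x, hx⟩, rfl⟩
    exact ⟨x, hx, rfl⟩
  · rintro ⟨x, hx, rfl⟩
    exact ⟨⟨x, hx⟩, rfl⟩

theorem lcs_succ_eq_span (k : ℕ) : lcs 𝔤 (k + 1) =
    span ℝ {m | ∃ u : 𝔤, ∃ v ∈ lcs 𝔤 k, ⁅u, v⁆ = m} := by
  rw [lcs, LieModule.lowerCentralSeries_succ, LieSubmodule.lieIdeal_oper_eq_linear_span']
  congr 1
  ext m
  simp [lcs]

/-- Generation by `V 0` reflects that `𝔤^(k+1)` is spanned by brackets `[u, v]` with `v ∈ 𝔤^k`: the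
class of such a bracket is the product of the classes of `u` and `v`. -/
theorem Gr.natGraded : NatGraded (Gr.comp 𝔤) where
  lie_mem := by
    intro i j x y hx hy
    obtain ⟨u, hu⟩ := Gr.mem_comp.mp hx
    obtain ⟨v, hv⟩ := Gr.mem_comp.mp hy
    exact Gr.mem_comp.mpr ⟨_, hu.lie hv⟩
  gen k := by
    intro e he
    obtain ⟨x, hx⟩ := Gr.mem_comp.mp he
    have key : ∀ x ∈ lcs 𝔤 (k + 1), ∃ e ∈ span ℝ {m | ∃ u ∈ Gr.comp 𝔤 0, ∃ v ∈ Gr.comp 𝔤 k,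
        ⁅u, v⁆ = m}, HasSymbol (k + 1) x e := by
      intro x hx
      rw [lcs_succ_eq_span] at hx
      induction hx using Submodule.span_induction with
      | zero => exact ⟨0, zero_mem _, HasSymbol.zero _⟩
      | add x y _ _ h h' =>
        obtain ⟨e, he, hx⟩ := h
        obtain ⟨f, hf, hy⟩ := h'
        exact ⟨e + f, add_mem he hf, hx.add hy⟩
      | smul c x _ h =>
        obtain ⟨e, he, hx⟩ := h
        exact ⟨c • e, smul_mem _ c he, hx.smul c⟩
      | mem x h =>
        obtain ⟨u, v, hv, rfl⟩ := h
        have hu : HasSymbol 0 u (Gr.cls 𝔤 0 ⟨u, by simp [lcs]⟩) := ⟨by simp [lcs], rfl⟩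
        have hv' : HasSymbol k v (Gr.cls 𝔤 k ⟨v, hv⟩) := ⟨hv, rfl⟩
        refine ⟨_, subset_span ⟨_, Gr.mem_comp.mpr ⟨u, hu⟩, _, Gr.mem_comp.mpr ⟨v, hv'⟩, rfl⟩, ?_⟩
        simpa using hu.lie hv'
    obtain ⟨f, hf, hxf⟩ := key x hx.mem
    obtain ⟨h1, rfl⟩ := hx
    obtain ⟨h2, rfl⟩ := hxf
    exact hf

theorem Gr.finrank_comp_add [Module.Finite ℝ 𝔤] (k : ℕ) :
    Module.finrank ℝ (Gr.comp 𝔤 k) + Module.finrank ℝ (lcs 𝔤 (k + 1)) =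
      Module.finrank ℝ (lcs 𝔤 k) := by
  have h := LinearMap.finrank_range_add_finrank_ker (Gr.cls 𝔤 k)
  have hk : LinearMap.ker (Gr.cls 𝔤 k) = (lcs 𝔤 (k + 1)).submoduleOf (lcs 𝔤 k) := by
    ext x
    rw [LinearMap.mem_ker]
    exact ⟨fun h => Gr.mem_of_cls_eq_zero h, fun h => Gr.cls_eq_zero x h⟩
  rw [hk, (Submodule.submoduleOfEquivOfLe (lcs_anti_succ k)).finrank_eq] at h
  exact h

theorem Gr.comp_eq_bot_iff {k : ℕ} : Gr.comp 𝔤 k = ⊥ ↔ lcs 𝔤 k ≤ lcs 𝔤 (k + 1) := by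
  rw [eq_bot_iff]
  constructor
  · intro h x hx
    have := h (Gr.mem_comp.mpr ⟨x, hx, rfl⟩)
    rw [Submodule.mem_bot] at this
    exact Gr.mem_of_cls_eq_zero this
  · intro h e he
    obtain ⟨x, hx, rfl⟩ := Gr.mem_comp.mp he
    exact Gr.cls_eq_zero _ (h hx)

/-- A family of elements of `𝔤` whose symbols span all the components of `gr 𝔤`. -/
theorem exists_basis_of_symbols [Module.Finite ℝ 𝔤] {N K : ℕ} (hN : Module.finrank ℝ 𝔤 = N)
    (hK : lcs 𝔤 K = ⊥) {X : Fin N → 𝔤} {E : Fin N → Gr 𝔤} {d : Fin N → ℕ}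
    (hX : ∀ i, HasSymbol (d i) (X i) (E i))
    (hsp : ∀ k, Gr.comp 𝔤 k ≤ span ℝ (E '' {i | d i = k})) :
    ∃ b : Module.Basis (Fin N) ℝ 𝔤, (⇑b = X) ∧
      (∀ k, ∀ x ∈ lcs 𝔤 k, ∀ i, d i < k → b.repr x i = 0) ∧
      ∃ e : Module.Basis (Fin N) ℝ (Gr 𝔤), ⇑e = E := by
  have hA : ∀ k, ∀ e ∈ span ℝ (E '' {i | d i = k}), ∃ y ∈ span ℝ (X '' {i | d i = k}),
      HasSymbol k y e := by
    intro k e he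
    induction he using Submodule.span_induction with
    | zero => exact ⟨0, zero_mem _, HasSymbol.zero _⟩
    | add x y _ _ h h' =>
      obtain ⟨e, he, hx⟩ := h
      obtain ⟨f, hf, hy⟩ := h'
      exact ⟨e + f, add_mem he hf, hx.add hy⟩
    | smul c x _ h =>
      obtain ⟨e, he, hx⟩ := h
      exact ⟨c • e, smul_mem _ c he, hx.smul c⟩
    | mem x h =>
      obtain ⟨i, rfl, rfl⟩ := h
      exact ⟨X i, subset_span ⟨i, rfl, rfl⟩, hX i⟩
  -- Descending induction on `k`, with `j` bounding the distance to `K`: subtracting a combination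
  -- with the same class pushes an element of `𝔤^k` into `𝔤^(k+1)`.
  have hB : ∀ j k, K ≤ k + j → lcs 𝔤 k ≤ span ℝ (X '' {i | k ≤ d i}) := by
    intro j
    induction j with
    | zero =>
      intro k hk
      exact ((lcs_antitone (𝔤 := 𝔤) hk).trans hK.le).trans bot_le
    | succ j ih =>
      intro k hk x hx
      obtain ⟨y, hy, hys⟩ := hA k _ (hsp k (Gr.mem_comp.mpr ⟨x, hx, rfl⟩))
      have h1 := ih (k + 1) (by omega) (HasSymbol.sub_mem ⟨hx, rfl⟩ hys)
      rw [← sub_add_cancel x y]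
      refine add_mem (span_mono (Set.image_mono ?_) h1) (span_mono (Set.image_mono ?_) hy)
      · intro i hi; simp at hi ⊢; omega
      · intro i hi; simp at hi ⊢; omega
  have htop : ⊤ ≤ span ℝ (Set.range X) := by
    intro x _
    exact span_mono (Set.image_subset_range _ _) (hB K 0 (by omega) (by simp [lcs] : x ∈ lcs 𝔤 0))
  set b := basisOfTopLeSpanOfCardEqFinrank X htop (by simp [hN]) with hb
  have hbX : ⇑b = X := coe_basisOfTopLeSpanOfCardEqFinrank _ _ _
  have hcoord : ∀ k, ∀ x ∈ lcs 𝔤 k, ∀ i, d i < k → b.repr x i = 0 := by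
    intro k x hx i hi
    have h1 := hB K k (by omega) hx
    rw [← hbX, b.mem_span_image] at h1
    by_contra hne
    have := h1 (Finsupp.mem_support_iff.mpr hne)
    simp at this
    omega
  refine ⟨b, hbX, hcoord, ?_⟩
  have hli : LinearIndependent ℝ E := by
    rw [Fintype.linearIndependent_iff]
    intro c hc i
    set k := d i with hk
    -- The projection to one component makes a linear relation homogeneous. The same combination of
    -- the `X j` then has symbol zero, so it lies in `𝔤^(k+1)`, where coordinates of degree `k`
    -- vanish.
    let π : Gr 𝔤 →ₗ[ℝ] Gr 𝔤 := Gr.lift fun j => if j = k then Gr.incl 𝔤 j else 0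
    have hπ : ∀ j, π (E j) = if d j = k then E j else 0 := by
      intro j
      obtain ⟨h, hE⟩ := hX j
      rw [← hE]
      change Gr.lift _ _ = _
      rw [Gr.lift_cls]
      split_ifs
      · rfl
      · rfl
    have h0 : ∑ j with d j = k, c j • E j = 0 := by
      have := congrArg π hc
      rw [map_zero, map_sum] at this
      simp only [map_smul, hπ, smul_ite, smul_zero] at this
      rw [Finset.sum_filter]
      exact this
    have hs : HasSymbol k (∑ j with d j = k, c j • X j) (∑ j with d j = k, c j • E j) := by
      refine HasSymbol.sum _ fun j hj => ?_
      have hj' : d j = k := by simpa using hj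
      exact (hj' ▸ hX j).smul _
    rw [h0] at hs
    have := hcoord (k + 1) _ hs.mem_succ i (by omega)
    have hsum : ∑ j with d j = k, c j • X j = ∑ j, (if d j = k then c j else 0) • b j := by
      simp only [Finset.sum_filter, ite_smul, zero_smul, hbX]
    rw [hsum, b.repr_sum_self] at this
    simpa [hk] using this
  have hsE : ⊤ ≤ span ℝ (Set.range E) := by
    intro a _
    induction a using Gr.induction with
    | h0 => exact zero_mem _
    | hc k x => exact span_mono (Set.image_subset_range _ _) (hsp k ⟨x, rfl⟩)
    | ha a b h h' => exact add_mem (h trivial) (h' trivial)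
  exact ⟨Module.Basis.mk hli hsE, Module.Basis.coe_mk _ _⟩

end Symbols

/-! ### Isomorphism with a model as existence of a basis -/

section Equiv

variable {H : Type*} [LieRing H] [LieAlgebra ℝ H] {V W : Type*} [AddCommGroup V] [Module ℝ V]
  [AddCommGroup W] [Module ℝ W]

/-- An isomorphism pulls the standard basis back. Conversely the coordinate map of the basis
respects brackets, both sides being bilinear and antisymmetric, so that pairs `i < j` suffice. -/
theorem LieTable.nonempty_equiv_iff {N : ℕ} (T : LieTable N) :
    Nonempty (H ≃ₗ⁅ℝ⁆ T.Alg) ↔ ∃ e : Module.Basis (Fin N) ℝ H, ∀ i j : Fin N, i < j →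
      ⁅e i, e j⁆ = Fintype.linearCombination ℝ e (T.t i j) := by
  constructor
  · rintro ⟨φ⟩
    let ψ : H ≃ₗ[ℝ] (Fin N → ℝ) := φ.toLinearEquiv
    let e := Module.Basis.ofEquivFun ψ
    refine ⟨e, fun i j hij => ?_⟩
    have h1 : ∀ v, Fintype.linearCombination ℝ e v = ψ.symm v := by
      intro v
      rw [Fintype.linearCombination_apply, ← e.equivFun_symm_apply]
      simp [e]
    have hψ : ∀ x y, ψ ⁅x, y⁆ = tableBracket T.t (ψ x) (ψ y) := fun x y => φ.map_lie x y
    have h2 : ∀ i, ψ (e i) = Pi.single i 1 := by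
      intro i
      simp [e]
    rw [h1, LinearEquiv.eq_symm_apply, hψ, h2, h2, tableBracket_single, if_pos hij]
  · rintro ⟨e, he⟩
    let ψ : H ≃ₗ[ℝ] (Fin N → ℝ) := e.equivFun
    have h1 : ∀ v, ψ (Fintype.linearCombination ℝ e v) = v := by
      intro v
      rw [Fintype.linearCombination_apply, ← e.equivFun_symm_apply]
      exact ψ.apply_symm_apply v
    have h2 : ∀ i, ψ (e i) = Pi.single i 1 := by
      intro i
      ext j
      simp [ψ, Pi.single_apply, eq_comm]
    have key : ∀ x y, ψ ⁅x, y⁆ = tableLin T.t (ψ x) (ψ y) := by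
      let A : H →ₗ[ℝ] H →ₗ[ℝ] (Fin N → ℝ) :=
        (LieModule.toEnd ℝ H H : H →ₗ[ℝ] Module.End ℝ H).compr₂ (ψ : H →ₗ[ℝ] (Fin N → ℝ))
      let B : H →ₗ[ℝ] H →ₗ[ℝ] (Fin N → ℝ) :=
        (tableLin T.t).compl₁₂ (ψ : H →ₗ[ℝ] (Fin N → ℝ)) (ψ : H →ₗ[ℝ] (Fin N → ℝ))
      have hAB : A = B := by
        refine e.ext fun i => e.ext fun j => ?_
        change ψ ⁅e i, e j⁆ = tableBracket T.t (ψ (e i)) (ψ (e j))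
        rw [h2, h2, tableBracket_single]
        rcases lt_trichotomy i j with h | rfl | h
        · rw [if_pos h, he i j h, h1]
        · simp
        · rw [if_neg h.asymm, if_pos h, ← lie_skew, map_neg, he j i h, h1]
      intro x y
      exact LinearMap.congr_fun (LinearMap.congr_fun hAB x) y
    exact ⟨{ ψ with map_lie' := fun {x y} => key x y }⟩

theorem linearCombination_stdVec {N : ℕ} (e : Fin N → V) (k : ℕ) :
    Fintype.linearCombination ℝ e (stdVec N k) = natExt e k := by
  unfold stdVec natExt
  split_ifs
  · rw [Fintype.linearCombination_apply_single, one_smul]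
  · rw [map_zero]

theorem map_brackets_LR (f : V →ₗ[ℝ] W) (n : ℕ) (X : ℕ → V) (i j : ℕ) :
    f (brackets_LR n X i j) = brackets_LR n (fun k => f (X k)) i j := by
  unfold brackets_LR
  split_ifs <;> simp

theorem map_brackets_L (f : V →ₗ[ℝ] W) (n r : ℕ) (X : ℕ → V) (i j : ℕ) :
    f (brackets_L n r X i j) = brackets_L n r (fun k => f (X k)) i j := by
  unfold brackets_L
  split_ifs <;> simp

theorem map_brackets_T (f : V →ₗ[ℝ] W) (n : ℕ) (X : ℕ → V) (i j : ℕ) :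
    f (brackets_T n X i j) = brackets_T n (fun k => f (X k)) i j := by
  unfold brackets_T
  split_ifs <;> simp

theorem map_brackets_N (f : V →ₗ[ℝ] W) (X : ℕ → V) (i j : ℕ) :
    f (brackets_N X i j) = brackets_N (fun k => f (X k)) i j := by
  unfold brackets_N
  split_ifs <;> simp

theorem equiv_tableLR_iff (n : ℕ) : Nonempty (H ≃ₗ⁅ℝ⁆ (tableLR n).Alg) ↔
    ∃ e : Module.Basis (Fin (2 * n)) ℝ H, HasBrackets e (brackets_LR n) := by
  rw [LieTable.nonempty_equiv_iff]
  change (∃ e : Module.Basis (Fin (2 * n)) ℝ H, ∀ i j : Fin (2 * n), i < j → ⁅e i, e j⁆ =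
    Fintype.linearCombination ℝ e (brackets_LR n (stdVec (2 * n)) i j)) ↔ _
  simp only [map_brackets_LR, linearCombination_stdVec]
  rfl

theorem equiv_tableL_iff (n r : ℕ) (hr : Odd r) (hrn : r + 3 ≤ 2 * n) :
    Nonempty (H ≃ₗ⁅ℝ⁆ (tableL n r hr hrn).Alg) ↔
      ∃ e : Module.Basis (Fin (2 * n)) ℝ H, HasBrackets e (brackets_L n r) := by
  rw [LieTable.nonempty_equiv_iff]
  change (∃ e : Module.Basis (Fin (2 * n)) ℝ H, ∀ i j : Fin (2 * n), i < j → ⁅e i, e j⁆ =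
    Fintype.linearCombination ℝ e (brackets_L n r (stdVec (2 * n)) i j)) ↔ _
  simp only [map_brackets_L, linearCombination_stdVec]
  rfl

theorem equiv_tableT_iff (n : ℕ) (hn : 3 ≤ n) : Nonempty (H ≃ₗ⁅ℝ⁆ (tableT n hn).Alg) ↔
    ∃ e : Module.Basis (Fin (2 * n)) ℝ H, HasBrackets e (brackets_T n) := by
  rw [LieTable.nonempty_equiv_iff]
  change (∃ e : Module.Basis (Fin (2 * n)) ℝ H, ∀ i j : Fin (2 * n), i < j → ⁅e i, e j⁆ =
    Fintype.linearCombination ℝ e (brackets_T n (stdVec (2 * n)) i j)) ↔ _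
  simp only [map_brackets_T, linearCombination_stdVec]
  rfl

theorem equiv_tableN_iff : Nonempty (H ≃ₗ⁅ℝ⁆ tableN.Alg) ↔
    ∃ e : Module.Basis (Fin 6) ℝ H, HasBrackets e brackets_N := by
  rw [LieTable.nonempty_equiv_iff]
  change (∃ e : Module.Basis (Fin 6) ℝ H, ∀ i j : Fin 6, i < j → ⁅e i, e j⁆ =
    Fintype.linearCombination ℝ e (brackets_N (stdVec 6) i j)) ↔ _
  simp only [map_brackets_N, linearCombination_stdVec]
  rfl

end Equiv

/-! ### The algebras of the list are pairwise non-isomorphic -/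

section NonIso

variable {H : Type*} [LieRing H] [LieAlgebra ℝ H] {N : ℕ}

open Submodule Module

theorem natExt_of_lt {V : Type*} [Zero V] (X : Fin N → V) {k : ℕ} (hk : k < N) :
    natExt X k = X ⟨k, hk⟩ := by
  simp [natExt, hk]

theorem HasBrackets.lie {X : Basis (Fin N) ℝ H} {F : (ℕ → H) → ℕ → ℕ → H} (h : HasBrackets X F)
    {i j : ℕ} (hij : i < j) (hj : j < N) : ⁅natExt X i, natExt X j⁆ = F (natExt X) i j := by
  rw [natExt_of_lt X hj, natExt_of_lt X (hij.trans hj)]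
  exact h ⟨i, _⟩ ⟨j, hj⟩ hij

theorem HasBrackets.lie' {X : Basis (Fin N) ℝ H} {F : (ℕ → H) → ℕ → ℕ → H} (h : HasBrackets X F)
    {i j : ℕ} (hi : i < N) (hj : j < N) : ⁅natExt X i, natExt X j⁆ =
      if i < j then F (natExt X) i j else if j < i then -F (natExt X) j i else 0 := by
  rcases lt_trichotomy i j with hij | rfl | hij
  · rw [if_pos hij, h.lie hij hj]
  · simp
  · rw [if_neg hij.asymm, if_pos hij, ← lie_skew, h.lie hij hi]

theorem repr_natExt {V : Type*} [AddCommGroup V] [Module ℝ V] (X : Basis (Fin N) ℝ V) (k : ℕ) (m : Fin N) :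
    X.repr (natExt X k) m = if k = m then 1 else 0 := by
  unfold natExt
  split_ifs with h1 h2 h2
  · have : m = ⟨k, h1⟩ := by ext; exact h2.symm
    simp [this]
  · rw [X.repr_self, Finsupp.single_apply, if_neg]
    rintro rfl
    exact h2 rfl
  · exact absurd m.2 (by omega)
  · simp

/-- Checking a linear identity on a basis. -/
theorem basis_ext (X : Basis (Fin N) ℝ H) {W : Type*} [AddCommGroup W] [Module ℝ W]
    {f g : H →ₗ[ℝ] W} (h : ∀ k < N, f (natExt X k) = g (natExt X k)) (x : H) : f x = g x := by
  have : f = g := X.ext fun i => by simpa [natExt_of_lt X i.2] using h i i.2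
  rw [this]

theorem lie_eq_zero_of_basis (X : Basis (Fin N) ℝ H) {u : H}
    (h : ∀ k < N, ⁅u, natExt X k⁆ = 0) (w : H) : ⁅u, w⁆ = 0 :=
  basis_ext X (f := (LieAlgebra.ad ℝ H u : H →ₗ[ℝ] H)) (g := 0) (fun k hk => h k hk) w

theorem map_lie_eq_zero_of_basis (X : Basis (Fin N) ℝ H) {W : Type*} [AddCommGroup W]
    [Module ℝ W] {f : H →ₗ[ℝ] W}
    (h : ∀ i j, i < j → j < N → f ⁅natExt X i, natExt X j⁆ = 0) (x y : H) : f ⁅x, y⁆ = 0 := by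
  have hX : ∀ i < N, ∀ y, f ⁅natExt X i, y⁆ = 0 := fun i hi y =>
    basis_ext X (f := f ∘ₗ (LieAlgebra.ad ℝ H (natExt X i) : H →ₗ[ℝ] H)) (g := 0) (fun k hk => by
      change f ⁅natExt X i, natExt X k⁆ = 0
      rcases lt_trichotomy i k with h' | rfl | h'
      · exact h i k h' hk
      · simp
      · rw [← lie_skew, map_neg, h k i h' hi, neg_zero]) y
  rw [← lie_skew, map_neg, neg_eq_zero]
  exact basis_ext X (f := f ∘ₗ (LieAlgebra.ad ℝ H y : H →ₗ[ℝ] H)) (g := 0) (fun k hk => by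
    change f ⁅y, natExt X k⁆ = 0
    rw [← lie_skew, map_neg, hX k hk, neg_zero]) x

/-- The abelianization has dimension at least three. -/
def HasThreeGenerators (H : Type*) [LieRing H] [LieAlgebra ℝ H] : Prop :=
  ∃ f : H →ₗ[ℝ] (Fin 3 → ℝ), (∀ x y : H, f ⁅x, y⁆ = 0) ∧ Function.Surjective f

/-- The vectors `X_0`, `X_1`, `X_(2n-1)` never occur in a bracket, so their coordinates factor
through the abelianization. -/
theorem hasThreeGenerators_LR {n : ℕ} (hn : 2 ≤ n) {X : Basis (Fin (2 * n)) ℝ H}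
    (h : HasBrackets X (brackets_LR n)) : HasThreeGenerators H := by
  let s : Fin 3 → Fin (2 * n) := ![⟨0, by omega⟩, ⟨1, by omega⟩, ⟨2 * n - 1, by omega⟩]
  let f : H →ₗ[ℝ] (Fin 3 → ℝ) := LinearMap.pi fun a => X.coord (s a)
  refine ⟨f, map_lie_eq_zero_of_basis X fun i j hij hj => ?_, fun v => ?_⟩
  · rw [h.lie hij hj]
    ext a
    change X.repr _ (s a) = 0
    unfold brackets_LR
    split_ifs with h1
    · rw [repr_natExt, if_neg]
      fin_cases a <;> simp [s] <;> omega
    · simp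
  · refine ⟨∑ a, v a • X (s a), ?_⟩
    have hs : Function.Injective s := by
      intro a b hab
      have := congrArg Fin.val hab
      fin_cases a <;> fin_cases b <;> simp [s] at this ⊢ <;> omega
    ext b
    change X.repr _ (s b) = v b
    simp [Finsupp.single_apply, hs.eq_iff]

/-- A linear map that kills brackets is determined by its values at `X_0` and `X_1`, so its image is
at most a plane. -/
theorem not_hasThreeGenerators (X : Basis (Fin N) ℝ H)
    (h : ∀ k, 2 ≤ k → k < N → ∃ x y : H, natExt X k = ⁅x, y⁆) : ¬HasThreeGenerators H := by
  rintro ⟨f, hf, hs⟩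
  have hr : LinearMap.range f ≤ span ℝ {f (natExt X 0), f (natExt X 1)} := by
    rw [LinearMap.range_eq_map, ← X.span_eq, map_span, span_le]
    rintro _ ⟨_, ⟨i, rfl⟩, rfl⟩
    rw [show X i = natExt X i by rw [natExt_of_lt X i.2]]
    rcases (show (i : ℕ) = 0 ∨ (i : ℕ) = 1 ∨ 2 ≤ (i : ℕ) by omega) with h0 | h1 | h2
    · rw [h0]; exact subset_span (by simp)
    · rw [h1]; exact subset_span (by simp)
    · obtain ⟨x, y, hxy⟩ := h i h2 i.2
      rw [hxy, hf]
      exact zero_mem _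
  rw [LinearMap.range_eq_top.mpr hs] at hr
  have h1 := Submodule.finrank_mono hr
  have h2 : finrank ℝ (span ℝ {f (natExt X 0), f (natExt X 1)}) ≤ 2 :=
    (finrank_span_le_card _).trans (by rw [Set.toFinset_insert, Set.toFinset_singleton]; exact Finset.card_le_two)
  rw [finrank_top, Module.finrank_fin_fun] at h1
  omega

theorem not_hasThreeGenerators_L {n r : ℕ} (hrn : r + 3 ≤ 2 * n) (hr : 3 ≤ r)
    {X : Basis (Fin (2 * n)) ℝ H} (h : HasBrackets X (brackets_L n r)) :
    ¬HasThreeGenerators H := by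
  refine not_hasThreeGenerators X fun k hk hk' => ?_
  rcases (show k = 2 * n - 1 ∨ k ≤ 2 * n - 2 by omega) with rfl | h1
  · refine ⟨natExt X 1, natExt X (r - 1), ?_⟩
    rw [h.lie (by omega) (by omega), brackets_L, if_neg (by omega), if_pos (by omega)]
    simp
  · refine ⟨natExt X 0, natExt X (k - 1), ?_⟩
    rw [h.lie (by omega) (by omega), brackets_L, if_pos (by omega)]
    congr 1
    omega

theorem not_hasThreeGenerators_T {n : ℕ} (hn : 3 ≤ n)
    {X : Basis (Fin (2 * n)) ℝ H} (h : HasBrackets X (brackets_T n)) :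
    ¬HasThreeGenerators H := by
  refine not_hasThreeGenerators X fun k hk hk' => ?_
  rcases (show k = 2 * n - 1 ∨ k = 2 * n - 2 ∨ k ≤ 2 * n - 3 by omega) with rfl | rfl | h1
  · refine ⟨natExt X 1, natExt X (2 * n - 4), ?_⟩
    rw [h.lie (by omega) (by omega), brackets_T, if_neg (by omega), if_neg (by omega),
      if_pos (by omega)]
    simp
  · refine ⟨natExt X 0, natExt X (2 * n - 1), ?_⟩
    rw [h.lie (by omega) (by omega), brackets_T, if_neg (by omega), if_pos (by omega)]
  · refine ⟨natExt X 0, natExt X (k - 1), ?_⟩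
    rw [h.lie (by omega) (by omega), brackets_T, if_pos (by omega)]
    congr 1
    omega

theorem not_hasThreeGenerators_N {X : Basis (Fin 6) ℝ H} (h : HasBrackets X brackets_N) :
    ¬HasThreeGenerators H := by
  refine not_hasThreeGenerators X fun k hk hk' => ?_
  rcases (show k = 5 ∨ k ≤ 4 by omega) with rfl | h1
  · refine ⟨natExt X 1, natExt X 2, ?_⟩
    rw [h.lie (by omega) (by omega), brackets_N, if_neg (by omega), if_pos (by omega)]
  · refine ⟨natExt X 0, natExt X (k - 1), ?_⟩
    rw [h.lie (by omega) (by omega), brackets_N, if_pos (by omega)]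
    congr 1
    omega

/-- There are two independent central elements in `H^k`. -/
def HasTwoCentral (H : Type*) [LieRing H] [LieAlgebra ℝ H] (k : ℕ) : Prop :=
  ∃ u ∈ lcs H k, ∃ v ∈ lcs H k, (∀ w : H, ⁅u, w⁆ = 0) ∧ (∀ w : H, ⁅v, w⁆ = 0) ∧
    LinearIndependent ℝ ![u, v]

theorem HasTwoCentral.mono {k l : ℕ} (hkl : k ≤ l) (h : HasTwoCentral H l) :
    HasTwoCentral H k := by
  obtain ⟨u, hu, v, hv, h⟩ := h
  exact ⟨u, lcs_antitone hkl hu, v, lcs_antitone hkl hv, h⟩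

theorem not_hasTwoCentral (X : Basis (Fin N) ℝ H) {k p : ℕ}
    (h : ∀ u ∈ lcs H k, (∀ w : H, ⁅w, u⁆ = 0) → ∀ i : Fin N, (i : ℕ) ≠ p → X.repr u i = 0) :
    ¬HasTwoCentral H k := by
  rintro ⟨u, hu, v, hv, hu0, hv0, hli⟩
  have key : ∀ u ∈ lcs H k, (∀ w : H, ⁅u, w⁆ = 0) → ∃ c : ℝ, u = c • natExt X p := by
    intro u hu hu0
    have hc := h u hu fun w => by rw [← lie_skew, hu0, neg_zero]
    by_cases hp : p < N
    · refine ⟨X.repr u ⟨p, hp⟩, X.repr.injective ?_⟩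
      ext i
      rw [map_smul, Finsupp.smul_apply, repr_natExt]
      by_cases hi : (i : ℕ) = p
      · have : i = ⟨p, hp⟩ := Fin.ext hi
        simp [this]
      · rw [hc i hi, if_neg (Ne.symm hi), smul_zero]
    · refine ⟨0, X.repr.injective ?_⟩
      ext i
      rw [hc i (by omega)]
      simp
  obtain ⟨c, rfl⟩ := key u hu hu0
  obtain ⟨d, rfl⟩ := key v hv hv0
  rw [LinearIndependent.pair_iff] at hli
  have h1 := hli d (-c) (by module)
  have h2 := hli 1 0 (by simp [neg_eq_zero.mp h1.2])
  exact one_ne_zero h2.1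

theorem natExt_mem_lcs {F : (ℕ → H) → ℕ → ℕ → H} {X : Basis (Fin N) ℝ H} (h : HasBrackets X F)
    (m : ℕ) (hF : ∀ k, 1 ≤ k → k < m → F (natExt X) 0 k = natExt X (k + 1)) (hm : m < N) :
    ∀ k, k < m → natExt X (k + 1) ∈ lcs H k := by
  intro k
  induction k with
  | zero => intro _; simp [lcs]
  | succ k ih =>
    intro hk
    have h1 := lie_mem_lcs 0 k (by simp [lcs] : natExt X 0 ∈ lcs H 0) (ih (by omega))
    rwa [h.lie (by omega) (by omega), hF (k + 1) (by omega) hk, zero_add] at h1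

/-- The elements are `X_(2n-2)` and `X_(2n-1) = [X_1, X_(r-1)]`. Together with `not_hasTwoCentral_L`
this makes `r` an isomorphism invariant. -/
theorem hasTwoCentral_L {n r : ℕ} (hrn : r + 3 ≤ 2 * n) (hr : 3 ≤ r)
    {X : Basis (Fin (2 * n)) ℝ H} (h : HasBrackets X (brackets_L n r)) :
    HasTwoCentral H (r - 1) := by
  have hm := natExt_mem_lcs h (2 * n - 2) (fun k hk hk' => by
    rw [brackets_L, if_pos (by omega)]) (by omega)
  have h1 : ⁅natExt X 1, natExt X (r - 1)⁆ = natExt X (2 * n - 1) := by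
    rw [h.lie (by omega) (by omega), brackets_L, if_neg (by omega), if_pos (by omega)]
    simp
  refine ⟨natExt X (2 * n - 2), ?_, natExt X (2 * n - 1), ?_, lie_eq_zero_of_basis X fun k hk => ?_,
    lie_eq_zero_of_basis X fun k hk => ?_, ?_⟩
  · have := hm (2 * n - 3) (by omega)
    rw [show 2 * n - 3 + 1 = 2 * n - 2 by omega] at this
    exact lcs_antitone (by omega) this
  · have h2 := lie_mem_lcs 0 (r - 2) (hm 0 (by omega)) (hm (r - 2) (by omega))
    rwa [show r - 2 + 1 = r - 1 by omega, zero_add, h1, show r - 2 + 1 = r - 1 by omega]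
      at h2
  · rw [h.lie' (by omega) hk]
    unfold brackets_L
    split_ifs <;> first | omega | simp
  · rw [h.lie' (by omega) hk]
    unfold brackets_L
    split_ifs <;> first | omega | simp
  · rw [natExt_of_lt X (by omega : 2 * n - 2 < 2 * n), natExt_of_lt X (by omega : 2 * n - 1 < 2 * n)]
    have := X.linearIndependent.comp ![(⟨2 * n - 2, by omega⟩ : Fin (2 * n)), ⟨2 * n - 1, by omega⟩]
      (by
        intro a b hab
        have := congrArg Fin.val hab
        fin_cases a <;> fin_cases b <;> simp at this ⊢ <;> omega)
    convert this using 1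
    ext i
    fin_cases i <;> rfl

/-- `X_(2n-1)` arises only from two indices adding up to `r`. One of them grows along the series, so
this vector is lost from `H^r` on. -/
theorem lcs_L_le {n r : ℕ} (hrn : r + 3 ≤ 2 * n) (hr : 3 ≤ r) {X : Basis (Fin (2 * n)) ℝ H}
    (h : HasBrackets X (brackets_L n r)) (k : ℕ) : lcs H (k + 1) ≤
      span ℝ (X '' {i | k + 2 ≤ (i : ℕ) ∧ ((i : ℕ) = 2 * n - 1 → k + 1 < r)}) := by
  have hmem : ∀ (k m : ℕ), k + 2 ≤ m → m < 2 * n → (m = 2 * n - 1 → k + 1 < r) → natExt X m ∈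
      span ℝ (X '' {i | k + 2 ≤ (i : ℕ) ∧ ((i : ℕ) = 2 * n - 1 → k + 1 < r)}) := by
    intro k m h1 h2 h3
    rw [natExt_of_lt X h2]
    exact subset_span ⟨_, ⟨h1, h3⟩, rfl⟩
  have htop : ∀ u : H, u ∈ span ℝ (Set.range X) := fun u => by rw [X.span_eq]; trivial
  induction k with
  | zero =>
    rw [lcs_succ_eq_span, span_le]
    rintro _ ⟨u, v, -, rfl⟩
    refine lie_mem_of_mem_span ?_ (htop u) (htop v)
    rintro _ ⟨a, rfl⟩ _ ⟨b, rfl⟩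
    rw [← natExt_of_lt X a.2, ← natExt_of_lt X b.2, h.lie' a.2 b.2]
    unfold brackets_L
    split_ifs <;> (try rw [neg_mem_iff]) <;> (try refine smul_mem _ _ ?_) <;>
      first | exact zero_mem _ | exact hmem _ _ (by omega) (by omega) (by omega)
  | succ k ih =>
    rw [lcs_succ_eq_span, span_le]
    rintro _ ⟨u, v, hv, rfl⟩
    refine lie_mem_of_mem_span ?_ (htop u) (ih hv)
    rintro _ ⟨a, rfl⟩ _ ⟨b, ⟨hb, hb'⟩, rfl⟩
    rw [← natExt_of_lt X a.2, ← natExt_of_lt X b.2, h.lie' a.2 b.2]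
    unfold brackets_L
    split_ifs <;> (try rw [neg_mem_iff]) <;> (try refine smul_mem _ _ ?_) <;>
      first | exact zero_mem _ | exact hmem _ _ (by omega) (by omega) (by omega)

/-- If `f ∘ ad a` is a multiple of a coordinate, the coordinate of central elements vanishes. -/
theorem repr_eq_zero_of_central (X : Basis (Fin N) ℝ H) {u a : H} (hu : ⁅a, u⁆ = 0)
    (i j : Fin N) {c : ℝ} (hc : c ≠ 0)
    (h : ∀ k < N, X.repr ⁅a, natExt X k⁆ i = if k = j then c else 0) : X.repr u j = 0 := by
  have h1 := basis_ext X (f := X.coord i ∘ₗ (LieAlgebra.ad ℝ H a : H →ₗ[ℝ] H))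
    (g := c • X.coord j) (fun k hk => by
      change X.repr ⁅a, natExt X k⁆ i = c * X.repr (natExt X k) j
      rw [h k hk, repr_natExt]
      simp) u
  change X.repr ⁅a, u⁆ i = c * X.repr u j at h1
  rw [hu, map_zero, Finsupp.zero_apply, eq_comm, mul_eq_zero] at h1
  exact h1.resolve_left hc

/-- On central elements `ad X_0` annihilates the coordinates `1, ..., 2n-3` and `ad X_1` the
coordinate `0`; the coordinate `2n-1` is zero on `H^r` by `lcs_L_le`. Only `X_(2n-2)` remains. -/
theorem not_hasTwoCentral_L {n r : ℕ} (hrn : r + 3 ≤ 2 * n) (hr : 3 ≤ r)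
    {X : Basis (Fin (2 * n)) ℝ H} (h : HasBrackets X (brackets_L n r)) :
    ¬HasTwoCentral H r := by
  refine not_hasTwoCentral X (p := 2 * n - 2) fun u hu hu0 i hi => ?_
  rcases (show (i : ℕ) = 0 ∨ (i : ℕ) = 2 * n - 1 ∨ (1 ≤ (i : ℕ) ∧ (i : ℕ) ≤ 2 * n - 3) by omega)
    with h0 | h0 | h0
  · refine repr_eq_zero_of_central X (hu0 (natExt X 1)) ⟨2, by omega⟩ i (c := -1) (by norm_num)
      fun k hk => ?_
    rw [h.lie' (by omega) hk]
    unfold brackets_L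
    split_ifs <;> simp [repr_natExt] <;> omega
  · have := lcs_L_le hrn hr h (r - 1) (by rwa [show r - 1 + 1 = r by omega])
    rw [X.mem_span_image] at this
    by_contra hne
    have := (this (Finsupp.mem_support_iff.mpr hne)).2 h0
    omega
  · refine repr_eq_zero_of_central X (hu0 (natExt X 0)) ⟨i + 1, by omega⟩ i (c := 1) (by norm_num)
      fun k hk => ?_
    rw [h.lie' (by omega) hk]
    unfold brackets_L
    split_ifs <;> simp [repr_natExt] <;> omega

/-- Here the whole center is a line: `[X_0, X_(2n-1)] = X_(2n-2)` detects `X_(2n-1)`, and `[X_1,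
X_(2n-3)] = (n-2) X_(2n-2)` detects `X_(2n-3)`. -/
theorem not_hasTwoCentral_T {n : ℕ} (hn : 3 ≤ n) {X : Basis (Fin (2 * n)) ℝ H}
    (h : HasBrackets X (brackets_T n)) : ¬HasTwoCentral H 0 := by
  refine not_hasTwoCentral X (p := 2 * n - 2) fun u hu hu0 i hi => ?_
  rcases (show (i : ℕ) = 0 ∨ (i : ℕ) = 2 * n - 1 ∨ (i : ℕ) = 2 * n - 3 ∨
    (1 ≤ (i : ℕ) ∧ (i : ℕ) ≤ 2 * n - 4) by omega) with h0 | h0 | h0 | h0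
  · refine repr_eq_zero_of_central X (hu0 (natExt X 1)) ⟨2, by omega⟩ i (c := -1) (by norm_num)
      fun k hk => ?_
    rw [h.lie' (by omega) hk]
    unfold brackets_T
    split_ifs <;> simp [repr_natExt] <;> omega
  · refine repr_eq_zero_of_central X (hu0 (natExt X 0)) ⟨2 * n - 2, by omega⟩ i (c := 1)
      (by norm_num) fun k hk => ?_
    rw [h.lie' (by omega) hk]
    unfold brackets_T
    split_ifs <;> simp [repr_natExt] <;> omega
  · have hn2 : (n : ℝ) - 2 ≠ 0 := by
      have : (3 : ℝ) ≤ n := by exact_mod_cast hn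
      intro h0
      linarith
    refine repr_eq_zero_of_central X (hu0 (natExt X 1)) ⟨2 * n - 2, by omega⟩ i (c := (n : ℝ) - 2)
      hn2 fun k hk => ?_
    rw [h.lie' (by omega) hk]
    unfold brackets_T
    split_ifs <;> simp [repr_natExt] <;> first | omega | tauto | ring
  · refine repr_eq_zero_of_central X (hu0 (natExt X 0)) ⟨i + 1, by omega⟩ i (c := 1) (by norm_num)
      fun k hk => ?_
    rw [h.lie' (by omega) hk]
    unfold brackets_T
    split_ifs <;> simp [repr_natExt] <;> omega

theorem not_hasTwoCentral_N {X : Basis (Fin 6) ℝ H} (h : HasBrackets X brackets_N) :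
    ¬HasTwoCentral H 0 := by
  refine not_hasTwoCentral X (p := 4) fun u hu hu0 i hi => ?_
  rcases (show (i : ℕ) = 0 ∨ (i : ℕ) = 5 ∨ (1 ≤ (i : ℕ) ∧ (i : ℕ) ≤ 3) by omega) with
    h0 | h0 | h0
  · refine repr_eq_zero_of_central X (hu0 (natExt X 1)) ⟨2, by omega⟩ i (c := -1) (by norm_num)
      fun k hk => ?_
    rw [h.lie' (by omega) hk]
    unfold brackets_N
    split_ifs <;> simp [repr_natExt] <;> omega
  · refine repr_eq_zero_of_central X (hu0 (natExt X 1)) ⟨4, by omega⟩ i (c := 1) (by norm_num)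
      fun k hk => ?_
    rw [h.lie' (by omega) hk]
    unfold brackets_N
    split_ifs <;> simp [repr_natExt] <;> first | omega | tauto
  · refine repr_eq_zero_of_central X (hu0 (natExt X 0)) ⟨i + 1, by omega⟩ i (c := 1) (by norm_num)
      fun k hk => ?_
    rw [h.lie' (by omega) hk]
    unfold brackets_N
    split_ifs <;> simp [repr_natExt] <;> first | omega | tauto

/-- There is an element `x` with `(ad x)^3 = 0` that does not commute with the derived algebra. -/
def HasIsotropic (H : Type*) [LieRing H] [LieAlgebra ℝ H] : Prop :=
  ∃ x : H, (∀ y : H, ⁅x, ⁅x, ⁅x, y⁆⁆⁆ = 0) ∧ ∃ y z : H, ⁅x, ⁅y, z⁆⁆ ≠ 0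

/-- `X_0` is such an element: `ad X_0` acts by `X_1 ↦ X_2 ↦ X_3 ↦ 0` and `X_5 ↦ X_4 ↦ 0`. Only `n =
3` matters, as `N_{6,3}` has dimension six. -/
theorem hasIsotropic_T {X : Basis (Fin (2 * 3)) ℝ H} (h : HasBrackets X (brackets_T 3)) :
    HasIsotropic H := by
  have e1 : ⁅natExt X 0, natExt X 1⁆ = natExt X 2 := by rw [h.lie] <;> simp [brackets_T]
  have e2 : ⁅natExt X 0, natExt X 2⁆ = natExt X 3 := by rw [h.lie] <;> simp [brackets_T]
  have e3 : ⁅natExt X 0, natExt X 3⁆ = 0 := by rw [h.lie] <;> simp [brackets_T]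
  have e4 : ⁅natExt X 0, natExt X 4⁆ = 0 := by rw [h.lie] <;> simp [brackets_T]
  have e5 : ⁅natExt X 0, natExt X 5⁆ = natExt X 4 := by rw [h.lie] <;> simp [brackets_T]
  refine ⟨natExt X 0, fun y => ?_, natExt X 0, natExt X 1, ?_⟩
  · let A : H →ₗ[ℝ] H := LieAlgebra.ad ℝ H (natExt X 0)
    refine basis_ext X (f := A ∘ₗ A ∘ₗ A) (g := 0) (fun k hk => ?_) y
    change ⁅natExt X 0, ⁅natExt X 0, ⁅natExt X 0, natExt X k⁆⁆⁆ = 0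
    interval_cases k
    · simp
    · rw [e1, e2, e3]
    · rw [e2, e3, lie_zero]
    · rw [e3, lie_zero, lie_zero]
    · rw [e4, lie_zero, lie_zero]
    · rw [e5, e4, lie_zero]
  · rw [e1, e2, natExt_of_lt X (by omega)]
    exact X.ne_zero _

/-- For `x = a X_0 + b X_1 + ...` the `X_4`-coordinates of `(ad x)^3 X_0` and `(ad x)^3 X_1` are `-b
(a² + b²)` and `a (a² + b²)`. Over `ℝ` their vanishing gives `a = b = 0`, so `x` lies in the span of
`X_2, ..., X_5`, which is abelian and contains all brackets. -/
theorem not_hasIsotropic_N {X : Basis (Fin 6) ℝ H} (h : HasBrackets X brackets_N) :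
    ¬HasIsotropic H := by
  rintro ⟨x, hx, y, z, hxyz⟩
  have htop : ∀ u : H, u ∈ span ℝ (Set.range X) := fun u => by rw [X.span_eq]; trivial
  have hmem : ∀ m : ℕ, 2 ≤ m → m < 6 → natExt X m ∈ span ℝ (X '' {i | 2 ≤ (i : ℕ)}) := by
    intro m h1 h2
    rw [natExt_of_lt X h2]
    exact subset_span ⟨_, h1, rfl⟩
  have hD : ∀ u v : H, ⁅u, v⁆ ∈ span ℝ (X '' {i | 2 ≤ (i : ℕ)}) := by
    intro u v
    refine lie_mem_of_mem_span ?_ (htop u) (htop v)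
    rintro _ ⟨a, rfl⟩ _ ⟨b, rfl⟩
    rw [← natExt_of_lt X a.2, ← natExt_of_lt X b.2, h.lie' a.2 b.2]
    unfold brackets_N
    split_ifs <;> (try rw [neg_mem_iff]) <;>
      first | exact zero_mem _ | exact hmem _ (by omega) (by omega)
  have hsum : x = X.repr x 0 • natExt X 0 + X.repr x 1 • natExt X 1 + X.repr x 2 • natExt X 2 +
      X.repr x 3 • natExt X 3 + X.repr x 4 • natExt X 4 + X.repr x 5 • natExt X 5 := by
    conv_lhs => rw [← X.sum_repr x, Fin.sum_univ_six]
    simp [natExt]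
  have key : ∀ k < 2, X.repr ⁅x, ⁅x, ⁅x, natExt X k⁆⁆⁆ 4 = (if k = 0 then -X.repr x 1 else
      X.repr x 0) * (X.repr x 0 * X.repr x 0 + X.repr x 1 * X.repr x 1) := by
    intro k hk
    generalize X.repr x 0 = a, X.repr x 1 = b, X.repr x 2 = c2, X.repr x 3 = c3,
      X.repr x 4 = c4, X.repr x 5 = c5 at *
    interval_cases k <;> rw [hsum] <;>
      simp [h.lie', brackets_N, repr_natExt] <;> ring
  have k0 := key 0 (by norm_num)
  have k1 := key 1 (by norm_num)
  simp only [hx, map_zero, Finsupp.zero_apply, if_true, one_ne_zero, if_false] at k0 k1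
  have ha : X.repr x 0 = 0 := by
    by_contra ha
    have h2 : 0 < X.repr x 0 * X.repr x 0 + X.repr x 1 * X.repr x 1 :=
      add_pos_of_pos_of_nonneg (mul_self_pos.mpr ha) (mul_self_nonneg _)
    exact mul_ne_zero ha h2.ne' k1.symm
  have hb : X.repr x 1 = 0 := by
    by_contra hb
    have h2 : 0 < X.repr x 0 * X.repr x 0 + X.repr x 1 * X.repr x 1 :=
      add_pos_of_nonneg_of_pos (mul_self_nonneg _) (mul_self_pos.mpr hb)
    exact mul_ne_zero (neg_ne_zero.mpr hb) h2.ne' k0.symm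
  have hxm : x ∈ span ℝ (X '' {i | 2 ≤ (i : ℕ)}) := by
    rw [X.mem_span_image]
    intro i hi
    rw [Finset.mem_coe, Finsupp.mem_support_iff] at hi
    change 2 ≤ (i : ℕ)
    by_contra hlt
    rcases (show i = 0 ∨ i = 1 by fin_cases i <;> simp at hlt ⊢) with rfl | rfl
    · exact hi ha
    · exact hi hb
  have hbot : ⁅x, ⁅y, z⁆⁆ ∈ (⊥ : Submodule ℝ H) := by
    refine lie_mem_of_mem_span ?_ hxm (hD y z)
    rintro _ ⟨a, ha, rfl⟩ _ ⟨b, hb, rfl⟩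
    rw [← natExt_of_lt X a.2, ← natExt_of_lt X b.2, h.lie' a.2 b.2]
    simp only [Set.mem_ofPred_eq] at ha hb
    unfold brackets_N
    split_ifs <;> first | omega | simp
  exact hxyz ((Submodule.mem_bot ℝ).mp hbot)

end NonIso

/-! ### Dimensions of the components -/

section Dimensions

/-- The quantity `a k + k` falls by `w k - 1` at step `k`, from `M + 3` down to `M + 1`. The total
drop is two, and at least one unit of it happens at step `0`. -/
theorem exists_jump {a w : ℕ → ℕ} {M : ℕ} (hw : ∀ k, w k + a (k + 1) = a k)
    (ha : a (M + 1) = 0) (h0 : a 0 = M + 3) (h1 : ∀ k, k ≤ M → 1 ≤ w k) (h2 : 2 ≤ w 0) :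
    (w 0 = 3 ∧ ∀ k, 1 ≤ k → k ≤ M → w k = 1) ∨
      (w 0 = 2 ∧ ∃ ρ, 1 ≤ ρ ∧ ρ ≤ M ∧ w ρ = 2 ∧ ∀ k, 1 ≤ k → k ≤ M → k ≠ ρ → w k = 1) := by
  have hlow : ∀ j k, k + j = M + 1 → M + 1 ≤ a k + k := by
    intro j
    induction j with
    | zero => intro k hk; omega
    | succ j ih =>
      intro k hk
      have := ih (k + 1) (by omega)
      have := hw k
      have := h1 k (by omega)
      omega
  have hlow' : ∀ k, k ≤ M + 1 → M + 1 ≤ a k + k := fun k hk => hlow (M + 1 - k) k (by omega)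
  have hup : ∀ k d, k + d ≤ M + 1 → a (k + d) + (k + d) ≤ a k + k := by
    intro k d
    induction d with
    | zero => intro _; exact le_rfl
    | succ d ih =>
      intro hd
      have := ih (by omega)
      have := hw (k + d)
      have := h1 (k + d) (by omega)
      rw [← add_assoc k d 1]
      omega
  have hup' : ∀ k l, k ≤ l → l ≤ M + 1 → a l + l ≤ a k + k := by
    intro k l hkl hl
    obtain ⟨d, rfl⟩ := Nat.exists_eq_add_of_le hkl
    exact hup k d hl
  have hw0 := hw 0
  have hl1 := hlow' 1 (by omega)
  rcases (show w 0 = 3 ∨ w 0 = 2 by simp at hw0; omega) with h3 | h3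
  · refine Or.inl ⟨h3, fun k hk hk' => ?_⟩
    have e1 := hlow' k (by omega)
    have e2 := hlow' (k + 1) (by omega)
    have e3 := hup' 1 k hk (by omega)
    have e4 := hup' 1 (k + 1) (by omega) (by omega)
    have e5 := hw k
    simp at hw0
    omega
  · refine Or.inr ⟨h3, ?_⟩
    -- The jump takes place just before the final level is reached for the first time, so `ρ = f -
    -- 1`.
    have hex : ∃ k, 1 ≤ k ∧ a k + k = M + 1 := ⟨M + 1, by omega, by omega⟩
    classical
    obtain ⟨hf1, hf2⟩ := Nat.find_spec hex
    have hmin := fun k => Nat.find_min hex (m := k)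
    have hfM : Nat.find hex ≤ M + 1 := Nat.find_min' hex ⟨by omega, by omega⟩
    set f := Nat.find hex
    simp only [zero_add] at hw0
    have hf3 : f ≠ 1 := by
      intro hf
      rw [hf] at hf2
      omega
    have hlt : ∀ k, 1 ≤ k → k < f → a k + k = M + 2 := by
      intro k hk hkf
      have e1 := hmin k hkf
      have e2 := hlow' k (by omega)
      have e3 := hup' 1 k hk (by omega)
      have : a k + k ≠ M + 1 := fun h => e1 ⟨hk, h⟩
      omega
    have hge : ∀ k, f ≤ k → k ≤ M + 1 → a k + k = M + 1 := by
      intro k hk hkM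
      have e2 := hlow' k (by omega)
      have e3 := hup' f k hk (by omega)
      omega
    refine ⟨f - 1, by omega, by omega, ?_, fun k hk hkM hne => ?_⟩
    · have e1 := hlt (f - 1) (by omega) (by omega)
      have e2 := hw (f - 1)
      rw [show f - 1 + 1 = f by omega] at e2
      omega
    · have e := hw k
      rcases (show k + 1 < f ∨ f ≤ k by omega) with h | h
      · have e1 := hlt k hk (by omega)
        have e2 := hlt (k + 1) (by omega) h
        omega
      · have e1 := hge k h (by omega)
        have e2 := hge (k + 1) (by omega) (by omega)
        omega

variable {𝔤 : Type*} [LieRing 𝔤] [LieAlgebra ℝ 𝔤]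

/-- A zero component of index at most `2n - 3` would make `V (2n-3)` zero, hence `𝔤^(2n-3) = 0`,
against the nilindex. The rest is the count in `exists_jump`. -/
theorem IsQuasiFiliform.dims {n : ℕ} (hdim : Module.finrank ℝ 𝔤 = 2 * n)
    (hq : IsQuasiFiliform 𝔤) : 2 ≤ n ∧ lcs 𝔤 (2 * n - 2) = ⊥ ∧
      ((Module.finrank ℝ (Gr.comp 𝔤 0) = 3 ∧
          ∀ k, 1 ≤ k → k ≤ 2 * n - 3 → Module.finrank ℝ (Gr.comp 𝔤 k) = 1) ∨
        (Module.finrank ℝ (Gr.comp 𝔤 0) = 2 ∧ ∃ ρ, 1 ≤ ρ ∧ ρ ≤ 2 * n - 3 ∧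
          Module.finrank ℝ (Gr.comp 𝔤 ρ) = 2 ∧
          ∀ k, 1 ≤ k → k ≤ 2 * n - 3 → k ≠ ρ → Module.finrank ℝ (Gr.comp 𝔤 k) = 1)) := by
  obtain ⟨hnil, hlen⟩ := hq
  rw [hdim] at hlen
  have hn : 2 ≤ n := by
    by_contra hlt
    have h0 : LieModule.nilpotencyLength 𝔤 𝔤 = 0 := by omega
    rw [LieModule.nilpotencyLength_eq_zero_iff] at h0
    have := Module.finrank_zero_of_subsingleton (R := ℝ) (M := 𝔤)
    omega
  have hfin : Module.Finite ℝ 𝔤 := Module.finite_of_finrank_pos (by omega)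
  obtain ⟨M, hM⟩ : ∃ M, 2 * n = M + 3 := ⟨2 * n - 3, by omega⟩
  rw [show 2 * n - 3 = M by omega, show 2 * n - 2 = M + 1 by omega]
  obtain ⟨hb, hb'⟩ := (LieModule.nilpotencyLength_eq_succ_iff ℝ 𝔤 𝔤 M).mp (by omega)
  have hbot : lcs 𝔤 (M + 1) = ⊥ := by rw [lcs, hb]; rfl
  have hnb : lcs 𝔤 M ≠ ⊥ := by
    intro h
    apply hb'
    rw [lcs] at h
    simpa using h
  have hcomp : ∀ k, k ≤ M → Gr.comp 𝔤 k ≠ ⊥ := by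
    intro k hk h
    have := Gr.comp_eq_bot_iff.mp (Gr.natGraded.eq_bot_of_le h hk)
    rw [hbot] at this
    exact hnb (eq_bot_iff.mpr this)
  have hfc : ∀ k, Module.Finite ℝ (Gr.comp 𝔤 k) := fun k => by
    unfold Gr.comp
    infer_instance
  refine ⟨hn, hbot, exists_jump (a := fun k => Module.finrank ℝ (lcs 𝔤 k))
    (w := fun k => Module.finrank ℝ (Gr.comp 𝔤 k)) (M := M) (fun k => Gr.finrank_comp_add k) ?_ ?_
    ?_ ?_⟩
  · rw [hbot, finrank_bot]
  · have : lcs 𝔤 0 = ⊤ := by simp [lcs]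
    change Module.finrank ℝ (lcs 𝔤 0) = M + 3
    rw [this, finrank_top, hdim, hM]
  · intro k hk
    have := hcomp k hk
    exact Nat.one_le_iff_ne_zero.mpr fun h => this (Submodule.finrank_eq_zero.mp h)
  · exact Gr.natGraded.two_le_finrank (hcomp 1 (by omega))

end Dimensions

/-! ### Indexed families and expansions with restricted support -/

section Families

variable {V : Type*}

/-- The family `x, c 0, c 1, ..., c (2n-3), z`. -/
def fam (n : ℕ) (x : V) (c : ℕ → V) (z : V) (i : ℕ) : V :=
  if i = 0 then x else if i = 2 * n - 1 then z else c (i - 1)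

theorem fam_zero (n : ℕ) (x : V) (c : ℕ → V) (z : V) : fam n x c z 0 = x := rfl

theorem fam_last {n : ℕ} (hn : 1 ≤ n) (x : V) (c : ℕ → V) (z : V) :
    fam n x c z (2 * n - 1) = z := by
  rw [fam, if_neg (by omega), if_pos rfl]

theorem fam_succ {n k : ℕ} (hk : k + 1 ≠ 2 * n - 1) (x : V) (c : ℕ → V) (z : V) :
    fam n x c z (k + 1) = c k := by
  rw [fam, if_neg (by omega), if_neg hk, Nat.add_sub_cancel]

theorem natExt_coe [Zero V] {N : ℕ} (f : ℕ → V) {k : ℕ} (hk : k < N) :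
    natExt (fun i : Fin N => f i) k = f k := by
  simp [natExt, hk]

theorem hasBrackets_of {H : Type*} [LieRing H] [LieAlgebra ℝ H] {N : ℕ} {X : Module.Basis (Fin N) ℝ H}
    {f : ℕ → H} {F : (ℕ → H) → ℕ → ℕ → H} (hX : ⇑X = fun i : Fin N => f i)
    (h : ∀ i j, i < j → j < N → ⁅f i, f j⁆ = F (natExt fun i : Fin N => f i) i j) :
    HasBrackets X F := by
  intro i j hij
  rw [hX]
  exact h i j hij j.2

/-- The expansion of a vector with given support. -/
theorem eq_add_sum_Icc {H : Type*} [AddCommGroup H] [Module ℝ H] {N : ℕ}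
    (X : Module.Basis (Fin N) ℝ H) (v : H) (s : ℝ) {p lo hi : ℕ} (hp : hi < p)
    (h : ∀ m : Fin N, ¬(lo ≤ (m : ℕ) ∧ (m : ℕ) ≤ hi) → X.repr (v - s • natExt X p) m = 0) :
    v = s • natExt X p + ∑ k ∈ Finset.Icc lo hi, natExt (X.repr v) k • natExt X k := by
  rw [← sub_eq_iff_eq_add']
  apply X.repr.injective
  ext m
  rw [map_sum, Finsupp.finsetSum_apply]
  simp only [map_smul, Finsupp.smul_apply, repr_natExt, smul_eq_mul, mul_ite, mul_one, mul_zero,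
    Finset.sum_ite_eq', Finset.mem_Icc]
  split_ifs with hm
  · rw [map_sub, Finsupp.sub_apply, map_smul, Finsupp.smul_apply, repr_natExt, if_neg (by omega), smul_zero,
      sub_zero, natExt_of_lt _ m.2]
  · exact h m hm

theorem eq_sum_Icc {H : Type*} [AddCommGroup H] [Module ℝ H] {N : ℕ}
    (X : Module.Basis (Fin N) ℝ H) (v : H) {lo hi : ℕ}
    (h : ∀ m : Fin N, ¬(lo ≤ (m : ℕ) ∧ (m : ℕ) ≤ hi) → X.repr v m = 0) :
    v = ∑ k ∈ Finset.Icc lo hi, natExt (X.repr v) k • natExt X k := by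
  have := eq_add_sum_Icc X v 0 (lo := lo) (hi := hi) (p := hi + 1) (by omega)
    (by simpa using h)
  rwa [zero_smul, zero_add] at this

end Families

/-! ### Adapted basis for `L_{2n-1} ⊕ ℝ` -/

section Adapted

variable {𝔤 : Type*} [LieRing 𝔤] [LieAlgebra ℝ 𝔤]

open Submodule

theorem HasSymbol.mem_of_eq_zero {k : ℕ} {x : 𝔤} {e : Gr 𝔤} (h : HasSymbol k x e) (he : e = 0) :
    x ∈ lcs 𝔤 (k + 1) :=
  (he ▸ h).mem_succ

theorem lcs_eq_bot_of_le {k l : ℕ} (h : lcs 𝔤 k = ⊥) (hkl : k ≤ l) : lcs 𝔤 l = ⊥ :=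
  eq_bot_iff.mpr ((lcs_antitone hkl).trans h.le)

theorem eq_zero_of_mem_lcs {k l : ℕ} (h : lcs 𝔤 k = ⊥) (hkl : k ≤ l) {v : 𝔤}
    (hv : v ∈ lcs 𝔤 l) : v = 0 := by
  have := lcs_antitone hkl hv
  rwa [h, mem_bot] at this

theorem Gr.eq_zero_of_mem_comp {k l : ℕ} (h : lcs 𝔤 k = ⊥) (hkl : k ≤ l) {e : Gr 𝔤}
    (he : e ∈ Gr.comp 𝔤 l) : e = 0 := by
  have : Gr.comp 𝔤 l = ⊥ := by
    rw [Gr.comp_eq_bot_iff, lcs_eq_bot_of_le h hkl]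
    exact bot_le
  rwa [this, mem_bot] at he

theorem comp_le_of_forall_mem {N : ℕ} {k : ℕ} {S : Set (Gr 𝔤)} {E : Fin N → Gr 𝔤} {d : Fin N → ℕ}
    (h : Gr.comp 𝔤 k ≤ span ℝ S) (hS : ∀ s ∈ S, ∃ i, d i = k ∧ E i = s) :
    Gr.comp 𝔤 k ≤ span ℝ (E '' {i | d i = k}) :=
  h.trans (span_mono fun s hs => hS s hs)

/-- Elements of `𝔤^(k+1)` are brackets with a given element if this is so in `gr 𝔤`. -/
theorem exists_lie_eq_of_mem_lcs {K : ℕ} (hK : lcs 𝔤 K = ⊥) {x y : 𝔤} {e f : Gr 𝔤}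
    (hx : HasSymbol 0 x e) (hy : HasSymbol 0 y f) {l : ℕ}
    (hsp : ∀ k, l < k → k < K → Gr.comp 𝔤 k ≤ span ℝ {chain e f k}) (j : ℕ) :
    ∀ k, K ≤ k + j → l ≤ k → ∀ v ∈ lcs 𝔤 (k + 1), ∃ u ∈ lcs 𝔤 k, ⁅x, u⁆ = v := by
  induction j with
  | zero =>
    intro k hk _ v hv
    exact ⟨0, zero_mem _, by rw [lie_zero, eq_zero_of_mem_lcs hK (by omega) hv]⟩
  | succ j ih =>
    intro k hk hl v hv
    by_cases hkK : K ≤ k + 1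
    · exact ⟨0, zero_mem _, by rw [lie_zero, eq_zero_of_mem_lcs hK hkK hv]⟩
    have hm : Gr.cls 𝔤 (k + 1) ⟨v, hv⟩ ∈ Gr.comp 𝔤 (k + 1) := ⟨_, rfl⟩
    obtain ⟨a, ha⟩ := mem_span_singleton.mp (hsp (k + 1) (by omega) (by omega) hm)
    -- The leading part of `v` is a multiple of `c (k+1) = [x, c k]`; the remainder is one step
    -- deeper.
    have h1 : v - a • chain x y (k + 1) ∈ lcs 𝔤 (k + 1 + 1) :=
      HasSymbol.sub_mem ⟨hv, ha.symm⟩ ((hx.chain hy (k + 1)).smul a)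
    obtain ⟨u, hu, hu'⟩ := ih (k + 1) (by omega) (by omega) _ h1
    refine ⟨u + a • chain x y k, add_mem (lcs_anti_succ k hu)
      (smul_mem _ _ (hx.chain hy k).mem), ?_⟩
    rw [lie_add, hu', lie_smul, ← chain_succ, sub_add_cancel]

/-- The ranges of summation express depth: a bracket that vanishes in `gr 𝔤` lies one step further
down the series, where low coordinates are zero. Only `[X_0, X_(2n-1)] = 0` has to be arranged by
hand. -/
theorem TypeLR.exists_adapted [Module.Finite ℝ 𝔤] {n : ℕ} (hn : 2 ≤ n)
    (hdim : Module.finrank ℝ 𝔤 = 2 * n) (hbot : lcs 𝔤 (2 * n - 2) = ⊥) {x y z : Gr 𝔤}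
    (h : TypeLR (Gr.comp 𝔤) (2 * n - 3) x y z) :
    (∃ e : Module.Basis (Fin (2 * n)) ℝ (Gr 𝔤), HasBrackets e (brackets_LR n)) ∧
      ∃ X : Module.Basis (Fin (2 * n)) ℝ 𝔤, ∃ C, HasBrackets X (adapted_LR n C) := by
  obtain ⟨x', hx⟩ := Gr.mem_comp.mp h.mem_x
  obtain ⟨y', hy⟩ := Gr.mem_comp.mp h.mem_y
  obtain ⟨z₀, hz₀⟩ := Gr.mem_comp.mp h.mem_z
  have hxz : ⁅x, z⁆ = 0 := by rw [← lie_skew, h.central 0 x h.mem_x, neg_zero]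
  have hcz : ∀ k, ⁅chain x y k, z⁆ = 0 := fun k => by
    rw [← lie_skew, h.central k _ (Gr.natGraded.chain_mem h.mem_x h.mem_y k), neg_zero]
  -- `[x', z₀]` lies in `𝔤^2`, which is the image of `𝔤^1` under `ad x'`. Correcting `z₀` by an
  -- element of `𝔤^1` does not change its class.
  obtain ⟨z', hz, hxz'⟩ : ∃ z', HasSymbol 0 z' z ∧ ⁅x', z'⁆ = 0 := by
    obtain ⟨u, hu, hu'⟩ := exists_lie_eq_of_mem_lcs hbot hx hy (l := 1)
      (fun k hk hk' => h.span_chain k hk.le (by omega)) (2 * n) 1 (by omega) le_rfl ⁅x', z₀⁆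
      ((hx.lie hz₀).mem_of_eq_zero hxz)
    refine ⟨z₀ - u, ?_, by rw [lie_sub, hu', sub_self]⟩
    have := hz₀.sub (HasSymbol.of_mem_succ (k := 0) hu)
    rwa [sub_zero] at this
  have hc := hx.chain hy
  -- `d i` is the index of the component containing the class of `X_i`: `i - 1` along the chain, `0`
  -- for `X_0` and `X_(2n-1)`.
  set d : ℕ → ℕ := fam n 0 id 0 with hd
  have hX : ∀ i : Fin (2 * n), HasSymbol (d i) (fam n x' (chain x' y') z' i)
      (fam n x (chain x y) z i) := by
    intro i
    simp only [hd, fam]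
    split_ifs
    exacts [hx, hz, hc _]
  have hsp : ∀ k, Gr.comp 𝔤 k ≤ span ℝ ((fun i : Fin (2 * n) => fam n x (chain x y) z i) ''
      {i : Fin (2 * n) | d i = k}) := by
    intro k
    rcases (show k = 0 ∨ (1 ≤ k ∧ k ≤ 2 * n - 3) ∨ 2 * n - 2 ≤ k by omega) with rfl | hk | hk
    · refine comp_le_of_forall_mem h.span_zero ?_
      rintro s (rfl | rfl | rfl)
      · exact ⟨⟨0, by omega⟩, rfl, rfl⟩
      · exact ⟨⟨0 + 1, by omega⟩, fam_succ (by omega) _ _ _, fam_succ (by omega) _ _ _⟩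
      · exact ⟨⟨2 * n - 1, by omega⟩, fam_last (by omega) _ _ _, fam_last (by omega) _ _ _⟩
    · refine comp_le_of_forall_mem (h.span_chain k hk.1 hk.2) ?_
      rintro s rfl
      exact ⟨⟨k + 1, by omega⟩, fam_succ (by omega) _ _ _, fam_succ (by omega) _ _ _⟩
    · intro e he
      rw [Gr.eq_zero_of_mem_comp hbot hk he]
      exact zero_mem _
  obtain ⟨X, hXc, hcoord, e, he⟩ := exists_basis_of_symbols hdim hbot hX hsp
  have hzero : ∀ i j, 1 ≤ i → i < j → j ≤ 2 * n - 2 → ⁅chain x y (i - 1), chain x y (j - 1)⁆ = 0 := by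
    intro i j hi hij hj
    rcases (show i + j ≤ 2 * n - 2 ∨ 2 * n - 2 < i + j by omega) with hl | hl
    · exact h.comm (i + j - 1) (by omega) _ _ (by omega)
    · exact Gr.eq_zero_of_mem_comp hbot (show 2 * n - 2 ≤ i - 1 + (j - 1) + 1 by omega)
        (Gr.natGraded.lie_mem (Gr.natGraded.chain_mem h.mem_x h.mem_y _)
          (Gr.natGraded.chain_mem h.mem_x h.mem_y _))
  refine ⟨⟨e, hasBrackets_of he fun i j hij hj => ?_⟩, X, fun i j k => natExt (X.repr
    ⁅natExt X i, natExt X j⁆) k, hasBrackets_of hXc fun i j hij hj => ?_⟩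
  · rcases Nat.eq_zero_or_pos i with rfl | hi
    · obtain ⟨j, rfl⟩ : ∃ k, j = k + 1 := ⟨j - 1, by omega⟩
      rw [fam_zero]
      rcases (show j + 1 = 2 * n - 1 ∨ j + 1 = 2 * n - 2 ∨ j + 1 ≤ 2 * n - 3 by omega) with
        h1 | h1 | h1
      · rw [h1, fam_last (by omega), hxz, brackets_LR, if_neg (by omega)]
      · rw [fam_succ (by omega), ← chain_succ, brackets_LR, if_neg (by omega)]
        exact Gr.eq_zero_of_mem_comp hbot (by omega)
          (Gr.natGraded.chain_mem h.mem_x h.mem_y (j + 1))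
      · rw [fam_succ (by omega), ← chain_succ, brackets_LR, if_pos (by omega),
          natExt_coe _ (by omega), fam_succ (by omega)]
    · rw [brackets_LR, if_neg (by omega), fam, if_neg (by omega), if_neg (by omega)]
      rcases (show j = 2 * n - 1 ∨ j ≤ 2 * n - 2 by omega) with rfl | h1
      · rw [fam_last (by omega), hcz]
      · rw [fam, if_neg (by omega), if_neg (by omega), hzero i j hi hij h1]
  · rcases Nat.eq_zero_or_pos i with rfl | hi
    · obtain ⟨j, rfl⟩ : ∃ k, j = k + 1 := ⟨j - 1, by omega⟩
      rw [fam_zero]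
      rcases (show j + 1 = 2 * n - 1 ∨ j + 1 = 2 * n - 2 ∨ j + 1 ≤ 2 * n - 3 by omega) with
        h1 | h1 | h1
      · rw [h1, fam_last (by omega), hxz', adapted_LR, if_neg (by omega), if_neg (by omega),
          if_neg (by omega)]
      · rw [fam_succ (by omega), ← chain_succ, adapted_LR, if_neg (by omega), if_neg (by omega),
          if_neg (by omega)]
        exact eq_zero_of_mem_lcs hbot (by omega) (hc (j + 1)).mem
      · rw [fam_succ (by omega), ← chain_succ, adapted_LR, if_pos (by omega),
          natExt_coe _ (by omega), fam_succ (by omega)]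
    · set v := ⁅fam n x' (chain x' y') z' i, fam n x' (chain x' y') z' j⁆ with hv
      have hvX : ⁅natExt X i, natExt X j⁆ = v := by
        rw [hXc, natExt_coe _ (by omega), natExt_coe _ hj]
      rw [adapted_LR, if_neg (by omega), hvX, ← hXc]
      rcases (show j = 2 * n - 1 ∨ j ≤ 2 * n - 2 by omega) with rfl | h1
      · have hvm : v ∈ lcs 𝔤 (i + 1) := by
          have := ((hc (i - 1)).lie hz).mem_of_eq_zero (hcz _)
          rw [hv, fam, if_neg (by omega), if_neg (by omega), fam_last (by omega)]
          rwa [show i - 1 + 0 + 1 + 1 = i + 1 by omega] at this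
        rw [if_neg (by omega)]
        split_ifs with h2
        · refine eq_sum_Icc X v fun m hm => hcoord _ v hvm m ?_
          simp only [hd, fam, id]
          split_ifs <;> omega
        · exact eq_zero_of_mem_lcs hbot (by omega) hvm
      · have hvm : v ∈ lcs 𝔤 (i + j) := by
          have := ((hc (i - 1)).lie (hc (j - 1))).mem_of_eq_zero (hzero i j hi hij h1)
          rw [hv, fam, if_neg (by omega), if_neg (by omega), fam, if_neg (by omega),
            if_neg (by omega)]
          rwa [show i - 1 + (j - 1) + 1 + 1 = i + j by omega] at this
        split_ifs with h2 h3
        · refine eq_sum_Icc X v fun m hm => hcoord _ v hvm m ?_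
          simp only [hd, fam, id]
          split_ifs <;> omega
        · omega
        · exact eq_zero_of_mem_lcs hbot (by omega) hvm

end Adapted

/-! ### Adapted bases for types L, T and N -/

section Adapted

variable {𝔤 : Type*} [LieRing 𝔤] [LieAlgebra ℝ 𝔤]

open Submodule

/-- Taking `X_(2n-1) = [y', c' (2q-1)]` makes `[X_1, X_(r-1)] = X_(2n-1)` exact. This vector has
component index `2q = r - 1`, so it can occur as an error term only in brackets with `i + j ≤ r -
1`. -/
theorem TypeL.exists_adapted [Module.Finite ℝ 𝔤] {n q : ℕ}
    (hdim : Module.finrank ℝ 𝔤 = 2 * n) (hbot : lcs 𝔤 (2 * n - 2) = ⊥) {x y : Gr 𝔤}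
    (h : TypeL (Gr.comp 𝔤) (2 * n - 3) q x y) :
    (∃ e : Module.Basis (Fin (2 * n)) ℝ (Gr 𝔤), HasBrackets e (brackets_L n (2 * q + 1))) ∧
      ∃ X : Module.Basis (Fin (2 * n)) ℝ 𝔤, ∃ C, HasBrackets X (adapted_L n (2 * q + 1) C) := by
  obtain ⟨x', hx⟩ := Gr.mem_comp.mp h.mem_x
  obtain ⟨y', hy⟩ := Gr.mem_comp.mp h.mem_y
  have hq := h.one_le
  have hqn := h.lt
  have hc := hx.chain hy
  obtain ⟨Y, hY⟩ : ∃ Y, Y = ⁅y, chain x y (2 * q - 1)⁆ := ⟨_, rfl⟩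
  obtain ⟨Y', hY'⟩ : ∃ Y', Y' = ⁅y', chain x' y' (2 * q - 1)⁆ := ⟨_, rfl⟩
  have hz : HasSymbol (2 * q) Y' Y := by
    have := hy.lie (hc (2 * q - 1))
    rwa [show 0 + (2 * q - 1) + 1 = 2 * q by omega, ← hY, ← hY'] at this
  have hxY : ⁅x, Y⁆ = 0 := hY ▸ h.lie_x
  have hyY : ⁅y, Y⁆ = 0 := hY ▸ h.lie_y
  have hcY : ∀ k, ⁅chain x y k, Y⁆ = 0 := fun k => by
    rw [← lie_skew, lie_chain_eq_zero hxY hyY, neg_zero]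
  set d : ℕ → ℕ := fam n 0 id (2 * q) with hd
  have hX : ∀ i : Fin (2 * n), HasSymbol (d i) (fam n x' (chain x' y') Y' i)
      (fam n x (chain x y) Y i) := by
    intro i
    simp only [hd, fam]
    split_ifs
    exacts [hx, hz, hc _]
  have hsp : ∀ k, Gr.comp 𝔤 k ≤ span ℝ ((fun i : Fin (2 * n) => fam n x (chain x y) Y i) ''
      {i : Fin (2 * n) | d i = k}) := by
    intro k
    rcases (show k = 0 ∨ k = 2 * q ∨ (1 ≤ k ∧ k ≤ 2 * n - 3 ∧ k ≠ 2 * q) ∨ 2 * n - 2 ≤ k by omega)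
      with rfl | rfl | hk | hk
    · refine comp_le_of_forall_mem h.span_zero ?_
      rintro s (rfl | rfl)
      · exact ⟨⟨0, by omega⟩, rfl, rfl⟩
      · exact ⟨⟨0 + 1, by omega⟩, fam_succ (by omega) _ _ _, fam_succ (by omega) _ _ _⟩
    · refine comp_le_of_forall_mem h.span_mid ?_
      rw [← hY]
      rintro s (rfl | rfl)
      · exact ⟨⟨2 * q + 1, by omega⟩, fam_succ (by omega) _ _ _, fam_succ (by omega) _ _ _⟩
      · exact ⟨⟨2 * n - 1, by omega⟩, fam_last (by omega) _ _ _, fam_last (by omega) _ _ _⟩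
    · refine comp_le_of_forall_mem (h.span_chain k hk.1 hk.2.1 hk.2.2) ?_
      rintro s rfl
      exact ⟨⟨k + 1, by omega⟩, fam_succ (by omega) _ _ _, fam_succ (by omega) _ _ _⟩
    · intro e he
      rw [Gr.eq_zero_of_mem_comp hbot hk he]
      exact zero_mem _
  obtain ⟨X, hXc, hcoord, e, he⟩ := exists_basis_of_symbols hdim hbot hX hsp
  have hmid : ∀ i j, 1 ≤ i → 1 ≤ j → i + j = 2 * q + 1 →
      ⁅chain x y (i - 1), chain x y (j - 1)⁆ = (-1 : ℝ) ^ (i - 1) • Y := by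
    intro i j hi hj hij
    rw [hY]
    exact (h.comm (2 * q - 1) (by omega) (by omega)).lie_eq (by omega) (by omega)
  have hzero : ∀ i j, 1 ≤ i → i < j → j ≤ 2 * n - 2 → i + j ≠ 2 * q + 1 →
      ⁅chain x y (i - 1), chain x y (j - 1)⁆ = 0 := by
    intro i j hi hij hj hne
    rcases (show i + j ≤ 2 * n - 2 ∨ 2 * n - 2 < i + j by omega) with hl | hl
    · exact h.comm (i + j - 1) (by omega) (by omega) _ _ (by omega)
    · exact Gr.eq_zero_of_mem_comp hbot (show 2 * n - 2 ≤ i - 1 + (j - 1) + 1 by omega)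
        (Gr.natGraded.lie_mem (Gr.natGraded.chain_mem h.mem_x h.mem_y _)
          (Gr.natGraded.chain_mem h.mem_x h.mem_y _))
  refine ⟨⟨e, hasBrackets_of he fun i j hij hj => ?_⟩, X, fun i j k => natExt (X.repr
    ⁅natExt X i, natExt X j⁆) k, hasBrackets_of hXc fun i j hij hj => ?_⟩
  · rcases Nat.eq_zero_or_pos i with rfl | hi
    · obtain ⟨j, rfl⟩ : ∃ k, j = k + 1 := ⟨j - 1, by omega⟩
      rw [fam_zero]
      rcases (show j + 1 = 2 * n - 1 ∨ j + 1 = 2 * n - 2 ∨ j + 1 ≤ 2 * n - 3 by omega) with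
        h1 | h1 | h1
      · rw [h1, fam_last (by omega), hxY, brackets_L, if_neg (by omega), if_neg (by omega)]
      · rw [fam_succ (by omega), ← chain_succ, brackets_L, if_neg (by omega), if_neg (by omega)]
        exact Gr.eq_zero_of_mem_comp hbot (by omega)
          (Gr.natGraded.chain_mem h.mem_x h.mem_y (j + 1))
      · rw [fam_succ (by omega), ← chain_succ, brackets_L, if_pos (by omega),
          natExt_coe _ (by omega), fam_succ (by omega)]
    · rw [brackets_L, if_neg (by omega), natExt_coe _ (by omega), fam_last (by omega), fam,
        if_neg (by omega), if_neg (by omega)]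
      rcases (show j = 2 * n - 1 ∨ j ≤ 2 * n - 2 by omega) with rfl | h1
      · rw [fam_last (by omega), hcY, if_neg (by omega)]
      · rw [fam, if_neg (by omega), if_neg (by omega)]
        by_cases h2 : i + j = 2 * q + 1
        · rw [hmid i j hi (by omega) h2, if_pos (by omega)]
        · rw [hzero i j hi hij h1 h2, if_neg (by omega)]
  · rcases Nat.eq_zero_or_pos i with rfl | hi
    · obtain ⟨j, rfl⟩ : ∃ k, j = k + 1 := ⟨j - 1, by omega⟩
      rcases (show j + 1 = 2 * n - 1 ∨ j + 1 = 2 * n - 2 ∨ j + 1 ≤ 2 * n - 3 by omega) with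
        h1 | h1 | h1
      · rw [adapted_L, if_neg (by omega), if_pos (by omega), ← hXc]
        have hvX : ⁅natExt X 0, natExt X (j + 1)⁆ = ⁅x', Y'⁆ := by
          rw [hXc, natExt_coe _ (by omega), natExt_coe _ hj, fam_zero, h1, fam_last (by omega)]
        have hvm : ⁅x', Y'⁆ ∈ lcs 𝔤 (2 * q + 2) := by
          have := (hx.lie hz).mem_of_eq_zero hxY
          rwa [show 0 + 2 * q + 1 + 1 = 2 * q + 2 by omega] at this
        rw [hvX, fam_zero, h1, fam_last (by omega)]
        refine eq_sum_Icc X _ fun m hm => hcoord _ _ hvm m ?_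
        simp only [hd, fam, id]
        split_ifs <;> omega
      · rw [fam_zero, fam_succ (by omega), ← chain_succ, adapted_L, if_neg (by omega),
          if_neg (by omega), if_neg (by omega), if_neg (by omega), if_neg (by omega),
          if_neg (by omega), if_neg (by omega)]
        exact eq_zero_of_mem_lcs hbot (by omega) (hc (j + 1)).mem
      · rw [fam_zero, fam_succ (by omega), ← chain_succ, adapted_L, if_pos (by omega),
          natExt_coe _ (by omega), fam_succ (by omega)]
    · set v := ⁅fam n x' (chain x' y') Y' i, fam n x' (chain x' y') Y' j⁆ with hv
      have hvX : ⁅natExt X i, natExt X j⁆ = v := by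
        rw [hXc, natExt_coe _ (by omega), natExt_coe _ hj]
      have hXl : natExt X (2 * n - 1) = Y' := by
        rw [hXc, natExt_coe _ (by omega), fam_last (by omega)]
      rw [adapted_L, if_neg (by omega), if_neg (by omega), hvX, ← hXc]
      rcases (show j = 2 * n - 1 ∨ j ≤ 2 * n - 2 by omega) with rfl | h1
      · have hvm : v ∈ lcs 𝔤 (i + 2 * q + 1) := by
          have := ((hc (i - 1)).lie hz).mem_of_eq_zero (hcY _)
          rw [hv, fam, if_neg (by omega), if_neg (by omega), fam_last (by omega)]
          rwa [show i - 1 + 2 * q + 1 + 1 = i + 2 * q + 1 by omega] at this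
        rw [if_neg (by omega), if_neg (by omega)]
        split_ifs with h2
        · refine eq_sum_Icc X v fun m hm => hcoord _ v hvm m ?_
          simp only [hd, fam, id]
          split_ifs <;> omega
        · omega
        · omega
        · exact eq_zero_of_mem_lcs hbot (by omega) hvm
      · by_cases h2 : i + j = 2 * q + 1
        · rw [if_neg (by omega), if_neg (by omega), if_neg (by omega)]
          have hvs : HasSymbol (2 * q) v ((-1 : ℝ) ^ (i - 1) • Y) := by
            have := (hc (i - 1)).lie (hc (j - 1))
            rw [hmid i j hi (by omega) h2, show i - 1 + (j - 1) + 1 = 2 * q by omega] at this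
            rwa [hv, fam, if_neg (by omega), if_neg (by omega), fam, if_neg (by omega),
              if_neg (by omega)]
          split_ifs with h3 h4
          · rw [hXl, hv, h3.1, fam, if_neg (by omega), if_neg (by omega), fam, if_neg (by omega),
              if_neg (by omega), hY']
            rw [show j - 1 = 2 * q - 1 by omega]
            rfl
          -- Removing the leading term leaves an element of `𝔤^r`, which involves only `X_(r+1),
          -- ..., X_(2n-2)`.
          · refine eq_add_sum_Icc X v _ (by omega) fun m hm => ?_
            rw [hXl]
            refine hcoord _ _ (hvs.sub_mem (hz.smul _)) m ?_
            simp only [hd, fam, id]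
            split_ifs <;> omega
          · omega
        · have hvm : v ∈ lcs 𝔤 (i + j) := by
            have := ((hc (i - 1)).lie (hc (j - 1))).mem_of_eq_zero (hzero i j hi hij h1 h2)
            rw [hv, fam, if_neg (by omega), if_neg (by omega), fam, if_neg (by omega),
              if_neg (by omega)]
            rwa [show i - 1 + (j - 1) + 1 + 1 = i + j by omega] at this
          split_ifs with h3 h4
          · refine eq_sum_Icc X v fun m hm => hcoord _ v hvm m ?_
            simp only [hd, fam, id]
            split_ifs <;> omega
          · refine eq_sum_Icc X v fun m hm => hcoord _ v hvm m ?_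
            simp only [hd, fam, id]
            split_ifs <;> omega
          · omega
          · omega
          · omega
          · exact eq_zero_of_mem_lcs hbot (by omega) hvm

/-- The chain stops at `c (2q)` and `[x, Y]` spans the last component, so the family `b` has `[x,
Y]` in slot `2q + 1`. Since `𝔤^(2q+2) = 0`, relations in that component lift exactly: the chain of
representatives also vanishes at `2q + 1`, and the brackets with `i + j = 2n - 2` carry no
constants. -/
theorem TypeT.exists_adapted [Module.Finite ℝ 𝔤] {n q : ℕ} (hnq : n = q + 2)
    (hdim : Module.finrank ℝ 𝔤 = 2 * n) (hbot : lcs 𝔤 (2 * n - 2) = ⊥) {x y : Gr 𝔤}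
    (h : TypeT (Gr.comp 𝔤) q x y) :
    (∃ e : Module.Basis (Fin (2 * n)) ℝ (Gr 𝔤), HasBrackets e (brackets_T n)) ∧
      ∃ X : Module.Basis (Fin (2 * n)) ℝ 𝔤, ∃ C, HasBrackets X (adapted_T n C) := by
  obtain ⟨x', hx⟩ := Gr.mem_comp.mp h.mem_x
  obtain ⟨y', hy⟩ := Gr.mem_comp.mp h.mem_y
  have hq := h.one_le
  have hc := hx.chain hy
  obtain ⟨Y, hY⟩ : ∃ Y, Y = ⁅y, chain x y (2 * q - 1)⁆ := ⟨_, rfl⟩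
  obtain ⟨Y', hY'⟩ : ∃ Y', Y' = ⁅y', chain x' y' (2 * q - 1)⁆ := ⟨_, rfl⟩
  have hz : HasSymbol (2 * q) Y' Y := by
    have := hy.lie (hc (2 * q - 1))
    rwa [show 0 + (2 * q - 1) + 1 = 2 * q by omega, ← hY, ← hY'] at this
  have hU : HasSymbol (2 * q + 1) ⁅x', Y'⁆ ⁅x, Y⁆ := by
    simpa using hx.lie hz
  have hyY : ⁅y, Y⁆ = 0 := hY ▸ h.lie_y
  set b : ℕ → Gr 𝔤 := fun k => if k = 2 * q + 1 then ⁅x, Y⁆ else chain x y k with hb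
  set b' : ℕ → 𝔤 := fun k => if k = 2 * q + 1 then ⁅x', Y'⁆ else chain x' y' k with hb'
  have hbs : ∀ k, HasSymbol k (b' k) (b k) := by
    intro k
    simp only [hb, hb']
    split_ifs with hk
    · rw [hk]; exact hU
    · exact hc k
  have hbc : ∀ k, k ≠ 2 * q + 1 → b k = chain x y k := fun k hk => if_neg hk
  have hbc' : ∀ k, k ≠ 2 * q + 1 → b' k = chain x' y' k := fun k hk => if_neg hk
  have hbU : b (2 * q + 1) = ⁅x, Y⁆ := if_pos rfl
  have hbU' : b' (2 * q + 1) = ⁅x', Y'⁆ := if_pos rfl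
  set d : ℕ → ℕ := fam n 0 id (2 * q) with hd
  have hX : ∀ i : Fin (2 * n), HasSymbol (d i) (fam n x' b' Y' i) (fam n x b Y i) := by
    intro i
    simp only [hd, fam]
    split_ifs
    exacts [hx, hz, hbs _]
  have hsp : ∀ k, Gr.comp 𝔤 k ≤ span ℝ ((fun i : Fin (2 * n) => fam n x b Y i) ''
      {i : Fin (2 * n) | d i = k}) := by
    intro k
    rcases (show k = 0 ∨ k = 2 * q ∨ k = 2 * q + 1 ∨ (1 ≤ k ∧ k < 2 * q) ∨ 2 * n - 2 ≤ k by omega)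
      with rfl | rfl | rfl | hk | hk
    · refine comp_le_of_forall_mem h.span_zero ?_
      rintro s (rfl | rfl)
      · exact ⟨⟨0, by omega⟩, rfl, rfl⟩
      · exact ⟨⟨0 + 1, by omega⟩, fam_succ (by omega) _ _ _,
          (fam_succ (by omega) _ _ _).trans (hbc 0 (by omega))⟩
    · refine comp_le_of_forall_mem h.span_mid ?_
      rw [← hY]
      rintro s (rfl | rfl)
      · exact ⟨⟨2 * q + 1, by omega⟩, fam_succ (by omega) _ _ _,
          (fam_succ (by omega) _ _ _).trans (hbc _ (by omega))⟩
      · exact ⟨⟨2 * n - 1, by omega⟩, fam_last (by omega) _ _ _, fam_last (by omega) _ _ _⟩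
    · refine comp_le_of_forall_mem h.span_top ?_
      rw [← hY]
      rintro s rfl
      exact ⟨⟨2 * q + 1 + 1, by omega⟩, fam_succ (by omega) _ _ _,
        (fam_succ (by omega) _ _ _).trans hbU⟩
    · refine comp_le_of_forall_mem (h.span_chain k hk.1 hk.2) ?_
      rintro s rfl
      exact ⟨⟨k + 1, by omega⟩, fam_succ (by omega) _ _ _,
        (fam_succ (by omega) _ _ _).trans (hbc _ (by omega))⟩
    · intro e he
      rw [Gr.eq_zero_of_mem_comp hbot hk he]
      exact zero_mem _
  obtain ⟨X, hXc, hcoord, e, he⟩ := exists_basis_of_symbols hdim hbot hX hsp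
  have hmid : ∀ p s, p + s = 2 * q - 1 → ⁅chain x y p, chain x y s⁆ = (-1 : ℝ) ^ p • Y := by
    intro p s hps
    rw [hY]
    exact (h.comm (2 * q - 1) (by omega)).lie_eq (by omega) hps
  have hbm : ∀ k, b k ∈ Gr.comp 𝔤 k := fun k => Gr.mem_comp.mpr ⟨_, hbs k⟩
  -- the brackets of the members of the family with positive indices
  have hgr : ∀ i j, 1 ≤ i → i < j → j ≤ 2 * n - 2 → ⁅b (i - 1), b (j - 1)⁆ =
      if i + j = 2 * n - 3 then (-1 : ℝ) ^ (i - 1) • Y else if i + j = 2 * n - 2 then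
        ((-1 : ℝ) ^ (i - 1) * ((n : ℝ) - 1 - i)) • ⁅x, Y⁆ else 0 := by
    intro i j hi hij hj
    rcases (show i + j ≤ 2 * n - 2 ∨ 2 * n - 2 < i + j by omega) with hl | hl
    · rw [hbc _ (by omega), hbc _ (by omega)]
      split_ifs with h1 h2
      · exact hmid _ _ (by omega)
      -- With `p = i - 1` and `q = n - 2`, the coefficient `q - p` is `n - 1 - i`.
      · rw [lie_chain_of_alternating (N := 2 * q - 1) (κ := q) (by omega) hmid (by omega)]
        congr 2
        rw [hnq]
        push_cast [hi]
        ring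
      · exact h.comm (i + j - 1) (by omega) _ _ (by omega)
    · rw [if_neg (by omega), if_neg (by omega)]
      exact Gr.eq_zero_of_mem_comp hbot (show 2 * n - 2 ≤ i - 1 + (j - 1) + 1 by omega)
        (Gr.natGraded.lie_mem (hbm _) (hbm _))
  have hlast : ∀ i, 1 ≤ i → ⁅b (i - 1), Y⁆ = 0 := by
    intro i hi
    rcases (show i = 1 ∨ 2 ≤ i by omega) with rfl | h2
    · rw [hbc _ (by omega)]
      exact hyY
    · exact Gr.eq_zero_of_mem_comp hbot (show 2 * n - 2 ≤ i - 1 + 2 * q + 1 by omega)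
        (Gr.natGraded.lie_mem (hbm _) (Gr.mem_comp.mpr ⟨_, hz⟩))
  have htop' : chain x' y' (2 * q + 1) = 0 :=
    eq_zero_of_mem_lcs hbot (by omega) ((hc _).mem_of_eq_zero h.chain_top)
  have hxU : ⁅x, ⁅x, Y⁆⁆ = 0 :=
    Gr.eq_zero_of_mem_comp hbot (show 2 * n - 2 ≤ 0 + (2 * q + 1) + 1 by omega)
      (Gr.natGraded.lie_mem h.mem_x (Gr.mem_comp.mpr ⟨_, hU⟩))
  have hxU' : ⁅x', ⁅x', Y'⁆⁆ = 0 :=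
    eq_zero_of_mem_lcs hbot (show 2 * n - 2 ≤ 0 + (2 * q + 1) + 1 by omega) (hx.lie hU).mem
  refine ⟨⟨e, hasBrackets_of he fun i j hij hj => ?_⟩, X, fun i j k => natExt (X.repr
    ⁅natExt X i, natExt X j⁆) k, hasBrackets_of hXc fun i j hij hj => ?_⟩
  · rcases Nat.eq_zero_or_pos i with rfl | hi
    · obtain ⟨j, rfl⟩ : ∃ k, j = k + 1 := ⟨j - 1, by omega⟩
      rw [fam_zero]
      rcases (show j + 1 = 2 * n - 1 ∨ j = 2 * q + 1 ∨ j = 2 * q ∨ j + 1 ≤ 2 * n - 4 by omega) with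
        h1 | rfl | rfl | h1
      · rw [h1, fam_last (by omega), brackets_T, if_neg (by omega), if_pos (by omega),
          natExt_coe _ (by omega), show 2 * n - 2 = 2 * q + 1 + 1 by omega, fam_succ (by omega), hbU]
      · rw [fam_succ (by omega), hbU, hxU, brackets_T, if_neg (by omega), if_neg (by omega),
          if_neg (by omega), if_neg (by omega)]
      · rw [fam_succ (by omega), hbc _ (by omega), ← chain_succ, h.chain_top, brackets_T,
          if_neg (by omega), if_neg (by omega), if_neg (by omega), if_neg (by omega)]
      · rw [fam_succ (by omega), hbc _ (by omega), ← chain_succ, brackets_T, if_pos (by omega),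
          natExt_coe _ (by omega), fam_succ (by omega), hbc _ (by omega)]
    · rw [brackets_T, if_neg (by omega), if_neg (by omega), natExt_coe _ (by omega),
        natExt_coe _ (by omega), fam_last (by omega), fam, if_neg (by omega), if_neg (by omega),
        show 2 * n - 2 = 2 * q + 1 + 1 by omega, fam_succ (by omega), hbU]
      rcases (show j = 2 * n - 1 ∨ j ≤ 2 * n - 2 by omega) with rfl | h1
      · rw [fam_last (by omega), hlast i hi, if_neg (by omega), if_neg (by omega)]
      · rw [fam, if_neg (by omega), if_neg (by omega), hgr i j hi hij h1]
        split_ifs <;> first | omega | rfl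
  · rcases Nat.eq_zero_or_pos i with rfl | hi
    · obtain ⟨j, rfl⟩ : ∃ k, j = k + 1 := ⟨j - 1, by omega⟩
      rw [fam_zero]
      rcases (show j + 1 = 2 * n - 1 ∨ j = 2 * q + 1 ∨ j = 2 * q ∨ j + 1 ≤ 2 * n - 4 by omega) with
        h1 | rfl | rfl | h1
      · rw [h1, fam_last (by omega), adapted_T, if_neg (by omega), if_pos (by omega),
          natExt_coe _ (by omega), show 2 * n - 2 = 2 * q + 1 + 1 by omega, fam_succ (by omega),
          hbU']
      · rw [fam_succ (by omega), hbU', hxU', adapted_T, if_neg (by omega), if_neg (by omega),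
          if_neg (by omega), if_neg (by omega), if_neg (by omega), if_neg (by omega)]
      · rw [fam_succ (by omega), hbc' _ (by omega), ← chain_succ, htop', adapted_T,
          if_neg (by omega), if_neg (by omega), if_neg (by omega), if_neg (by omega),
          if_neg (by omega), if_neg (by omega)]
      · rw [fam_succ (by omega), hbc' _ (by omega), ← chain_succ, adapted_T, if_pos (by omega),
          natExt_coe _ (by omega), fam_succ (by omega), hbc' _ (by omega)]
    · set v := ⁅fam n x' b' Y' i, fam n x' b' Y' j⁆ with hv
      have hvX : ⁅natExt X i, natExt X j⁆ = v := by
        rw [hXc, natExt_coe _ (by omega), natExt_coe _ hj]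
      have hXl : natExt X (2 * n - 1) = Y' := by
        rw [hXc, natExt_coe _ (by omega), fam_last (by omega)]
      have hXU : natExt X (2 * n - 2) = ⁅x', Y'⁆ := by
        rw [hXc, natExt_coe _ (by omega), show 2 * n - 2 = 2 * q + 1 + 1 by omega,
          fam_succ (by omega), hbU']
      rw [adapted_T, if_neg (by omega), if_neg (by omega), hvX, ← hXc]
      rcases (show j = 2 * n - 1 ∨ j ≤ 2 * n - 2 by omega) with rfl | h1
      · have hv0 : v = 0 := by
          have := ((hbs (i - 1)).lie hz).mem_of_eq_zero (hlast i hi)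
          rw [hv, fam, if_neg (by omega), if_neg (by omega), fam_last (by omega)]
          exact eq_zero_of_mem_lcs hbot (by omega) this
        rw [if_neg (by omega), if_neg (by omega), if_neg (by omega), if_neg (by omega), hv0]
      · have hvb : v = ⁅b' (i - 1), b' (j - 1)⁆ := by
          rw [hv, fam, if_neg (by omega), if_neg (by omega), fam, if_neg (by omega),
            if_neg (by omega)]
        have hvs : HasSymbol (i + j - 1) v ⁅b (i - 1), b (j - 1)⁆ := by
          have := (hbs (i - 1)).lie (hbs (j - 1))
          rwa [← hvb, show i - 1 + (j - 1) + 1 = i + j - 1 by omega] at this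
        rw [hgr i j hi hij h1] at hvs
        rcases (show i + j ≤ 2 * n - 4 ∨ i + j = 2 * n - 3 ∨ i + j = 2 * n - 2 ∨ 2 * n - 2 < i + j
          by omega) with h2 | h2 | h2 | h2
        · rw [if_neg (by omega), if_neg (by omega)] at hvs
          rw [if_pos (by omega)]
          refine eq_sum_Icc X v fun m hm => hcoord _ v hvs.mem_succ m ?_
          simp only [hd, fam, id]
          split_ifs <;> omega
        · rw [if_pos h2, show i + j - 1 = 2 * q by omega] at hvs
          rw [if_neg (by omega)]
          split_ifs with h3 h4
          · rw [hXl, hvb, h3.1, hbc' _ (by omega), hbc' _ (by omega), hY',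
              show j - 1 = 2 * q - 1 by omega]
            rfl
          -- The remainder lies in `𝔤^(2n-3)`, which is spanned by `X_(2n-2)` alone.
          · have := eq_add_sum_Icc X v ((-1 : ℝ) ^ (i - 1)) (p := 2 * n - 1) (lo := 2 * n - 2)
              (hi := 2 * n - 2) (by omega) fun m hm => by
                rw [hXl]
                refine hcoord _ _ (hvs.sub_mem (hz.smul _)) m ?_
                simp only [hd, fam, id]
                split_ifs <;> omega
            rwa [Finset.Icc_self, Finset.sum_singleton] at this
          · omega
          · omega
        · rw [if_neg (by omega), if_pos h2] at hvs
          rw [if_neg (by omega), if_neg (by omega), if_neg (by omega), if_pos (by omega), hXU,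
            ← sub_eq_zero]
          rw [show i + j - 1 = 2 * q + 1 by omega] at hvs
          exact eq_zero_of_mem_lcs hbot (by omega) (hvs.sub_mem (hU.smul _))
        · rw [if_neg (by omega), if_neg (by omega), if_neg (by omega), if_neg (by omega)]
          exact eq_zero_of_mem_lcs hbot (by omega) hvs.mem

/-- Formulated for an arbitrary Lie algebra so that the same table check serves `gr 𝔤` and `𝔤`. -/
theorem fam_brackets_N {H : Type*} [LieRing H] {x y Y : H} (hx : ⁅x, chain x y 3⁆ = 0)
    (hxY : ⁅x, Y⁆ = 0) (hy : ⁅y, chain x y 1⁆ = Y) (hyY : ⁅y, Y⁆ = chain x y 3)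
    (hc : ∀ p q, 2 ≤ p + q → p < q → ⁅chain x y p, chain x y q⁆ = 0)
    (hcY : ∀ p, 1 ≤ p → ⁅chain x y p, Y⁆ = 0) [Module ℝ H] {i j : ℕ} (hij : i < j) (hj : j < 6) :
    ⁅fam 3 x (chain x y) Y i, fam 3 x (chain x y) Y j⁆ =
      brackets_N (natExt fun i : Fin 6 => fam 3 x (chain x y) Y i) i j := by
  interval_cases j <;> interval_cases i
  · rfl
  · rfl
  · exact hy
  · rfl
  · exact hc 0 2 (by omega) (by omega)
  · exact hc 1 2 (by omega) (by omega)
  · exact hx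
  · exact hc 0 3 (by omega) (by omega)
  · exact hc 1 3 (by omega) (by omega)
  · exact hc 2 3 (by omega) (by omega)
  · exact hxY
  · exact hyY
  · exact hcY 1 le_rfl
  · exact hcY 2 (by omega)
  · exact hcY 3 (by omega)

/-- There is no room for constants: `c 1`, `c 2`, `c 3` and `Y` are defined by brackets, and all
other relations live at index three or higher, where `𝔤^4 = 0` makes them exact. -/
theorem TypeN.exists_adapted [Module.Finite ℝ 𝔤]
    (hdim : Module.finrank ℝ 𝔤 = 6) (hbot : lcs 𝔤 4 = ⊥) {x y : Gr 𝔤}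
    (h : TypeN (Gr.comp 𝔤) x y) :
    (∃ e : Module.Basis (Fin 6) ℝ (Gr 𝔤), HasBrackets e brackets_N) ∧
      ∃ X : Module.Basis (Fin 6) ℝ 𝔤, HasBrackets X brackets_N := by
  obtain ⟨x', hx⟩ := Gr.mem_comp.mp h.mem_x
  obtain ⟨y', hy⟩ := Gr.mem_comp.mp h.mem_y
  have hc := hx.chain hy
  obtain ⟨Y, hY⟩ : ∃ Y, Y = ⁅y, chain x y 1⁆ := ⟨_, rfl⟩
  obtain ⟨Y', hY'⟩ : ∃ Y', Y' = ⁅y', chain x' y' 1⁆ := ⟨_, rfl⟩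
  have hz : HasSymbol 2 Y' Y := by
    rw [hY, hY']
    simpa using hy.lie (hc 1)
  have hX : ∀ i : Fin 6, HasSymbol (fam 3 0 id 2 i) (fam 3 x' (chain x' y') Y' i)
      (fam 3 x (chain x y) Y i) := by
    intro i
    simp only [fam]
    split_ifs
    exacts [hx, hz, hc _]
  have hsp : ∀ k, Gr.comp 𝔤 k ≤ span ℝ ((fun i : Fin 6 => fam 3 x (chain x y) Y i) ''
      {i : Fin 6 | fam 3 0 id 2 i = k}) := by
    intro k
    rcases (show k = 0 ∨ k = 1 ∨ k = 2 ∨ k = 3 ∨ 4 ≤ k by omega) with rfl | rfl | rfl | rfl | hk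
    · refine comp_le_of_forall_mem h.span_zero ?_
      rintro s (rfl | rfl)
      exacts [⟨0, rfl, rfl⟩, ⟨1, rfl, rfl⟩]
    · refine comp_le_of_forall_mem h.span_one ?_
      rintro s rfl
      exact ⟨2, rfl, rfl⟩
    · refine comp_le_of_forall_mem h.span_two ?_
      rw [← hY]
      rintro s (rfl | rfl)
      exacts [⟨3, rfl, rfl⟩, ⟨5, rfl, rfl⟩]
    · refine comp_le_of_forall_mem h.span_three ?_
      rintro s rfl
      exact ⟨4, rfl, rfl⟩
    · intro e he
      rw [Gr.eq_zero_of_mem_comp hbot hk he]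
      exact zero_mem _
  obtain ⟨X, hXc, -, e, he⟩ := exists_basis_of_symbols hdim hbot hX hsp
  have hzero : ∀ {k : ℕ} {v : 𝔤} {u : Gr 𝔤}, HasSymbol k v u → 4 ≤ k ∨ (k = 3 ∧ u = 0) →
      v = 0 := by
    rintro k v u hv (hk | ⟨rfl, hu⟩)
    · exact eq_zero_of_mem_lcs hbot hk hv.mem
    · exact eq_zero_of_mem_lcs hbot le_rfl (hv.mem_of_eq_zero hu)
  have hzero' : ∀ {k : ℕ} {v : 𝔤} {u : Gr 𝔤}, HasSymbol k v u → 4 ≤ k → u = 0 :=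
    fun hv hk => Gr.eq_zero_of_mem_comp hbot hk (Gr.mem_comp.mpr ⟨_, hv⟩)
  have hxY := h.lie_x
  have hyY := h.lie_y
  have hy2 := h.lie_y_two
  rw [← hY] at hxY hyY
  have hxY' : ⁅x', Y'⁆ = 0 := hzero (hx.lie hz) (Or.inr ⟨rfl, hxY⟩)
  have hy2' : ⁅y', chain x' y' 2⁆ = 0 := hzero (hy.lie (hc 2)) (Or.inr ⟨rfl, hy2⟩)
  have hyY' : ⁅y', Y'⁆ = chain x' y' 3 := by
    rw [← sub_eq_zero]
    have := (hy.lie hz).sub (hc 3)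
    exact hzero this (Or.inr ⟨rfl, by rw [hyY, sub_self]⟩)
  refine ⟨⟨e, hasBrackets_of he fun i j hij hj => ?_⟩, X, hasBrackets_of hXc fun i j hij hj => ?_⟩
  · refine fam_brackets_N ?_ hxY hY.symm hyY (fun p q hp _ => ?_) (fun p hp => ?_) hij hj
    · exact hzero' (hx.lie (hc 3)) (by omega)
    · rcases (show p = 0 ∧ q = 2 ∨ 3 ≤ p + q by omega) with ⟨rfl, rfl⟩ | h3
      · exact hy2
      · exact hzero' ((hc p).lie (hc q)) (by omega)
    · exact hzero' ((hc p).lie hz) (by omega)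
  · refine fam_brackets_N ?_ hxY' hY'.symm hyY' (fun p q hp _ => ?_) (fun p hp => ?_) hij hj
    · exact hzero (hx.lie (hc 3)) (Or.inl (by omega))
    · rcases (show p = 0 ∧ q = 2 ∨ 3 ≤ p + q by omega) with ⟨rfl, rfl⟩ | h3
      · exact hy2'
      · exact hzero ((hc p).lie (hc q)) (Or.inl (by omega))
    · exact hzero ((hc p).lie hz) (Or.inl (by omega))

end Adapted

/-! ### The classification with adapted bases -/

section Classification

variable {𝔤 : Type*} [LieRing 𝔤] [LieAlgebra ℝ 𝔤]

/-- The possible brackets of `gr 𝔤`, together with those of an adapted basis. -/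
theorem IsQuasiFiliform.exists_adapted {n : ℕ} (hdim : Module.finrank ℝ 𝔤 = 2 * n)
    (hq : IsQuasiFiliform 𝔤) :
    (2 ≤ n ∧ (∃ e : Module.Basis (Fin (2 * n)) ℝ (Gr 𝔤), HasBrackets e (brackets_LR n)) ∧
      ∃ X : Module.Basis (Fin (2 * n)) ℝ 𝔤, ∃ C, HasBrackets X (adapted_LR n C)) ∨
    (∃ r, Odd r ∧ r + 3 ≤ 2 * n ∧ 3 ≤ r ∧
      (∃ e : Module.Basis (Fin (2 * n)) ℝ (Gr 𝔤), HasBrackets e (brackets_L n r)) ∧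
      ∃ X : Module.Basis (Fin (2 * n)) ℝ 𝔤, ∃ C, HasBrackets X (adapted_L n r C)) ∨
    (3 ≤ n ∧ (∃ e : Module.Basis (Fin (2 * n)) ℝ (Gr 𝔤), HasBrackets e (brackets_T n)) ∧
      ∃ X : Module.Basis (Fin (2 * n)) ℝ 𝔤, ∃ C, HasBrackets X (adapted_T n C)) ∨
    (n = 3 ∧ (∃ e : Module.Basis (Fin 6) ℝ (Gr 𝔤), HasBrackets e brackets_N) ∧
      ∃ X : Module.Basis (Fin 6) ℝ 𝔤, HasBrackets X brackets_N) := by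
  obtain ⟨hn, hbot, hd⟩ := hq.dims hdim
  have hfin : Module.Finite ℝ 𝔤 := Module.finite_of_finrank_pos (by omega)
  have hodd : Odd (2 * n - 3) := ⟨n - 2, by omega⟩
  rcases hd with ⟨h3, h1⟩ | ⟨h2, ρ, hρ, hρM, hρ2, h1⟩
  · obtain ⟨x, y, z, h⟩ := Gr.natGraded.exists_typeLR hodd h3 h1
    exact Or.inl ⟨hn, h.exists_adapted hn hdim hbot⟩
  · rcases Gr.natGraded.classify hodd h2 hρ hρM hρ2 h1 with
      ⟨q, x, y, h⟩ | ⟨q, hM, x, y, h⟩ | ⟨hM, x, y, h⟩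
    · have := h.one_le
      have := h.lt
      exact Or.inr (Or.inl ⟨2 * q + 1, ⟨q, rfl⟩, by omega, by omega, h.exists_adapted hdim hbot⟩)
    · have := h.one_le
      exact Or.inr (Or.inr (Or.inl
        ⟨by omega, h.exists_adapted (show n = q + 2 by omega) hdim hbot⟩))
    · obtain rfl : n = 3 := by omega
      exact Or.inr (Or.inr (Or.inr ⟨rfl, h.exists_adapted hdim hbot⟩))

end Classification

/-! ### Mutual exclusion of the types with two generators -/

section Disjoint

variable {H : Type*} [LieRing H] [LieAlgebra ℝ H]

/-- `r - 1` is the largest `k` for which `H^k` contains two independent central elements. -/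
theorem eq_of_hasBrackets_L {n r s : ℕ} (hr : 3 ≤ r) (hrn : r + 3 ≤ 2 * n) (hs : 3 ≤ s)
    (hsn : s + 3 ≤ 2 * n) {X Y : Module.Basis (Fin (2 * n)) ℝ H}
    (hX : HasBrackets X (brackets_L n r)) (hY : HasBrackets Y (brackets_L n s)) : r = s := by
  by_contra hne
  rcases lt_or_gt_of_ne hne with h | h
  · exact not_hasTwoCentral_L hrn hr hX ((hasTwoCentral_L hsn hs hY).mono (by omega))
  · exact not_hasTwoCentral_L hsn hs hY ((hasTwoCentral_L hrn hr hX).mono (by omega))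

theorem not_hasBrackets_T_of_L {n r : ℕ} (hr : 3 ≤ r) (hrn : r + 3 ≤ 2 * n)
    {X Y : Module.Basis (Fin (2 * n)) ℝ H} (hX : HasBrackets X (brackets_L n r)) :
    ¬HasBrackets Y (brackets_T n) := fun hY =>
  not_hasTwoCentral_T (by omega) hY ((hasTwoCentral_L hrn hr hX).mono (Nat.zero_le _))

theorem not_hasBrackets_N_of_L {n r : ℕ} (hr : 3 ≤ r) (hrn : r + 3 ≤ 2 * n)
    {X : Module.Basis (Fin (2 * n)) ℝ H} {Y : Module.Basis (Fin 6) ℝ H}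
    (hX : HasBrackets X (brackets_L n r)) : ¬HasBrackets Y brackets_N := fun hY =>
  not_hasTwoCentral_N hY ((hasTwoCentral_L hrn hr hX).mono (Nat.zero_le _))

theorem not_hasBrackets_N_of_T {n : ℕ} {X : Module.Basis (Fin (2 * n)) ℝ H}
    {Y : Module.Basis (Fin 6) ℝ H} (hX : HasBrackets X (brackets_T n)) :
    ¬HasBrackets Y brackets_N := fun hY => by
  obtain rfl : n = 3 := by
    have h1 := Module.finrank_eq_card_basis X
    have h2 := Module.finrank_eq_card_basis Y
    simp only [Fintype.card_fin] at h1 h2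
    omega
  exact not_hasIsotropic_N hY (hasIsotropic_T hX)

end Disjoint

end QuasiFiliform

end

theorem mainTheorem6 {𝔤 : Type*} [LieRing 𝔤] [LieAlgebra ℝ 𝔤] (n : ℕ)
    (hdim : Module.finrank ℝ 𝔤 = 2 * n) (hq : QuasiFiliform.IsQuasiFiliform 𝔤) :
    -- the four possibilities for `gr 𝔤`
    ((2 ≤ n ∧ Nonempty (QuasiFiliform.Gr 𝔤 ≃ₗ⁅ℝ⁆ (QuasiFiliform.tableLR n).Alg)) ∨
      (∃ (r : ℕ) (hr : Odd r) (hrn : r + 3 ≤ 2 * n), 3 ≤ n ∧ 3 ≤ r ∧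
        Nonempty (QuasiFiliform.Gr 𝔤 ≃ₗ⁅ℝ⁆ (QuasiFiliform.tableL n r hr hrn).Alg)) ∨
      (∃ hn : 3 ≤ n,
        Nonempty (QuasiFiliform.Gr 𝔤 ≃ₗ⁅ℝ⁆ (QuasiFiliform.tableT n hn).Alg)) ∨
      (n = 3 ∧ Nonempty (QuasiFiliform.Gr 𝔤 ≃ₗ⁅ℝ⁆ QuasiFiliform.tableN.Alg))) ∧
    -- the adapted basis
    ∃ X : Module.Basis (Fin (2 * n)) ℝ 𝔤,
      (Nonempty (QuasiFiliform.Gr 𝔤 ≃ₗ⁅ℝ⁆ (QuasiFiliform.tableLR n).Alg) →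
        ∃ C : ℕ → ℕ → ℕ → ℝ,
          QuasiFiliform.HasBrackets X (QuasiFiliform.adapted_LR n C)) ∧
      (∀ (r : ℕ) (hr : Odd r) (hrn : r + 3 ≤ 2 * n), 3 ≤ r →
        Nonempty (QuasiFiliform.Gr 𝔤 ≃ₗ⁅ℝ⁆ (QuasiFiliform.tableL n r hr hrn).Alg) →
        ∃ C : ℕ → ℕ → ℕ → ℝ,
          QuasiFiliform.HasBrackets X (QuasiFiliform.adapted_L n r C)) ∧
      (∀ hn : 3 ≤ n,
        Nonempty (QuasiFiliform.Gr 𝔤 ≃ₗ⁅ℝ⁆ (QuasiFiliform.tableT n hn).Alg) →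
        ∃ C : ℕ → ℕ → ℕ → ℝ,
          QuasiFiliform.HasBrackets X (QuasiFiliform.adapted_T n C)) ∧
      (Nonempty (QuasiFiliform.Gr 𝔤 ≃ₗ⁅ℝ⁆ QuasiFiliform.tableN.Alg) →
        Nonempty (𝔤 ≃ₗ⁅ℝ⁆ QuasiFiliform.tableN.Alg) ∧
          QuasiFiliform.HasBrackets X QuasiFiliform.brackets_N) := by
  simp only [QuasiFiliform.equiv_tableLR_iff, QuasiFiliform.equiv_tableL_iff,
    QuasiFiliform.equiv_tableT_iff, QuasiFiliform.equiv_tableN_iff]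
  -- The type that occurs supplies the basis `X`; the implications for the other types, and for
  -- other values of `r`, hold vacuously by the invariants.
  rcases hq.exists_adapted hdim with ⟨hn, ⟨e, he⟩, X, C, hX⟩ | ⟨r, hr, hrn, hr3, ⟨e, he⟩, X, C, hX⟩ |
    ⟨hn, ⟨e, he⟩, X, C, hX⟩ | ⟨rfl, ⟨e, he⟩, X, hX⟩
  · have h3 := QuasiFiliform.hasThreeGenerators_LR hn he
    refine ⟨Or.inl ⟨hn, e, he⟩, X, fun _ => ⟨C, hX⟩, ?_, ?_, ?_⟩
    · rintro s - hsn hs ⟨e', he'⟩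
      exact absurd h3 (QuasiFiliform.not_hasThreeGenerators_L hsn hs he')
    · rintro hn ⟨e', he'⟩
      exact absurd h3 (QuasiFiliform.not_hasThreeGenerators_T hn he')
    · rintro ⟨e', he'⟩
      exact absurd h3 (QuasiFiliform.not_hasThreeGenerators_N he')
  · refine ⟨Or.inr (Or.inl ⟨r, hr, hrn, by omega, hr3, e, he⟩), X, ?_, ?_, ?_, ?_⟩
    · rintro ⟨e', he'⟩
      exact absurd (QuasiFiliform.hasThreeGenerators_LR (by omega) he')
        (QuasiFiliform.not_hasThreeGenerators_L hrn hr3 he)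
    · rintro s - hsn hs ⟨e', he'⟩
      obtain rfl := QuasiFiliform.eq_of_hasBrackets_L hr3 hrn hs hsn he he'
      exact ⟨C, hX⟩
    · rintro - ⟨e', he'⟩
      exact absurd he' (QuasiFiliform.not_hasBrackets_T_of_L hr3 hrn he)
    · rintro ⟨e', he'⟩
      exact absurd he' (QuasiFiliform.not_hasBrackets_N_of_L hr3 hrn he)
  · refine ⟨Or.inr (Or.inr (Or.inl ⟨hn, e, he⟩)), X, ?_, ?_, fun _ _ => ⟨C, hX⟩, ?_⟩
    · rintro ⟨e', he'⟩
      exact absurd (QuasiFiliform.hasThreeGenerators_LR (by omega) he')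
        (QuasiFiliform.not_hasThreeGenerators_T hn he)
    · rintro s - hsn hs ⟨e', he'⟩
      exact absurd he (QuasiFiliform.not_hasBrackets_T_of_L hs hsn he')
    · rintro ⟨e', he'⟩
      exact absurd he' (QuasiFiliform.not_hasBrackets_N_of_T he)
  · refine ⟨Or.inr (Or.inr (Or.inr ⟨rfl, e, he⟩)), X, ?_, ?_, ?_, fun _ => ⟨⟨X, hX⟩, hX⟩⟩
    · rintro ⟨e', he'⟩
      exact absurd (QuasiFiliform.hasThreeGenerators_LR (by omega) he')
        (QuasiFiliform.not_hasThreeGenerators_N he)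
    · rintro s - hsn hs ⟨e', he'⟩
      exact absurd he (QuasiFiliform.not_hasBrackets_N_of_L hs hsn he')
    · rintro - ⟨e', he'⟩
      exact absurd he (QuasiFiliform.not_hasBrackets_N_of_T he')
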